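/- **Definitions.** A *mean-payoff game (MPG) with limited observation* $G=\langle Q,q_I,\Sigma,\Delta,w,Obs\rangle$ consists of a finite set $Q$ of states, an initial state $q_I\in Q$, a finite non-empty set $\Sigma$ of actions, a total transition relation $\Delta\subseteq Q\times\Sigma\times Q$, weights $w:\Delta\to\mathbb Z$, and a partition $Obs$ of $Q$ such that $\{q_I\}\in Obs$ and, for all $o\in Obs$ and $\sigma\in\Sigma$, the set $\mathrm{post}_\sigma(o)$ of $\sigma$-successors of states in $o$ is a union of elements of $Obs$. Eve *wins* $G$ if she has an observation-based strategy (a function from finite prefixes $o_0\sigma_0\dots o_n$ of plays to $\Sigma$) such that for every infinite play $o_0\sigma_0o_1\sigma_1\dots$ consistent with it (starting in $o_0=\{q_I\}$), every concrete path $q_0\sigma_0q_1\sigma_1\dots$ with $q_i\in o_i$ and $(q_i,\sigma_i,q_{i+1})\in\Delta$ satisfies $\liminf_{n}\frac1n\sum_{i<n}w(q_i,\sigma_i,q_{i+1})\ge 0$. Let $\mathcal F$ be the set of functions $f:Q\to\mathbb Z\cup\{+\infty,\bot\}$ and $\mathrm{supp}(f)=\{q: f(q)\ne\bot\}$. Call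 $f'$ a $\sigma$-successor of $f$ if $\mathrm{supp}(f')\in Obs$, $\mathrm{supp}(f')\subseteq\mathrm{post}_\sigma(\mathrm{supp}(f))$, and for each $q\in\mathrm{supp}(f')$ the value $f'(q)$ is either $+\infty$ or $\min\{f(q')+w(q',\sigma,q): q'\in\mathrm{supp}(f),\,(q',\sigma,q)\in\Delta\}$. Write $f\preceq_k f'$ if $\mathrm{supp}(f)=\mathrm{supp}(f')$ and $f(q)+k\le f'(q)$ for all $q\in\mathrm{supp}(f)$. Let $f_I(q_I)=0$ and $f_I(q)=\bot$ for $q\neq q_I$. The *reachability game* $\Gamma_G$ has as positions the finite sequences $f_0\sigma_0f_1\dots\sigma_{n-1}f_n$ with $f_0=f_I$, each $f_{i+1}$ a $\sigma_i$-successor of $f_i$, and $f_i\not\preceq_0f_j$ and $f_j\not\preceq_1f_i$ for all $0\le i<j<n$. From the initial position $f_I$, Eve repeatedly chooses an action $\sigma$ and Adam extends the current position $x$ to a position $x\sigma f$. The play stops, and Eve wins it, at a position in which $f_i\preceq_0f_n$ for some $i<n$; it stops, and Adam wins it, at a position in which, for some $i<n$, $f_n\preceq_1f_i$ and $f_i(q)\neq+\infty$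 for some $q\in\mathrm{supp}(f_i)$. Infinite plays are won by neither player. A player *wins* $\Gamma_G$ if (s)he has a strategy all of whose consistent plays (s)he wins. The game $G$ is *forcibly terminating* if Eve or Adam wins $\Gamma_G$. **Theorem.** 1. There is a polynomial-time computable function that maps every deterministic Turing machine $M$ (with distinct accept and reject states) together with an input word $u$ (the case $u=\varepsilon$ being $M$ started on the blank tape) to an MPG with limited observation $G$ such that Eve wins $\Gamma_G$ if and only if $M$, started on $u$, halts in the accept state, and Adam wins $\Gamma_G$ if and only if $M$, started on $u$, halts in the reject state. 2. (Class membership.) It is undecidable whether a given MPG with limited observation is forcibly terminating. 3. (Winner determination.) The problem of determining, for a given forcibly terminating MPG $G$, whether Eve wins $G$ is complete, under polynomial-time reductions, for the class of all decidable problems. That is, there is an algorithm that, given the code of any forcibly terminating MPG $G$, halts and correctly tells whether Eve wins $G$; and for every decidable language $L\subseteq\{0,1\}^*$ there is a polynomial-time computable function $f$ from $\{0,1\}^*$ to MPGs with limited observation such that, for all $u$, $f(u)$ is forcibly terminating, and $u\in L$ if and only if Eve wins $f(u)$. -/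

import Mathlib

open Filter

/-! ## Mean-payoff games with partial observation and with limited observation -/

/-- A mean-payoff game with partial observation, with states `Q` and actions `A`. The weight
function is only ever evaluated on transitions. -/
structure MPG (Q A : Type) where
  init : Q
  Δ : Set (Q × A × Q)
  w : Q × A × Q → ℤ
  Obs : Set (Set Q)
  obs_partition : Setoid.IsPartition Obs
  total : ∀ q a, ∃ q', (q, a, q') ∈ Δ

namespace MPG

variable {Q A : Type} (G : MPG Q A)

/-- The `a`-successors of a set of states. -/
def post (a : A) (s : Set Q) : Set Q := {q' | ∃ q ∈ s, (q, a, q') ∈ G.Δ}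

/-- Limited observation: the initial state is observed, and the `a`-successors of an observation
form a union of observations. -/
def IsLimitedObservation : Prop :=
  {G.init} ∈ G.Obs ∧ ∀ o ∈ G.Obs, ∀ a, ∃ S ⊆ G.Obs, G.post a o = ⋃₀ S

/-- `o 0, a 0, o 1, a 1, …` is a play: an infinite abstract path that starts in the observation of
the initial state. -/
structure IsPlay (o : ℕ → Set Q) (a : ℕ → A) : Prop where
  start : G.init ∈ o 0
  mem_obs : ∀ i, o i ∈ G.Obs
  step : ∀ i, ∃ q ∈ o i, ∃ q' ∈ o (i + 1), (q, a i, q') ∈ G.Δ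

/-- `q 0, a 0, q 1, a 1, …` is a concrete path that agrees with `o 0, a 0, o 1, a 1, …`. -/
def IsConcretePath (o : ℕ → Set Q) (a : ℕ → A) (q : ℕ → Q) : Prop :=
  ∀ i, q i ∈ o i ∧ (q i, a i, q (i + 1)) ∈ G.Δ

/-- The payoff of the first `n` transitions of a concrete path. -/
def payoff (q : ℕ → Q) (a : ℕ → A) (n : ℕ) : ℤ :=
  ∑ i ∈ Finset.range n, G.w (q i, a i, q (i + 1))

/-- The (liminf) mean payoff of an infinite concrete path. With finitely many states and actions
the averages are bounded. -/
noncomputable def meanPayoff (q : ℕ → Q) (a : ℕ → A) : ℝ :=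
  liminf (fun n : ℕ => (1 / (n : ℝ)) * (G.payoff q a n : ℝ)) atTop

/-- The finite prefix `o 0, a 0, …, o n` of a play, as the list of the pairs `(a i, o (i + 1))`
with `i < n`, **the latest one first**. (`o 0` is the same for all plays and is left out.) -/
def playPrefix (o : ℕ → Set Q) (a : ℕ → A) : ℕ → List (A × Set Q)
  | 0 => []
  | n + 1 => (a n, o (n + 1)) :: playPrefix o a n

/-- Eve wins the mean-payoff game (threshold `0`): she has an observation-based strategy `s` such
that for all plays consistent with `s`, all concrete paths of the play have mean payoff `≥ 0`. -/
def EveWins : Prop :=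
  ∃ s : List (A × Set Q) → A, ∀ o a, G.IsPlay o a → (∀ i, a i = s (playPrefix o a i)) →
    ∀ q, G.IsConcretePath o a q → 0 ≤ G.meanPayoff q a

end MPG

/-! ## Reachability games -/

/-- A reachability game with states `S` and actions `A`. Eve chooses actions, Adam chooses
successors; `TE` and `TA` are the terminating states, where Eve resp. Adam wins. -/
structure ReachGame (S A : Type) where
  init : S
  Δ : S → A → S → Prop
  TE : Set S
  TA : Set S

namespace ReachGame

variable {S A : Type} (R : ReachGame S A)

/-- The last state of a history. A history `s₀ a₀ s₁ … a₍ₙ₋₁₎ sₙ` with `s₀` the initial state is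
the list of the pairs `(aᵢ, sᵢ₊₁)`, **the latest one first**. -/
def cur : List (A × S) → S
  | [] => R.init
  | (_, s) :: _ => s

/-- The histories that occur in the game: transitions are respected, and the game stops at the first
terminating state. -/
def IsHistory : List (A × S) → Prop
  | [] => True
  | (a, s) :: h => IsHistory h ∧ R.cur h ∉ R.TE ∪ R.TA ∧ R.Δ (R.cur h) a s

/-- The history of length `n` in an infinite sequence of moves. -/
def historyOf (p : ℕ → A × S) : ℕ → List (A × S)
  | 0 => []
  | n + 1 => p n :: historyOf p n

/-- All actions in the history are those of Eve's strategy `e`. -/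
def EveConsistent (e : List (A × S) → A) : List (A × S) → Prop
  | [] => True
  | (a, _) :: h => EveConsistent e h ∧ a = e h

/-- All successors in the history are those of Adam's strategy `m`. -/
def AdamConsistent (m : List (A × S) → A → S) : List (A × S) → Prop
  | [] => True
  | (a, s) :: h => AdamConsistent m h ∧ s = m h a

/-- Adam's strategies choose successors of the current state, as long as the game has not
stopped. -/
def IsAdamStrategy (m : List (A × S) → A → S) : Prop :=
  ∀ h, R.IsHistory h → R.cur h ∉ R.TE ∪ R.TA → ∀ a, R.Δ (R.cur h) a (m h a)

/-- Eve has a winning strategy. The plays are the histories that end in a terminating state and the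
infinite ones; nobody wins an infinite play. -/
def EveWins : Prop :=
  ∃ e : List (A × S) → A,
    (∀ h, R.IsHistory h → EveConsistent e h → R.cur h ∈ R.TE ∪ R.TA → R.cur h ∈ R.TE) ∧
    ¬ ∃ p : ℕ → A × S, ∀ n, R.IsHistory (historyOf p n) ∧ EveConsistent e (historyOf p n)

/-- Adam has a winning strategy. -/
def AdamWins : Prop :=
  ∃ m : List (A × S) → A → S, R.IsAdamStrategy m ∧
    (∀ h, R.IsHistory h → AdamConsistent m h → R.cur h ∈ R.TE ∪ R.TA → R.cur h ∈ R.TA) ∧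
    ¬ ∃ p : ℕ → A × S, ∀ n, R.IsHistory (historyOf p n) ∧ AdamConsistent m (historyOf p n)

end ReachGame

/-! ## The reachability game associated with a game -/

/-- Functions `Q → ℤ ∪ {+∞, ⊥}`; here `⊥` is `none` and `+∞` is `some ⊤`. -/
abbrev WFun (Q : Type) := Q → Option (WithTop ℤ)

namespace WFun

variable {Q : Type}

/-- The support of `f`: the states where it is not `⊥`. -/
def supp (f : WFun Q) : Set Q := {q | f q ≠ none}

/-- The relation `f ⪯ₖ g`. -/
def Prec (k : ℕ) (f g : WFun Q) : Prop :=
  supp f = supp g ∧ ∀ q x y, f q = some x → g q = some y → x + (k : WithTop ℤ) ≤ y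

end WFun

namespace MPG

variable {Q A : Type} (G : MPG Q A)

/-- `f'` is an `a`-successor of `f`. -/
def IsSucc (f : WFun Q) (a : A) (f' : WFun Q) : Prop :=
  f'.supp ∈ G.Obs ∧ f'.supp ⊆ G.post a f.supp ∧
  ∀ q ∈ f'.supp, f' q = some ⊤ ∨
    ∃ v : WithTop ℤ, f' q = some v ∧
      IsLeast {x | ∃ q' y, (q', a, q) ∈ G.Δ ∧ f q' = some y ∧
        x = y + ((G.w (q', a, q) : ℤ) : WithTop ℤ)} v

open Classical in
/-- The initial function: `0` at the initial state and `⊥` elsewhere. -/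
noncomputable def initFun : WFun Q := fun q => if q = G.init then some 0 else none

/-- The last function `fₙ` of a sequence `f₀ a₀ f₁ … a₍ₙ₋₁₎ fₙ` with `f₀` the initial function,
given as the list of the pairs `(aᵢ, fᵢ₊₁)`, **the latest one first**. -/
noncomputable def lastFun : List (A × WFun Q) → WFun Q
  | [] => G.initFun
  | (_, f) :: _ => f

/-- The functions `f₀, …, fₙ₋₁` of such a sequence, that is, all except the last one. -/
noncomputable def earlierFuns : List (A × WFun Q) → List (WFun Q)
  | [] => []
  | (_, _) :: x => G.lastFun x :: earlierFuns x

/-- The positions `f₀ a₀ f₁ … a₍ₙ₋₁₎ fₙ` of the associated reachability game: every `fᵢ₊₁` is an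
`aᵢ`-successor of `fᵢ`, and for all `i < j < n` neither `fᵢ ⪯₀ fⱼ` nor `fⱼ ⪯₁ fᵢ`. -/
def IsPosition : List (A × WFun Q) → Prop
  | [] => True
  | (a, f) :: x => IsPosition x ∧ G.IsSucc (G.lastFun x) a f ∧
      ∀ g ∈ G.earlierFuns x, ¬ g.Prec 0 (G.lastFun x) ∧ ¬ (G.lastFun x).Prec 1 g

/-- The reachability game `Γ_G` associated with `G`. -/
noncomputable def assocGame : ReachGame (List (A × WFun Q)) A where
  init := []
  Δ x a y := G.IsPosition x ∧ G.IsPosition y ∧ ∃ f, y = (a, f) :: x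
  TE := {x | G.IsPosition x ∧ ∃ g ∈ G.earlierFuns x, g.Prec 0 (G.lastFun x)}
  TA := {x | G.IsPosition x ∧ ∃ g ∈ G.earlierFuns x, (G.lastFun x).Prec 1 g ∧
    ∃ q ∈ g.supp, g q ≠ some ⊤}

/-- One of the players has a winning strategy in the associated reachability game. -/
def ForciblyTerminating : Prop := G.assocGame.AdamWins ∨ G.assocGame.EveWins

end MPG

/-! ## Words over `{0, 1}` as codes -/

/-- A list of natural numbers as a word: each number in unary, followed by an end marker. -/
def natsToWord (l : List ℕ) : List Bool := l.flatMap fun n => List.replicate n true ++ [false]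

/-- A finite description of a mean-payoff game with partial observation: the states are
`0, …, numStates - 1` and the actions `0, …, numActions - 1`; two states are in the same observation
if they have the same label; the transitions are listed with their weights. -/
structure GameCode where
  numStates : ℕ
  numActions : ℕ
  numActions_pos : 0 < numActions
  init : Fin numStates
  label : Fin numStates → ℕ
  trans : List (Fin numStates × Fin numActions × Fin numStates × ℤ)
  weight_unique : ∀ q a q' z z', (q, a, q', z) ∈ trans → (q, a, q', z') ∈ trans → z = z'
  trans_total : ∀ q a, ∃ q' z, (q, a, q', z) ∈ trans

namespace GameCode

variable (C : GameCode)

open Classical in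
/-- The game that is described. -/
noncomputable def toMPG : MPG (Fin C.numStates) (Fin C.numActions) where
  init := C.init
  Δ := {t | ∃ z, (t.1, t.2.1, t.2.2, z) ∈ C.trans}
  w t := if h : ∃ z, (t.1, t.2.1, t.2.2, z) ∈ C.trans then h.choose else 0
  Obs := (Setoid.ker C.label).classes
  obs_partition := Setoid.isPartition_classes _
  total q a := C.trans_total q a

/-- The numbers of states and of actions, the initial state, the labels of the states, the number of
transitions, and the transitions; a weight `z` is given as the pair of its positive and its negative
part. -/
def toNats : List ℕ :=
  [C.numStates, C.numActions, (C.init : ℕ)] ++ List.ofFn C.label ++ [C.trans.length] ++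
    C.trans.flatMap fun t => [(t.1 : ℕ), (t.2.1 : ℕ), (t.2.2.1 : ℕ), t.2.2.2.toNat, (-t.2.2.2).toNat]

end GameCode

/-- Finitely described mean-payoff games with limited observation. -/
def LimObsGame : Type := {C : GameCode // C.toMPG.IsLimitedObservation}

namespace LimObsGame

/-- The game. -/
noncomputable def game (G : LimObsGame) : MPG (Fin G.1.numStates) (Fin G.1.numActions) := G.1.toMPG

/-- The code word of the game. -/
def encode (G : LimObsGame) : List Bool := natsToWord G.1.toNats

end LimObsGame

/-! ## Deterministic Turing machines -/

/-- A deterministic Turing machine with one tape that is infinite in both directions. The states are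
`0, …, numStates - 1`, the tape symbols are `0, …, numSymbols` with blank `0`. The machine halts if
`δ` is undefined; otherwise it goes to the new state, writes the new symbol and moves the head
(`none`: the head stays). -/
structure DTM where
  numStates : ℕ
  numSymbols : ℕ
  start : Fin numStates
  accept : Fin numStates
  reject : Fin numStates
  accept_ne_reject : accept ≠ reject
  δ : Fin numStates → Fin (numSymbols + 1) →
    Option (Fin numStates × Fin (numSymbols + 1) × Option Turing.Dir)

namespace DTM

variable (M : DTM)

/-- Configurations: a state and a tape with a head position. -/
abbrev Cfg : Type := Fin M.numStates × Turing.Tape (Fin (M.numSymbols + 1))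

/-- One computation step. -/
def step (c : M.Cfg) : Option M.Cfg :=
  (M.δ c.1 c.2.head).map fun r => (r.1,
    match r.2.2 with
    | none => c.2.write r.2.1
    | some d => (c.2.write r.2.1).move d)

/-- Started with the word `u` on the tape (blank elsewhere) and the head on its first symbol, the
machine halts in the state `q`. -/
def HaltsIn (u : List (Fin (M.numSymbols + 1))) (q : Fin M.numStates) : Prop :=
  ∃ T : Turing.Tape (Fin (M.numSymbols + 1)),
    StateTransition.Reaches M.step (M.start, Turing.Tape.mk₁ u) (q, T) ∧ M.step (q, T) = none

/-- The machine halts in the accepting state. -/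
def Accepts (u : List (Fin (M.numSymbols + 1))) : Prop := M.HaltsIn u M.accept

/-- The machine halts in the rejecting state. -/
def Rejects (u : List (Fin (M.numSymbols + 1))) : Prop := M.HaltsIn u M.reject

/-- The head movements as numbers. -/
def moveCode : Option Turing.Dir → ℕ
  | none => 0
  | some Turing.Dir.left => 1
  | some Turing.Dir.right => 2

/-- An entry of the transition table as a block of four numbers. -/
def entryNats {n k : ℕ} : Option (Fin n × Fin k × Option Turing.Dir) → List ℕ
  | none => [0, 0, 0, 0]
  | some (q, b, d) => [1, (q : ℕ), (b : ℕ), moveCode d]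

/-- The machine and its input word as a list of numbers. -/
def toNats (u : List (Fin (M.numSymbols + 1))) : List ℕ :=
  [M.numStates, M.numSymbols, (M.start : ℕ), (M.accept : ℕ), (M.reject : ℕ)] ++
    ((List.finRange M.numStates).flatMap fun q =>
      (List.finRange (M.numSymbols + 1)).flatMap fun b => entryNats (M.δ q b)) ++
    [u.length] ++ u.map Fin.val

end DTM

/-- A deterministic Turing machine together with an input word. -/
structure DTMInput where
  machine : DTM
  word : List (Fin (machine.numSymbols + 1))

/-- The code word of a machine with its input. -/
def DTMInput.encode (x : DTMInput) : List Bool := natsToWord (x.machine.toNats x.word)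

/-! ## Different objects have different codes -/

theorem natsToWord_injective : Function.Injective natsToWord := by
  intro l
  induction l with
  | nil => intro l' h; cases l' <;> simp_all [natsToWord]
  | cons n l ih =>
    intro l' h
    cases l' with
    | nil => simp [natsToWord] at h
    | cons n' l' =>
      have key : ∀ (n n' : ℕ) (s s' : List Bool), List.replicate n true ++ false :: s =
          List.replicate n' true ++ false :: s' → n = n' ∧ s = s' := by
        intro n
        induction n with
        | zero => intro n' s s' h; cases n' <;> simp_all [List.replicate_succ]
        | succ n ih =>
          intro n' s s' h
          cases n' with
          | zero => simp [List.replicate_succ] at h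
          | succ n' =>
            simp only [List.replicate_succ, List.cons_append, List.cons.injEq, true_and] at h
            simpa using ih n' s s' h
      simp only [natsToWord, List.flatMap_cons, List.append_assoc, List.singleton_append] at h
      obtain ⟨rfl, h2⟩ := key _ _ _ _ h
      rw [ih h2]

theorem flatMap_injective_of_length {α β : Type} (f : α → List β) (k : ℕ)
    (hk : ∀ a, (f a).length = k + 1) (hf : Function.Injective f) :
    Function.Injective fun l : List α => l.flatMap f := by
  intro l
  induction l with
  | nil =>
    intro l' h
    cases l' with
    | nil => rfl
    | cons b l' =>
      have := congrArg List.length h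
      simp only [List.flatMap_nil, List.flatMap_cons, List.length_append, List.length_nil,
        hk] at this
      lia
  | cons a l ih =>
    intro l' h
    cases l' with
    | nil =>
      have := congrArg List.length h
      simp [hk] at this
    | cons b l' =>
      simp only [List.flatMap_cons] at h
      obtain ⟨h1, h2⟩ := List.append_inj h (by rw [hk, hk])
      rw [hf h1, ih h2]

theorem GameCode.toNats_injective : Function.Injective GameCode.toNats := by
  rintro ⟨n, m, hm, i, lab, tr, hw, ht⟩ ⟨n', m', hm', i', lab', tr', hw', ht'⟩ h
  simp only [GameCode.toNats, List.append_assoc, List.cons_append, List.nil_append,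
    List.cons.injEq] at h
  obtain ⟨rfl, rfl, h3, h4⟩ := h
  obtain rfl := Fin.ext h3
  obtain ⟨h5, h6⟩ := List.append_inj h4 (by simp)
  obtain rfl := List.ofFn_injective h5
  simp only [List.cons.injEq] at h6
  obtain rfl := flatMap_injective_of_length _ 4 (by simp) (by
    rintro ⟨q, a, q', z⟩ ⟨r, b, r', y⟩ h
    simp only [List.cons.injEq, and_true, Fin.val_inj] at h
    obtain ⟨rfl, rfl, rfl, h1, h2⟩ := h
    have : z = y := by lia
    rw [this]) h6.2
  rfl

theorem LimObsGame.encode_injective : Function.Injective LimObsGame.encode := fun _ _ h =>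
  Subtype.ext (GameCode.toNats_injective (natsToWord_injective h))

theorem flatMap_finRange_injective {β : Type} {n : ℕ} (f g : Fin n → List β)
    (hl : ∀ i, (f i).length = (g i).length)
    (h : (List.finRange n).flatMap f = (List.finRange n).flatMap g) : f = g := by
  have key : ∀ l : List (Fin n), l.flatMap f = l.flatMap g → ∀ i ∈ l, f i = g i := by
    intro l
    induction l with
    | nil => simp
    | cons a l ih =>
      intro h
      simp only [List.flatMap_cons] at h
      obtain ⟨h1, h2⟩ := List.append_inj h (hl a)
      intro i hi
      rcases List.mem_cons.1 hi with rfl | hi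
      · exact h1
      · exact ih h2 i hi
  funext i
  exact key _ h i (List.mem_finRange i)

theorem DTM.entryNats_length {n k : ℕ} (e : Option (Fin n × Fin k × Option Turing.Dir)) :
    (DTM.entryNats e).length = 4 := by
  rcases e with _ | ⟨q, b, d⟩ <;> rfl

theorem DTM.entryNats_injective {n k : ℕ} : Function.Injective (@DTM.entryNats n k) := by
  rintro (_ | ⟨q, b, d⟩) (_ | ⟨q', b', d'⟩) h
  · rfl
  · simp [DTM.entryNats] at h
  · simp [DTM.entryNats] at h
  · simp only [DTM.entryNats, List.cons.injEq, Fin.val_inj, true_and, and_true] at h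
    obtain ⟨rfl, rfl, h⟩ := h
    have : d = d' := by
      rcases d with _ | _ | _ <;> rcases d' with _ | _ | _ <;> simp_all [DTM.moveCode]
    rw [this]

theorem DTMInput.encode_injective : Function.Injective DTMInput.encode := by
  rintro ⟨⟨n, k, s, a, r, har, δ⟩, u⟩ ⟨⟨n', k', s', a', r', har', δ'⟩, u'⟩ h
  replace h := natsToWord_injective h
  simp only [DTM.toNats, List.append_assoc, List.cons_append, List.nil_append,
    List.cons.injEq] at h
  obtain ⟨rfl, rfl, h1, h2, h3, h4⟩ := h
  obtain rfl := Fin.ext h1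
  obtain rfl := Fin.ext h2
  obtain rfl := Fin.ext h3
  obtain ⟨h5, h6⟩ := List.append_inj h4 (by simp [DTM.entryNats_length])
  have h7 := flatMap_finRange_injective _ _ (by simp [DTM.entryNats_length]) h5
  have : δ = δ' := by
    funext q b
    exact DTM.entryNats_injective (congrFun (flatMap_finRange_injective _ _
      (by simp [DTM.entryNats_length]) (congrFun h7 q)) b)
  subst this
  simp only [List.cons.injEq] at h6
  obtain rfl := (List.map_injective_iff.2 Fin.val_injective) h6.2
  rfl

/-! ## Algorithms and complexity -/

/-- `f` is computable in polynomial time by a (multi-stack) Turing machine, with respect to the given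
codes of the arguments and of the values. -/
def PolyTimeComputable {α β : Type} (codeα : α → List Bool) (codeβ : β → List Bool)
    (f : α → β) : Prop :=
  Nonempty (Turing.TM2ComputableInPolyTime codeα codeβ f)

/-- There is an algorithm that, on the code of any `x` with `S x`, halts and tells whether `P x`
holds. Nothing is required on other words. -/
def DecidableOn {α : Type} (code : α → List Bool) (S P : α → Prop) : Prop :=
  ∃ d : List Bool →. Bool, Partrec d ∧ ∀ x, S x → ∃ b ∈ d (code x), (b = true ↔ P x)

/-- The problem to tell, for given `x` with `S x`, whether `P x` holds, is complete, under
polynomial-time reductions, for the class of all decidable problems. -/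
def IsRComplete {α : Type} (code : α → List Bool) (S P : α → Prop) : Prop :=
  DecidableOn code S P ∧
  ∀ L : List Bool → Prop, ComputablePred L →
    ∃ f : List Bool → α, PolyTimeComputable id code f ∧ ∀ u, S (f u) ∧ (L u ↔ P (f u))

/-! The core is one reduction, `exists_reduction`: for every partial recursive `φ` on words there
are games, written down in polynomial time from a word `w`, in whose reachability game Eve wins iff
`true ∈ φ w` and Adam wins iff `false ∈ φ w`. Part 1 takes a universal machine for `φ`
(`DTM.partrec_universal`). Part 2 takes a `φ` that is defined at `w` iff the partial recursive
function with code number `w.length` is defined at `0`. The hardness in part 3 takes the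
characteristic function of the decidable language.

The reduction goes through counter machines. These compute all primitive recursive functions
(`Prog.computes_of_primrec'`), so they can search for the first step bound at which an evaluation of
`φ` has a result (`exists_wordCode`). The word is not an input but part of the code: each bit
contributes nine instructions that append a digit to the number in register `1`.

The game stores a configuration of the machine in a single function: the support is the observation
of the current location, and the hidden lanes carry every register and its negative. Eve announces
the outcome of each zero test. After a wrong announcement Adam can return to the initial state with
a negative value and wins by `⪯₁`; after a right one the returning value is nonnegative and Eve wins
by `⪯₀`. Adam may also replace values by `+∞`. Against this Eve has an action for each lane that
claims its value to be infinite: the claimed lane leads to a sink with a loop of weight `-1`, the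
other lanes to a sink with a loop of weight `0`. A true claim wins for her because `+∞` absorbs the
losses, and a false one loses. Finally a timer register, again with its negative, makes
configurations at different times incomparable, so that faithful play does not stop before the
machine halts. Hence each player wins exactly if the machine halts with the corresponding answer
(`MPG.Simulates.eveWins_iff`, `MPG.Simulates.adamWins_iff`).

The decision procedure in part 3 rests on finite certificates. A winning strategy in the
reachability game is a well-founded tree; identifying its leaves with the earlier functions that
stop the play yields a finite set of potentials closed under moves (`MPG.exists_eveCert`,
`MPG.exists_adamCert`). Such a set proves who wins the mean-payoff game itself, by a telescoping sum
along concrete paths (`MPG.EveCert.eveWins`, `MPG.AdamCert.not_eveWins`). An exhaustive search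
therefore ends for forcibly terminating games and never errs. The same implications carry the winner
of the reachability game over to the mean-payoff game in the hardness proof.

Polynomial time is obtained from the shape of the code words: the numbers that a bit contributes are
affine in its position. A machine with a unary position counter writes them in a fixed number of
passes over the word (`encode_simGame`, `StackMachine.polyTimeComputable_passesNats`). -/

/-! ## Forcing in reachability games -/

namespace ReachGame

variable {S A : Type} (R : ReachGame S A)

/-- The states from which Eve can force a win. -/
inductive EveForce : S → Prop
  | terminal {s : S} : s ∈ R.TE → EveForce s
  | move {s : S} (a : A) : s ∉ R.TE ∪ R.TA → (∀ s', R.Δ s a s' → EveForce s') → EveForce s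

/-- The states from which Adam can force a win. -/
inductive AdamForce : S → Prop
  | terminal {s : S} : s ∈ R.TA → AdamForce s
  | move {s : S} (m : A → S) : s ∉ R.TE ∪ R.TA → (∀ a, R.Δ s a (m a)) → (∀ a, AdamForce (m a)) →
      AdamForce s

variable {R}

/-- Playing Eve's forcing action against Adam's forcing answer would preserve both properties down
to a terminating state, and such a state belongs to one player only. -/
theorem not_eveForce_and_adamForce (hd : Disjoint R.TE R.TA) {s : S} (he : R.EveForce s) :
    ¬ R.AdamForce s := by
  induction he with
  | terminal h =>
    intro ha
    cases ha with
    | terminal h' => exact Set.disjoint_left.1 hd h h'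
    | move m h' => exact h' (Or.inl h)
  | move a h hs ih =>
    intro ha
    cases ha with
    | terminal h' => exact h (Or.inr h')
    | move m h' hm hf => exact ih _ (hm a) (hf a)

/-- Dependent choice for histories. It produces the infinite consistent play that a winning strategy
excludes. -/
theorem exists_historyOf {P : List (A × S) → Prop} (h0 : P [])
    (hs : ∀ h, P h → ∃ x, P (x :: h)) : ∃ p : ℕ → A × S, ∀ n, P (historyOf p n) := by
  choose g hg using hs
  let H : ℕ → {h // P h} := fun n => Nat.rec ⟨[], h0⟩ (fun _ h => ⟨g h.1 h.2 :: h.1, hg _ h.2⟩) n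
  refine ⟨fun n => g (H n).1 (H n).2, fun n => ?_⟩
  have : historyOf (fun n => g (H n).1 (H n).2) n = (H n).1 := by
    induction n with
    | zero => rfl
    | succ n ih => rw [historyOf, ih]
  rw [this]
  exact (H n).2

/-- Where Eve cannot force a win, each action has an answer that leads to another such state.
Following `e` with these answers gives an infinite consistent play. -/
theorem EveWins.eveForce (h : R.EveWins) : R.EveForce R.init := by
  obtain ⟨e, h1, h2⟩ := h
  by_contra hn
  refine h2 ?_
  obtain ⟨p, hp⟩ := exists_historyOf
    (P := fun h => (R.IsHistory h ∧ EveConsistent e h) ∧ ¬ R.EveForce (R.cur h))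
    ⟨⟨trivial, trivial⟩, hn⟩ (by
      rintro h ⟨⟨hh, hc⟩, hf⟩
      have ht : R.cur h ∉ R.TE ∪ R.TA := fun ht => hf (.terminal (h1 h hh hc ht))
      by_contra hcon
      push Not at hcon
      refine hf (.move (e h) ht fun s' hs' => ?_)
      exact hcon (e h, s') ⟨⟨hh, ht, hs'⟩, hc, rfl⟩)
  exact ⟨p, fun n => (hp n).1⟩

theorem AdamWins.adamForce (h : R.AdamWins) : R.AdamForce R.init := by
  obtain ⟨m, hm, h1, h2⟩ := h
  by_contra hn
  refine h2 ?_
  obtain ⟨p, hp⟩ := exists_historyOf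
    (P := fun h => (R.IsHistory h ∧ AdamConsistent m h) ∧ ¬ R.AdamForce (R.cur h))
    ⟨⟨trivial, trivial⟩, hn⟩ (by
      rintro h ⟨⟨hh, hc⟩, hf⟩
      have ht : R.cur h ∉ R.TE ∪ R.TA := fun ht => hf (.terminal (h1 h hh hc ht))
      by_contra hcon
      push Not at hcon
      refine hf (.move (m h) ht (hm h hh ht) fun a => ?_)
      exact hcon (a, m h a) ⟨⟨hh, ht, hm h hh ht a⟩, hc, rfl⟩)
  exact ⟨p, fun n => (hp n).1⟩

variable (R) in
/-- The states from which Eve can force a win in at most `n` moves. -/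
def EveForceIn : ℕ → S → Prop
  | 0, s => s ∈ R.TE
  | n + 1, s => s ∈ R.TE ∨ (s ∉ R.TE ∪ R.TA ∧ ∃ a, ∀ s', R.Δ s a s' → EveForceIn n s')

variable (R) in
/-- The states from which Adam can force a win in at most `n` moves. -/
def AdamForceIn : ℕ → S → Prop
  | 0, s => s ∈ R.TA
  | n + 1, s => s ∈ R.TA ∨
      (s ∉ R.TE ∪ R.TA ∧ ∃ m : A → S, ∀ a, R.Δ s a (m a) ∧ AdamForceIn n (m a))

theorem EveForceIn.eveForce {n : ℕ} {s : S} (h : R.EveForceIn n s) : R.EveForce s := by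
  induction n generalizing s with
  | zero => exact .terminal h
  | succ n ih =>
    rcases h with h | ⟨h, a, ha⟩
    · exact .terminal h
    · exact .move a h fun s' hs' => ih (ha s' hs')

theorem AdamForceIn.adamForce {n : ℕ} {s : S} (h : R.AdamForceIn n s) : R.AdamForce s := by
  induction n generalizing s with
  | zero => exact .terminal h
  | succ n ih =>
    rcases h with h | ⟨h, m, hm⟩
    · exact .terminal h
    · exact .move m h (fun a => (hm a).1) fun a => ih (hm a).2

theorem EveForceIn.succ {n : ℕ} {s : S} (h : R.EveForceIn n s) : R.EveForceIn (n + 1) s := by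
  induction n generalizing s with
  | zero => exact .inl h
  | succ n ih => exact h.imp id fun ⟨h, a, ha⟩ => ⟨h, a, fun s' hs' => ih (ha s' hs')⟩

theorem AdamForceIn.succ {n : ℕ} {s : S} (h : R.AdamForceIn n s) : R.AdamForceIn (n + 1) s := by
  induction n generalizing s with
  | zero => exact .inl h
  | succ n ih => exact h.imp id fun ⟨h, m, hm⟩ => ⟨h, m, fun a => ⟨(hm a).1, ih (hm a).2⟩⟩

theorem EveForceIn.mono {n k : ℕ} {s : S} (h : R.EveForceIn n s) (hk : n ≤ k) :
    R.EveForceIn k s := by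
  induction hk with
  | refl => exact h
  | step _ ih => exact ih.succ

theorem AdamForceIn.mono {n k : ℕ} {s : S} (h : R.AdamForceIn n s) (hk : n ≤ k) :
    R.AdamForceIn k s := by
  induction hk with
  | refl => exact h
  | step _ ih => exact ih.succ

/-- The positional strategy that always lowers the least number of remaining moves is winning: an
infinite play would give an infinite descent in `ℕ`. -/
theorem EveForceIn.eveWins [Nonempty A] {N : ℕ} (h : R.EveForceIn N R.init) : R.EveWins := by
  classical
  -- The action belongs to the least rank `Nat.find hs`, so it lowers every rank that `s` has.
  have key : ∀ s, s ∉ R.TE ∪ R.TA → (∃ n, R.EveForceIn n s) →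
      ∃ a, ∀ n, R.EveForceIn n s → ∃ k < n, ∀ s', R.Δ s a s' → R.EveForceIn k s' := by
    intro s ht hs
    have h1 := Nat.find_spec hs
    rcases hn : Nat.find hs with _ | k
    · rw [hn] at h1
      exact absurd (Or.inl h1) ht
    · rw [hn] at h1
      rcases h1 with h1 | ⟨-, a, ha⟩
      · exact absurd (Or.inl h1) ht
      · exact ⟨a, fun n hns => ⟨k, by have := Nat.find_min' hs hns; omega, ha⟩⟩
  choose! e he using key
  refine ⟨fun h => e (R.cur h), ?_, ?_⟩
  · have hforce : ∀ h, R.IsHistory h → EveConsistent (fun h => e (R.cur h)) h →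
        ∃ n, R.EveForceIn n (R.cur h) := by
      intro h
      induction h with
      | nil => intro _ _; exact ⟨N, ‹_›⟩
      | cons x h ih =>
        obtain ⟨a, s⟩ := x
        rintro ⟨h1, h2, h3⟩ ⟨h4, rfl⟩
        obtain ⟨n, hn⟩ := ih h1 h4
        obtain ⟨k, -, hk⟩ := he _ h2 ⟨n, hn⟩ n hn
        exact ⟨k, hk _ h3⟩
    intro h hh hc ht
    obtain ⟨n, hn⟩ := hforce h hh hc
    cases hn.eveForce with
    | terminal h' => exact h'
    | move a h' hs => exact absurd ht h'
  · rintro ⟨p, hp⟩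
    have : ∀ M n, ¬ R.EveForceIn M (R.cur (historyOf p n)) := by
      intro M
      induction M using Nat.strong_induction_on with
      | _ M ih =>
        intro n hn
        obtain ⟨⟨-, h2, h3⟩, -, h4⟩ := hp (n + 1)
        obtain ⟨k, hk, hs⟩ := he _ h2 ⟨M, hn⟩ M hn
        rw [h4] at h3
        exact ih k hk (n + 1) (hs _ h3)
    exact this N 0 h

/-- The same descent. `hΔ` is needed because a strategy of Adam must be legal after all histories,
also where he cannot force a win. -/
theorem AdamForceIn.adamWins {N : ℕ} (h : R.AdamForceIn N R.init)
    (hΔ : ∀ h, R.IsHistory h → R.cur h ∉ R.TE ∪ R.TA → ∀ a, ∃ s', R.Δ (R.cur h) a s') :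
    R.AdamWins := by
  classical
  have key : ∀ s a, s ∉ R.TE ∪ R.TA → (∃ s', R.Δ s a s') → ∃ s', R.Δ s a s' ∧
      ∀ n, R.AdamForceIn n s → ∃ k < n, R.AdamForceIn k s' := by
    intro s a ht ⟨s', hs'⟩
    by_cases hs : ∃ n, R.AdamForceIn n s
    · have h1 := Nat.find_spec hs
      rcases hn : Nat.find hs with _ | k
      · rw [hn] at h1
        exact absurd (Or.inr h1) ht
      · rw [hn] at h1
        rcases h1 with h1 | ⟨-, m, hm⟩
        · exact absurd (Or.inr h1) ht
        · exact ⟨m a, (hm a).1, fun n hns =>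
            ⟨k, by have := Nat.find_min' hs hns; omega, (hm a).2⟩⟩
    · exact ⟨s', hs', fun n hn => absurd ⟨n, hn⟩ hs⟩
  have : Nonempty S := ⟨R.init⟩
  choose! m hm hf using key
  refine ⟨fun h a => m (R.cur h) a, fun h hh ht a => hm _ a ht (hΔ h hh ht a), ?_, ?_⟩
  · have hforce : ∀ h, R.IsHistory h → AdamConsistent (fun h a => m (R.cur h) a) h →
        ∃ n, R.AdamForceIn n (R.cur h) := by
      intro h
      induction h with
      | nil => intro _ _; exact ⟨N, ‹_›⟩
      | cons x h ih =>
        obtain ⟨a, s⟩ := x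
        rintro ⟨h1, h2, h3⟩ ⟨h4, rfl⟩
        obtain ⟨n, hn⟩ := ih h1 h4
        obtain ⟨k, -, hk⟩ := hf _ a h2 ⟨_, h3⟩ n hn
        exact ⟨k, hk⟩
    intro h hh hc ht
    obtain ⟨n, hn⟩ := hforce h hh hc
    cases hn.adamForce with
    | terminal h' => exact h'
    | move a h' hs => exact absurd ht h'
  · rintro ⟨p, hp⟩
    have : ∀ M n, ¬ R.AdamForceIn M (R.cur (historyOf p n)) := by
      intro M
      induction M using Nat.strong_induction_on with
      | _ M ih =>
        intro n hn
        obtain ⟨⟨-, h2, h3⟩, -, h4⟩ := hp (n + 1)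
        obtain ⟨k, hk, hs⟩ := hf _ (p n).1 h2 ⟨_, h3⟩ M hn
        refine ih k hk (n + 1) ?_
        change R.AdamForceIn k (p n).2
        rw [h4]
        exact hs
    exact this N 0 h

end ReachGame

/-! ## Positions of the associated reachability game -/

namespace WFun

variable {Q : Type}

theorem mem_supp {f : WFun Q} {q : Q} : q ∈ f.supp ↔ ∃ v, f q = some v :=
  Option.ne_none_iff_exists'

/-- All values of `f` are `⊥` or `+∞`. -/
def AllTop (f : WFun Q) : Prop := ∀ q v, f q = some v → v = ⊤

/-- Functions with values in `ℤ ∪ {⊥}`. -/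
def lift (h : Q → Option ℤ) : WFun Q := fun q => (h q).map (↑)

theorem lift_injective : Function.Injective (lift : (Q → Option ℤ) → WFun Q) := by
  intro h h' e
  funext q
  exact Option.map_injective WithTop.coe_injective (congrFun e q)

theorem lift_eq_some {h : Q → Option ℤ} {q : Q} {v : WithTop ℤ} :
    lift h q = some v ↔ ∃ z, h q = some z ∧ v = z := by
  simp [lift, eq_comm]

theorem mem_supp_lift {h : Q → Option ℤ} {q : Q} : q ∈ (lift h).supp ↔ h q ≠ none := by
  simp [supp, lift]

theorem exists_lift {f : WFun Q} (hf : ∀ q v, f q = some v → v ≠ ⊤) : ∃ h, f = lift h := by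
  refine ⟨fun q => (f q).map (fun v => v.untopD 0), ?_⟩
  funext q
  rcases hq : f q with _ | v
  · simp [lift, hq]
  · have := hf q v hq
    lift v to ℤ using this
    simp [lift, hq]

theorem Prec.refl (f : WFun Q) : f.Prec 0 f :=
  ⟨rfl, fun q x y h h' => by rw [h] at h'; cases h'; simp⟩

theorem Prec.trans {f g h : WFun Q} {k l : ℕ} (h1 : f.Prec k g) (h2 : g.Prec l h) :
    f.Prec (k + l) h := by
  refine ⟨h1.1.trans h2.1, fun q x z hx hz => ?_⟩
  have hq : q ∈ g.supp := h1.1 ▸ mem_supp.2 ⟨x, hx⟩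
  obtain ⟨y, hy⟩ := mem_supp.1 hq
  push_cast
  rw [← add_assoc]
  exact (add_le_add_left (h1.2 q x y hx hy) _).trans (h2.2 q y z hy hz)

theorem Prec.mono {f g : WFun Q} {k l : ℕ} (h : f.Prec k g) (hl : l ≤ k) : f.Prec l g :=
  ⟨h.1, fun q x y hx hy => (add_le_add_right (by exact_mod_cast hl) x).trans (h.2 q x y hx hy)⟩

end WFun

namespace MPG

variable {Q A : Type} {G : MPG Q A}

/-- Two states that are in the same observation. -/
def Same (G : MPG Q A) (q q' : Q) : Prop := ∃ o ∈ G.Obs, q ∈ o ∧ q' ∈ o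

theorem exists_obs (q : Q) : ∃ o ∈ G.Obs, q ∈ o := (G.obs_partition.2 q).exists

theorem obs_unique {o o' : Set Q} {q : Q} (h : o ∈ G.Obs) (h' : o' ∈ G.Obs) (hq : q ∈ o)
    (hq' : q ∈ o') : o = o' :=
  (G.obs_partition.2 q).unique ⟨h, hq⟩ ⟨h', hq'⟩

theorem obs_nonempty {o : Set Q} (h : o ∈ G.Obs) : o.Nonempty :=
  Setoid.nonempty_of_mem_partition G.obs_partition h

theorem IsLimitedObservation.exists_obs_subset (hl : G.IsLimitedObservation) {o : Set Q}
    (ho : o ∈ G.Obs) {a : A} {q : Q} (hq : q ∈ G.post a o) :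
    ∃ o' ∈ G.Obs, q ∈ o' ∧ o' ⊆ G.post a o := by
  obtain ⟨S, hS, he⟩ := hl.2 o ho a
  rw [he] at hq ⊢
  obtain ⟨o', h1, h2⟩ := hq
  exact ⟨o', hS h1, h2, Set.subset_sUnion_of_mem h1⟩

theorem supp_initFun : G.initFun.supp = {G.init} := by
  ext q
  simp [WFun.supp, initFun]

theorem initFun_eq_some {q : Q} {v : WithTop ℤ} :
    G.initFun q = some v ↔ q = G.init ∧ v = 0 := by
  unfold initFun
  split_ifs with h <;> simp [h, eq_comm]

theorem supp_lastFun_mem (hl : G.IsLimitedObservation) {x : List (A × WFun Q)}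
    (hx : G.IsPosition x) : (G.lastFun x).supp ∈ G.Obs := by
  cases x with
  | nil => rw [lastFun, supp_initFun]; exact hl.1
  | cons p x => exact hx.2.1.1

variable (G) in
/-- The weights of the `a`-transitions to `q`, added to the values of `f`. -/
def stepValues (f : WFun Q) (a : A) (q : Q) : Set (WithTop ℤ) :=
  {x | ∃ q' y, (q', a, q) ∈ G.Δ ∧ f q' = some y ∧ x = y + ((G.w (q', a, q) : ℤ) : WithTop ℤ)}

theorem exists_isLeast_stepValues [Finite Q] {f : WFun Q} {a : A} {q : Q}
    (hq : q ∈ G.post a f.supp) : ∃ v, IsLeast (G.stepValues f a q) v := by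
  have hfin : (G.stepValues f a q).Finite := by
    refine (Set.finite_range fun q' => ((f q').getD 0) +
      ((G.w (q', a, q) : ℤ) : WithTop ℤ)).subset ?_
    rintro x ⟨q', y, -, h, rfl⟩
    exact ⟨q', by simp [h]⟩
  obtain ⟨q', h, h'⟩ := hq
  obtain ⟨y, hy⟩ := WFun.mem_supp.1 h
  have hne : (G.stepValues f a q).Nonempty := ⟨_, q', y, h', hy, rfl⟩
  obtain ⟨v, hv, hmin⟩ := Set.exists_min_image _ id hfin hne
  exact ⟨v, hv, hmin⟩

/-- The successor without additional values `+∞`. -/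
theorem exists_min_isSucc [Finite Q] {f : WFun Q} {a : A} {o : Set Q} (ho : o ∈ G.Obs)
    (hsub : o ⊆ G.post a f.supp) :
    ∃ f' : WFun Q, G.IsSucc f a f' ∧ f'.supp = o ∧
      ∀ q v, f' q = some v → IsLeast (G.stepValues f a q) v := by
  classical
  have key : ∀ q, ∃ v, q ∈ o → IsLeast (G.stepValues f a q) v := fun q => by
    by_cases hq : q ∈ o
    · obtain ⟨v, hv⟩ := exists_isLeast_stepValues (hsub hq)
      exact ⟨v, fun _ => hv⟩
    · exact ⟨0, fun h => absurd h hq⟩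
  choose v hv using key
  have hs : WFun.supp (fun q => if q ∈ o then some (v q) else none) = o := by
    ext q
    simp [WFun.supp]
  refine ⟨fun q => if q ∈ o then some (v q) else none,
    ⟨hs.symm ▸ ho, hs.symm ▸ hsub, fun q hq => Or.inr ⟨v q, ?_, ?_⟩⟩, hs, fun q w hw => ?_⟩
  · rw [hs] at hq; simp [hq]
  · rw [hs] at hq; exact hv q hq
  · have : q ∈ o := by by_contra h; simp [h] at hw
    simp only [this, if_true, Option.some.injEq] at hw
    exact hw ▸ hv q this

theorem IsSucc.allTop {f f' : WFun Q} {a : A} (h : G.IsSucc f a f') (hf : f.AllTop) :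
    f'.AllTop := by
  intro q v hv
  rcases h.2.2 q (WFun.mem_supp.2 ⟨v, hv⟩) with h | ⟨w, hw, ⟨q', y, -, hy, rfl⟩, -⟩
  · rw [hv] at h; exact Option.some.inj h
  · rw [hv] at hw
    rw [Option.some.inj hw, hf q' y hy, top_add]

theorem allTop_lastFun {x : List (A × WFun Q)} (hx : G.IsPosition x) {g : WFun Q}
    (hg : g ∈ G.earlierFuns x) (ht : g.AllTop) : (G.lastFun x).AllTop := by
  induction x with
  | nil => simp [earlierFuns] at hg
  | cons p x ih =>
    obtain ⟨a, f⟩ := p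
    obtain ⟨h1, h2, -⟩ := hx
    rw [earlierFuns, List.mem_cons] at hg
    rcases hg with rfl | hg
    · exact h2.allTop ht
    · exact h2.allTop (ih h1 hg)

/-- The side conditions are exactly failure to stop, with one exception: `⪯₁` to an earlier `g`
without finite values does not stop the play for Adam. But then all later functions are infinite as
well, so `g` is `⪯₀` the last one and Eve has already won. -/
theorem isPosition_cons {x : List (A × WFun Q)} (hx : G.IsPosition x)
    (ht : x ∉ G.assocGame.TE ∪ G.assocGame.TA) {a : A} {f : WFun Q}
    (hf : G.IsSucc (G.lastFun x) a f) : G.IsPosition ((a, f) :: x) := by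
  refine ⟨hx, hf, fun g hg => ⟨fun h => ht (Or.inl ⟨hx, g, hg, h⟩), fun h => ?_⟩⟩
  by_cases hg' : ∃ q ∈ g.supp, g q ≠ some ⊤
  · exact ht (Or.inr ⟨hx, g, hg, h, hg'⟩)
  · have htop : g.AllTop := fun q v hv => by
      by_contra hne
      exact hg' ⟨q, WFun.mem_supp.2 ⟨v, hv⟩, by rw [hv]; simpa using hne⟩
    refine ht (Or.inl ⟨hx, g, hg, h.1.symm, fun q v w hv hw => ?_⟩)
    rw [allTop_lastFun hx hg htop q w hw]
    exact le_top

theorem assocGame_Δ_cons {x : List (A × WFun Q)} (hx : G.IsPosition x)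
    (ht : x ∉ G.assocGame.TE ∪ G.assocGame.TA) {a : A} {f : WFun Q}
    (hf : G.IsSucc (G.lastFun x) a f) : G.assocGame.Δ x a ((a, f) :: x) :=
  ⟨hx, isPosition_cons hx ht hf, f, rfl⟩

theorem exists_isSucc [Finite Q] (hl : G.IsLimitedObservation) {f : WFun Q}
    (hf : f.supp ∈ G.Obs) (a : A) : ∃ f', G.IsSucc f a f' := by
  obtain ⟨q, hq⟩ := obs_nonempty hf
  obtain ⟨q', hq'⟩ := G.total q a
  obtain ⟨o', h1, -, h2⟩ := hl.exists_obs_subset hf (a := a) (q := q') ⟨q, hq, hq'⟩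
  obtain ⟨f', h, -⟩ := exists_min_isSucc h1 h2
  exact ⟨f', h⟩

theorem exists_assocGame_Δ [Finite Q] (hl : G.IsLimitedObservation)
    (h : List (A × List (A × WFun Q))) (hh : G.assocGame.IsHistory h)
    (ht : G.assocGame.cur h ∉ G.assocGame.TE ∪ G.assocGame.TA) (a : A) :
    ∃ s', G.assocGame.Δ (G.assocGame.cur h) a s' := by
  have hpos : G.IsPosition (G.assocGame.cur h) := by
    cases h with
    | nil => trivial
    | cons p h => exact hh.2.2.2.1
  obtain ⟨f', hf'⟩ := exists_isSucc hl (supp_lastFun_mem hl hpos) a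
  exact ⟨_, assocGame_Δ_cons hpos ht hf'⟩

theorem _root_.List.Pairwise.rel_or_rel {α : Type*} {r : α → α → Prop} {l : List α}
    (h : l.Pairwise r) {a b : α} (ha : a ∈ l) (hb : b ∈ l) (hab : a ≠ b) : r a b ∨ r b a := by
  induction h with
  | nil => simp at ha
  | cons h _ ih =>
    rcases List.mem_cons.1 ha with rfl | ha'
    · rcases List.mem_cons.1 hb with rfl | hb'
      · exact absurd rfl hab
      · exact .inl (h _ hb')
    · rcases List.mem_cons.1 hb with rfl | hb'
      · exact .inr (h _ ha')
      · exact ih ha' hb'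

/-- The list has the latest function first, so `f` is the later one of each pair. -/
theorem pairwise_earlierFuns {x : List (A × WFun Q)} (hx : G.IsPosition x) :
    (G.earlierFuns x).Pairwise fun f g => ¬ g.Prec 0 f ∧ ¬ f.Prec 1 g := by
  induction x with
  | nil => exact List.Pairwise.nil
  | cons p x ih => exact List.Pairwise.cons hx.2.2 (ih hx.1)

/-- If `g` stops the play for Eve and `g'` for Adam, then `g ⪯₁ g'` by transitivity. For `g = g'`
this contradicts the finite value of `g'`; otherwise it contradicts the position condition for the
two, whichever comes first. -/
theorem disjoint_TE_TA : Disjoint G.assocGame.TE G.assocGame.TA := by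
  rw [Set.disjoint_left]
  rintro x ⟨hx, g, hg, h⟩ ⟨-, g', hg', h', q, hq, hqt⟩
  have h1 : g.Prec 1 g' := by simpa using h.trans h'
  by_cases he : g = g'
  · subst he
    obtain ⟨v, hv⟩ := WFun.mem_supp.1 hq
    have h2 := h1.2 q v v hv hv
    have : v ≠ ⊤ := fun e => hqt (by rw [hv, e])
    lift v to ℤ using this
    norm_cast at h2
    omega
  · rcases (pairwise_earlierFuns hx).rel_or_rel hg hg' he with h2 | h2
    · exact h2.2 h1
    · exact h2.1 (h1.mono (by norm_num))

/-- Infinite values stay infinite, and Adam's final comparison needs a finite one. Hence Adam never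
discards everything on the way to a win. -/
theorem AdamForce.not_allTop [Nonempty A] {x : List (A × WFun Q)}
    (h : G.assocGame.AdamForce x) : ¬ (G.lastFun x).AllTop := by
  induction h with
  | terminal h =>
    rename_i x
    obtain ⟨hx, g, hg, h, q, hq, hqt⟩ := h
    intro ht
    have hq' : q ∈ (G.lastFun x).supp := by rw [h.1]; exact hq
    obtain ⟨v, hv⟩ := WFun.mem_supp.1 hq'
    obtain ⟨w, hw⟩ := WFun.mem_supp.1 hq
    have := h.2 q v w hv hw
    rw [ht q v hv, top_add, top_le_iff] at this
    exact hqt (by rw [hw, this])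
  | move m ht hm _ ih =>
    intro htop
    obtain a : A := Classical.arbitrary A
    obtain ⟨-, hp, f, hf⟩ := hm a
    refine ih a ?_
    rw [hf] at hp ⊢
    exact hp.2.1.allTop htop

end MPG

/-! ## Finite certificates for the mean-payoff game -/

namespace MPG

variable {Q A : Type} {G : MPG Q A}

theorem exists_payoff_bound [Finite Q] [Finite A] (G : MPG Q A) :
    ∃ W : ℕ, ∀ q a n, |G.payoff q a n| ≤ W * n := by
  obtain ⟨W, hW⟩ := (Set.finite_range fun t => (G.w t).natAbs).bddAbove
  refine ⟨W, fun q a n => ?_⟩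
  have h1 : ∀ t, |G.w t| ≤ W := fun t => by
    have := hW ⟨t, rfl⟩
    rw [Int.abs_eq_natAbs]
    exact_mod_cast this
  calc |G.payoff q a n| ≤ ∑ i ∈ Finset.range n, |G.w (q i, a i, q (i + 1))| :=
        Finset.abs_sum_le_sum_abs _ _
    _ ≤ ∑ _i ∈ Finset.range n, (W : ℤ) := Finset.sum_le_sum fun i _ => h1 _
    _ = W * n := by simp [mul_comm]

theorem abs_average_le {W : ℕ} {n : ℕ} {z : ℤ} (h : |z| ≤ W * n) : |1 / (n : ℝ) * (z : ℝ)| ≤ W := by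
  rcases Nat.eq_zero_or_pos n with rfl | hn
  · simp
  · have hn' : (0 : ℝ) < n := by exact_mod_cast hn
    have : |(z : ℝ)| ≤ W * n := by exact_mod_cast h
    rw [abs_mul, abs_of_pos (by positivity), one_div, inv_mul_le_iff₀ hn', mul_comm]
    exact this

/-- The averages lie above `-C / n`. Their boundedness must be supplied because a real `liminf` has
a junk value otherwise. -/
theorem meanPayoff_nonneg [Finite Q] [Finite A] {q : ℕ → Q} {a : ℕ → A} {C : ℤ}
    (h : ∀ n, -C ≤ G.payoff q a n) : 0 ≤ G.meanPayoff q a := by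
  obtain ⟨W, hW⟩ := exists_payoff_bound G
  have hlim : Tendsto (fun n : ℕ => 1 / (n : ℝ) * (-(C : ℝ))) atTop (nhds 0) := by
    simpa using tendsto_one_div_atTop_nhds_zero_nat.mul_const (-(C : ℝ))
  refine le_of_forall_lt_imp_le_of_dense fun b hb => ?_
  refine le_liminf_of_le (IsBoundedUnder.isCoboundedUnder_ge
    ⟨(W : ℝ), eventually_map.2 (Eventually.of_forall fun n => ?_)⟩) ?_
  · exact (abs_le.1 (abs_average_le (hW q a n))).2
  · filter_upwards [hlim.eventually (lt_mem_nhds hb)] with n hn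
    refine hn.le.trans ?_
    have : (-(C : ℝ)) ≤ G.payoff q a n := by exact_mod_cast h n
    gcongr

/-- The averages lie below `C / (N * n) - 1 / N`, so the limit inferior is at most `-1 / N`. -/
theorem meanPayoff_neg [Finite Q] [Finite A] {q : ℕ → Q} {a : ℕ → A} {C : ℤ} {N : ℕ}
    (hN : 0 < N) (h : ∀ n, N * G.payoff q a n + n ≤ C) : G.meanPayoff q a < 0 := by
  obtain ⟨W, hW⟩ := exists_payoff_bound G
  have hN' : (0 : ℝ) < N := by exact_mod_cast hN
  refine lt_of_le_of_lt (b := -(1 / (N : ℝ))) ?_ (by simpa using hN')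
  refine liminf_le_of_le ⟨-(W : ℝ), eventually_map.2 (Eventually.of_forall fun n => ?_)⟩ fun b hb => ?_
  · exact (abs_le.1 (abs_average_le (hW q a n))).1
  have hlim : Tendsto (fun n : ℕ => 1 / (n : ℝ) * ((C : ℝ) / N) - 1 / N) atTop
      (nhds (-(1 / (N : ℝ)))) := by
    simpa using (tendsto_one_div_atTop_nhds_zero_nat.mul_const ((C : ℝ) / N)).sub_const (1 / (N : ℝ))
  refine ge_of_tendsto hlim ?_
  filter_upwards [hb, eventually_gt_atTop 0] with n hn hpos
  refine hn.trans ?_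
  have hn' : (0 : ℝ) < n := by exact_mod_cast hpos
  have h1 : (N : ℝ) * G.payoff q a n + n ≤ C := by exact_mod_cast h n
  have h2 : (G.payoff q a n : ℝ) ≤ C / N - n / N := by
    rw [← sub_div, le_div_iff₀ hN']
    linarith
  calc 1 / (n : ℝ) * G.payoff q a n ≤ 1 / (n : ℝ) * (C / N - n / N) := by gcongr
    _ = _ := by field_simp

/-- A finite set of potentials that witnesses that Eve wins. -/
structure EveCert (G : MPG Q A) (L : Set (Q → Option ℤ)) : Prop where
  finite : L.Finite
  init : ∃ f ∈ L, f G.init ≠ none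
  step : ∀ f ∈ L, ∃ a, ∀ q q₁, (q, a, q₁) ∈ G.Δ → f q ≠ none → ∃ g ∈ L, ∀ q₂, G.Same q₁ q₂ →
    ∃ y, g q₂ = some y ∧ ∀ q' x, f q' = some x → (q', a, q₂) ∈ G.Δ → y ≤ x + G.w (q', a, q₂)

/-- A finite set of potentials that witnesses that Eve does not win. -/
structure AdamCert (G : MPG Q A) (N : ℕ) (L : Set (Q → Option ℤ)) : Prop where
  pos : 0 < N
  finite : L.Finite
  init : ∃ h ∈ L, h G.init ≠ none ∧ ∀ q, h q ≠ none → q = G.init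
  step : ∀ h ∈ L, ∀ a, ∃ g ∈ L, ∃ q₀, g q₀ ≠ none ∧ ∀ q y, g q = some y → G.Same q₀ q ∧
    ∃ q' x, (q', a, q) ∈ G.Δ ∧ h q' = some x ∧ x + N * G.w (q', a, q) + 1 ≤ y

theorem exists_potential_bound [Finite Q] {L : Set (Q → Option ℤ)} (hL : L.Finite) :
    ∃ B : ℤ, ∀ f ∈ L, ∀ q y, f q = some y → |y| ≤ B := by
  have := hL.to_subtype
  obtain ⟨B, hB⟩ := (Set.finite_range fun p : L × Q => |(p.1.1 p.2).getD 0|).bddAbove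
  refine ⟨B, fun f hf q y hy => ?_⟩
  have := hB ⟨(⟨f, hf⟩, q), rfl⟩
  simpa [hy] using this

/-- Eve's finite memory is a member of `L`, updated by the observations. Along a concrete path the
potential never increases by more than the weight, so the payoff is at least the difference of two
potentials, and these are bounded. -/
theorem EveCert.eveWins [Finite Q] [Finite A] (hl : G.IsLimitedObservation)
    {L : Set (Q → Option ℤ)} (h : G.EveCert L) : G.EveWins := by
  obtain ⟨f₀, hf₀, hinit⟩ := h.init
  have hA : Nonempty A := ⟨(h.step f₀ hf₀).choose⟩
  choose! act hact using h.step
  -- The next potential depends on `f` and the observation only, as an observation-based strategy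
  -- requires. Its value for unreachable observations is irrelevant.
  have key : ∀ f ∈ L, ∀ o ∈ G.Obs, ∃ g, (∃ q q₁, (q, act f, q₁) ∈ G.Δ ∧ f q ≠ none ∧ q₁ ∈ o) →
      g ∈ L ∧ ∀ q₂ ∈ o, ∃ y, g q₂ = some y ∧ ∀ q' x, f q' = some x → (q', act f, q₂) ∈ G.Δ →
        y ≤ x + G.w (q', act f, q₂) := by
    intro f hf o ho
    by_cases hq : ∃ q q₁, (q, act f, q₁) ∈ G.Δ ∧ f q ≠ none ∧ q₁ ∈ o
    · obtain ⟨q, q₁, h1, h2, h3⟩ := hq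
      obtain ⟨g, hg, hg'⟩ := hact f hf q q₁ h1 h2
      exact ⟨g, fun _ => ⟨hg, fun q₂ hq₂ => hg' q₂ ⟨o, ho, h3, hq₂⟩⟩⟩
    · exact ⟨f, fun hq' => absurd hq' hq⟩
  choose! nxt hnxt using key
  let cur : List (A × Set Q) → Q → Option ℤ := fun l => l.foldr (fun p f => nxt f p.2) f₀
  refine ⟨fun l => act (cur l), fun o a hp hs q hq => ?_⟩
  obtain ⟨B, hB⟩ := exists_potential_bound h.finite
  have hstep : ∀ i, cur (playPrefix o a i) ∈ L → cur (playPrefix o a i) (q i) ≠ none →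
      cur (playPrefix o a (i + 1)) ∈ L ∧ ∃ y, cur (playPrefix o a (i + 1)) (q (i + 1)) = some y ∧
        ∀ x, cur (playPrefix o a i) (q i) = some x → y ≤ x + G.w (q i, a i, q (i + 1)) := by
    intro i h1 h2
    have ha : a i = act (cur (playPrefix o a i)) := hs i
    obtain ⟨h3, h4⟩ := hnxt _ h1 (o (i + 1)) (hp.mem_obs _)
      ⟨q i, q (i + 1), ha ▸ (hq i).2, h2, (hq (i + 1)).1⟩
    obtain ⟨y, hy, hy'⟩ := h4 _ (hq (i + 1)).1
    refine ⟨h3, y, hy, fun x hx => ?_⟩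
    rw [ha]
    exact hy' _ x hx (ha ▸ (hq i).2)
  have hq0 : q 0 = G.init := by
    have := obs_unique (hp.mem_obs 0) hl.1 hp.start rfl
    have h0 := (hq 0).1
    rwa [this] at h0
  have hcur : ∀ i, cur (playPrefix o a i) ∈ L ∧ cur (playPrefix o a i) (q i) ≠ none := by
    intro i
    induction i with
    | zero => exact ⟨hf₀, hq0 ▸ hinit⟩
    | succ i ih =>
      obtain ⟨h1, y, hy, -⟩ := hstep i ih.1 ih.2
      exact ⟨h1, by simp [hy]⟩
  have hpay : ∀ n x y, cur (playPrefix o a 0) (q 0) = some x →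
      cur (playPrefix o a n) (q n) = some y → y ≤ x + G.payoff q a n := by
    intro n x y hx
    induction n generalizing y with
    | zero => intro hy; rw [hx] at hy; cases hy; simp [payoff]
    | succ n ih =>
      intro hy
      obtain ⟨z, hz⟩ := Option.ne_none_iff_exists'.1 (hcur n).2
      obtain ⟨-, y', hy', hle⟩ := hstep n (hcur n).1 (hcur n).2
      rw [hy] at hy'
      cases hy'
      have h1 := ih z hz
      have h2 := hle z hz
      rw [payoff, Finset.sum_range_succ, ← payoff]
      linarith
  refine meanPayoff_nonneg (C := 2 * B) fun n => ?_
  obtain ⟨x, hx⟩ := Option.ne_none_iff_exists'.1 (hcur 0).2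
  obtain ⟨y, hy⟩ := Option.ne_none_iff_exists'.1 (hcur n).2
  have h1 := abs_le.1 (hB _ (hcur 0).1 _ _ hx)
  have h2 := abs_le.1 (hB _ (hcur n).1 _ _ hy)
  have := hpay n x y hx hy
  linarith

/-- A form of König's lemma. -/
theorem exists_infinite_path [Finite Q] {P : ℕ → Q → Prop} {E : ℕ → Q → Q → Prop}
    (h0 : ∀ i, ∃ q, P i q) (hE : ∀ i q, P (i + 1) q → ∃ q', P i q' ∧ E i q' q) :
    ∃ q : ℕ → Q, ∀ i, P i (q i) ∧ E i (q i) (q (i + 1)) := by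
  -- `D n i q` says that a path with `n` steps starts in `q` at level `i`. Walking back from level
  -- `i + n` shows that such a `q` exists, and since `Q` is finite some `q` is good for all `n`.
  let D : ℕ → ℕ → Q → Prop := fun n => Nat.rec (fun i q => P i q)
    (fun _ d i q => P i q ∧ ∃ q', E i q q' ∧ d (i + 1) q') n
  have hDP : ∀ n i q, D n i q → P i q := by
    intro n i q h
    cases n with
    | zero => exact h
    | succ n => exact h.1
  have hanti : ∀ n i q, D (n + 1) i q → D n i q := by
    intro n
    induction n with
    | zero => exact fun i q h => h.1
    | succ n ih => exact fun i q ⟨h1, q', h2, h3⟩ => ⟨h1, q', h2, ih _ _ h3⟩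
  have hanti' : ∀ n m i q, n ≤ m → D m i q → D n i q := by
    intro n m i q hnm
    induction hnm with
    | refl => exact id
    | step _ ih => exact fun h => ih (hanti _ _ _ h)
  have hex : ∀ n i, ∃ q, D n i q := by
    intro n
    induction n with
    | zero => exact h0
    | succ n ih =>
      intro i
      obtain ⟨q, hq⟩ := ih (i + 1)
      obtain ⟨q', h1, h2⟩ := hE i q (hDP _ _ _ hq)
      exact ⟨q', h1, q, h2, hq⟩
  have hpigeon : ∀ (i : ℕ) (R : Q → Prop), (∀ n, ∃ q, R q ∧ D n i q) → ∃ q, R q ∧ ∀ n, D n i q := by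
    intro i R h
    by_contra hcon
    push Not at hcon
    choose! f hf using hcon
    obtain ⟨M, hM⟩ := (Set.finite_range f).bddAbove
    obtain ⟨q, h1, h2⟩ := h M
    exact hf q h1 (hanti' _ _ _ _ (hM ⟨q, rfl⟩) h2)
  obtain ⟨q₀, -, hq₀⟩ := hpigeon 0 (fun _ => True) fun n => (hex n 0).imp fun q h => ⟨trivial, h⟩
  have hnext : ∀ i q, (∀ n, D n i q) → ∃ q', E i q q' ∧ ∀ n, D n (i + 1) q' := fun i q h =>
    hpigeon (i + 1) (fun q' => E i q q') fun n => (h (n + 1)).2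
  choose! nx hnx1 hnx2 using hnext
  let p : ℕ → Q := fun n => Nat.rec q₀ (fun i q => nx i q) n
  have hp : ∀ i, ∀ n, D n i (p i) := by
    intro i
    induction i with
    | zero => exact hq₀
    | succ i ih => exact hnx2 i _ ih
  exact ⟨p, fun i => ⟨hp i 0, hnx1 i _ (hp i)⟩⟩

/-- Adam answers Eve's strategy with the functions of the certificate. Every state in the domain of
a potential has a predecessor in the domain of the previous one, so König's lemma gives an infinite
concrete path. Along it `N * payoff + n` telescopes to a bounded quantity. -/
theorem AdamCert.not_eveWins [Finite Q] [Finite A] {N : ℕ} {L : Set (Q → Option ℤ)}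
    (h : G.AdamCert N L) : ¬ G.EveWins := by
  rintro ⟨s, hs⟩
  obtain ⟨h₀, hh₀, hne, honly⟩ := h.init
  have : Nonempty Q := ⟨G.init⟩
  choose! nxt hL q₀ hq₀ hnxt using h.step
  -- The domain of a potential may be a proper part of an observation; `ob` completes it.
  let ob : (Q → Option ℤ) → Set Q := fun f => {q | ∃ q', f q' ≠ none ∧ G.Same q' q}
  have hsame : ∀ {q₁ q₂ q₃}, G.Same q₁ q₂ → G.Same q₁ q₃ → G.Same q₂ q₃ := by
    rintro q₁ q₂ q₃ ⟨o, ho, h1, h2⟩ ⟨o', ho', h3, h4⟩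
    exact ⟨o, ho, h2, (obs_unique ho ho' h1 h3) ▸ h4⟩
  have hrefl : ∀ q, G.Same q q := fun q => by
    obtain ⟨o, ho, hq⟩ := exists_obs (G := G) q
    exact ⟨o, ho, hq, hq⟩
  have hob : ∀ f q, f q ≠ none → (∀ q', f q' ≠ none → G.Same q q') → ob f ∈ G.Obs := by
    intro f q hq hf
    obtain ⟨o, ho, hqo⟩ := exists_obs (G := G) q
    have : ob f = o := by
      ext q₂
      constructor
      · rintro ⟨q', h1, h2⟩
        obtain ⟨o', ho', h3, h4⟩ := hsame (hsame (hf q' h1) (hrefl q)) h2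
        exact obs_unique ho ho' hqo h3 ▸ h4
      · exact fun h => ⟨q, hq, o, ho, hqo, h⟩
    exact this ▸ ho
  -- Potential and prefix are built together, since the next action depends on the prefix and the
  -- next observation on the potential.
  let st : ℕ → (Q → Option ℤ) × List (A × Set Q) := fun n => Nat.rec (h₀, [])
    (fun _ p => (nxt p.1 (s p.2), (s p.2, ob (nxt p.1 (s p.2))) :: p.2)) n
  let f : ℕ → Q → Option ℤ := fun n => (st n).1
  let a : ℕ → A := fun n => s (st n).2
  let o : ℕ → Set Q := fun n => ob (f n)
  have hpre : ∀ n, playPrefix o a n = (st n).2 := by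
    intro n
    induction n with
    | zero => rfl
    | succ n ih => rw [playPrefix, ih]
  have hfL : ∀ n, f n ∈ L := by
    intro n
    induction n with
    | zero => exact hh₀
    | succ n ih => exact hL _ ih _
  have hpred : ∀ n q y, f (n + 1) q = some y → ∃ q' x, (q', a n, q) ∈ G.Δ ∧ f n q' = some x ∧
      x + N * G.w (q', a n, q) + 1 ≤ y := fun n q y hy => (hnxt _ (hfL n) _ q y hy).2
  have hmem : ∀ n q, f n q ≠ none → q ∈ o n := fun n q hq => ⟨q, hq, hrefl q⟩
  have hobs : ∀ n, o n ∈ G.Obs := by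
    intro n
    cases n with
    | zero => exact hob _ G.init hne fun q' hq' => honly q' hq' ▸ hrefl _
    | succ n =>
      refine hob _ _ (hq₀ _ (hfL n) (a n)) fun q' hq' => ?_
      obtain ⟨y, hy⟩ := Option.ne_none_iff_exists'.1 hq'
      exact (hnxt _ (hfL n) _ q' y hy).1
  have hplay : G.IsPlay o a := by
    refine ⟨hmem 0 _ hne, hobs, fun i => ?_⟩
    have h1 : f (i + 1) (q₀ (f i) (a i)) ≠ none := hq₀ _ (hfL i) (a i)
    obtain ⟨y, hy⟩ := Option.ne_none_iff_exists'.1 h1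
    obtain ⟨q', x, h2, h3, -⟩ := hpred i _ y hy
    exact ⟨q', hmem i _ (by simp [h3]), _, hmem (i + 1) _ h1, h2⟩
  obtain ⟨q, hq⟩ := exists_infinite_path (P := fun i q => f i q ≠ none)
    (E := fun i q q' => (q, a i, q') ∈ G.Δ ∧ ∀ x y, f i q = some x → f (i + 1) q' = some y →
      x + N * G.w (q, a i, q') + 1 ≤ y) (fun i => by
        cases i with
        | zero => exact ⟨_, hne⟩
        | succ i => exact ⟨_, hq₀ _ (hfL i) (a i)⟩) (fun i q' hq' => by
        obtain ⟨y, hy⟩ := Option.ne_none_iff_exists'.1 hq'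
        obtain ⟨q'', x, h2, h3, h4⟩ := hpred i _ y hy
        refine ⟨q'', by simp [h3], h2, fun x' y' hx' hy' => ?_⟩
        rw [h3] at hx'
        rw [hy] at hy'
        cases hx'
        cases hy'
        exact h4)
  have hwin := hs o a hplay (fun i => by rw [hpre]) q fun i => ⟨hmem i _ (hq i).1, (hq i).2.1⟩
  obtain ⟨B, hB⟩ := exists_potential_bound h.finite
  refine absurd hwin (not_le.2 (meanPayoff_neg (C := 2 * B) h.pos fun n => ?_))
  have hpay : ∀ n x y, f 0 (q 0) = some x → f n (q n) = some y →
      x + N * G.payoff q a n + n ≤ y := by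
    intro n x y hx
    induction n generalizing y with
    | zero => intro hy; rw [hx] at hy; cases hy; simp [payoff]
    | succ n ih =>
      intro hy
      obtain ⟨z, hz⟩ := Option.ne_none_iff_exists'.1 (hq n).1
      have h1 := ih z hz
      have h2 := (hq n).2.2 z y hz hy
      rw [payoff, Finset.sum_range_succ, ← payoff]
      push_cast
      linarith
  obtain ⟨x, hx⟩ := Option.ne_none_iff_exists'.1 (hq 0).1
  obtain ⟨y, hy⟩ := Option.ne_none_iff_exists'.1 (hq n).1
  have h1 := abs_le.1 (hB _ (hfL 0) _ _ hx)
  have h2 := abs_le.1 (hB _ (hfL n) _ _ hy)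
  have := hpay n x y hx hy
  linarith

end MPG

/-! ## Winning strategies in the reachability game yield certificates -/

namespace MPG

variable {Q A : Type} {G : MPG Q A}

/-- Only Adam's moves without additional `+∞` are considered, so all functions in Eve's tree are
finite. `L` collects the inner nodes below `x`. An edge into a leaf is redirected to the earlier
function that stops the play there; this function may lie above `x`, and at the root no such exits
remain. -/
theorem EveForce.exists_potentials [Finite Q] (hl : G.IsLimitedObservation)
    {x : List (A × WFun Q)} (h : G.assocGame.EveForce x) (hx : G.IsPosition x)
    {h₀ : Q → Option ℤ} (hh₀ : G.lastFun x = WFun.lift h₀) :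
    ∃ L : Set (Q → Option ℤ), L.Finite ∧
      (∃ g, (g ∈ L ∨ WFun.lift g ∈ G.earlierFuns x) ∧ (WFun.lift g).Prec 0 (WFun.lift h₀)) ∧
      ∀ f ∈ L, (WFun.lift f).supp ∈ G.Obs ∧ ∃ a, ∀ o ∈ G.Obs, o ⊆ G.post a (WFun.lift f).supp →
        ∃ g, (g ∈ L ∨ WFun.lift g ∈ G.earlierFuns x) ∧ (WFun.lift g).supp = o ∧
          ∀ q y q' z, g q = some y → f q' = some z → (q', a, q) ∈ G.Δ →
            y ≤ z + G.w (q', a, q) := by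
  induction h generalizing h₀ with
  | terminal h =>
    obtain ⟨-, g, hg, hg'⟩ := h
    rw [hh₀] at hg'
    -- `g` has no infinite value because it lies below a finite function.
    obtain ⟨g₀, rfl⟩ : ∃ g₀, g = WFun.lift g₀ := by
      refine WFun.exists_lift fun q v hv htop => ?_
      have hq : q ∈ (WFun.lift h₀).supp := hg'.1 ▸ WFun.mem_supp.2 ⟨v, hv⟩
      obtain ⟨w, hw⟩ := WFun.mem_supp.1 hq
      have := hg'.2 q v w hv hw
      obtain ⟨z, -, rfl⟩ := WFun.lift_eq_some.1 hw
      simp [htop] at this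
    exact ⟨∅, Set.finite_empty, ⟨g₀, .inr hg, hg'⟩, by simp⟩
  | @move x a ht _ ih =>
    have key : ∀ o, ∃ (f' : Q → Option ℤ) (L : Set (Q → Option ℤ)), L.Finite ∧
        (o ∈ G.Obs → o ⊆ G.post a (WFun.lift h₀).supp → (WFun.lift f').supp = o ∧
          (∀ q y q' z, f' q = some y → h₀ q' = some z → (q', a, q) ∈ G.Δ →
            y ≤ z + G.w (q', a, q)) ∧
          (∃ g, (g ∈ L ∨ WFun.lift g ∈ G.earlierFuns ((a, WFun.lift f') :: x)) ∧
            (WFun.lift g).Prec 0 (WFun.lift f')) ∧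
          ∀ f ∈ L, (WFun.lift f).supp ∈ G.Obs ∧
            ∃ a', ∀ o ∈ G.Obs, o ⊆ G.post a' (WFun.lift f).supp →
            ∃ g, (g ∈ L ∨ WFun.lift g ∈ G.earlierFuns ((a, WFun.lift f') :: x)) ∧
              (WFun.lift g).supp = o ∧ ∀ q y q' z, g q = some y → f q' = some z →
                (q', a', q) ∈ G.Δ → y ≤ z + G.w (q', a', q)) := by
      intro o
      by_cases ho : o ∈ G.Obs ∧ o ⊆ G.post a (WFun.lift h₀).supp
      · obtain ⟨f', h1, h2, h3⟩ := exists_min_isSucc ho.1 ho.2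
        obtain ⟨f', rfl⟩ : ∃ f'', f' = WFun.lift f'' := by
          refine WFun.exists_lift fun q v hv htop => ?_
          obtain ⟨q', y, -, hy, he⟩ := (h3 q v hv).1
          obtain ⟨z, -, rfl⟩ := WFun.lift_eq_some.1 hy
          rw [htop] at he
          exact absurd he.symm (by exact_mod_cast WithTop.coe_ne_top)
        have hΔ := assocGame_Δ_cons hx ht (hh₀ ▸ h1)
        obtain ⟨L, hL, h4, h5⟩ := ih _ hΔ hΔ.2.1 rfl
        refine ⟨f', L, hL, fun _ _ => ⟨h2, fun q y q' z hy hz hΔ => ?_, h4, h5⟩⟩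
        have := (h3 q y (WFun.lift_eq_some.2 ⟨y, hy, rfl⟩)).2
          ⟨q', z, hΔ, WFun.lift_eq_some.2 ⟨z, hz, rfl⟩, rfl⟩
        exact_mod_cast this
      · exact ⟨h₀, ∅, Set.finite_empty, fun h1 h2 => absurd ⟨h1, h2⟩ ho⟩
    choose F Lo hfin hF using key
    refine ⟨{h₀} ∪ ⋃ o, ⋃ (_ : o ∈ G.Obs ∧ o ⊆ G.post a (WFun.lift h₀).supp), Lo o,
      (Set.finite_singleton _).union (Set.finite_iUnion fun o => Set.finite_iUnion fun _ => hfin o),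
      ⟨h₀, .inl (.inl rfl), WFun.Prec.refl _⟩, ?_⟩
    -- An earlier function of a child is either an earlier function of `x` or `h₀` itself, which now
    -- belongs to the set.
    have htrans : ∀ o, o ∈ G.Obs ∧ o ⊆ G.post a (WFun.lift h₀).supp → ∀ g,
        (g ∈ Lo o ∨ WFun.lift g ∈ G.earlierFuns ((a, WFun.lift (F o)) :: x)) →
        (g ∈ {h₀} ∪ ⋃ o, ⋃ (_ : o ∈ G.Obs ∧ o ⊆ G.post a (WFun.lift h₀).supp), Lo o) ∨
          WFun.lift g ∈ G.earlierFuns x := by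
      rintro o ho g (hg | hg)
      · exact .inl (.inr (Set.mem_iUnion₂.2 ⟨o, ho, hg⟩))
      · rw [earlierFuns, List.mem_cons, hh₀] at hg
        rcases hg with hg | hg
        · exact .inl (.inl (WFun.lift_injective hg))
        · exact .inr hg
    rintro f (rfl | hf)
    · refine ⟨hh₀ ▸ supp_lastFun_mem hl hx, a, fun o ho hsub => ?_⟩
      -- The edge leads to some `g ⪯₀ F o` instead of `F o`; a smaller potential still satisfies the
      -- inequalities.
      obtain ⟨h1, h2, ⟨g, h3, h4⟩, -⟩ := hF o ho hsub
      refine ⟨g, htrans o ⟨ho, hsub⟩ g h3, h4.1.trans h1, fun q y q' z hy hz hΔ => ?_⟩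
      have hq : q ∈ (WFun.lift (F o)).supp := by
        rw [← h4.1]; exact WFun.mem_supp_lift.2 (by simp [hy])
      obtain ⟨u, hu⟩ := Option.ne_none_iff_exists'.1 (WFun.mem_supp_lift.1 hq)
      have h5 := h4.2 q y u (WFun.lift_eq_some.2 ⟨y, hy, rfl⟩) (WFun.lift_eq_some.2 ⟨u, hu, rfl⟩)
      have h6 := h2 q u q' z hu hz hΔ
      simp only [Nat.cast_zero, add_zero, WithTop.coe_le_coe] at h5
      exact h5.trans h6
    · obtain ⟨o', ho', hf⟩ := Set.mem_iUnion₂.1 hf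
      obtain ⟨h1, a', h2⟩ := (hF o' ho'.1 ho'.2).2.2.2 f hf
      refine ⟨h1, a', fun o ho hsub => ?_⟩
      obtain ⟨g, h3, h4⟩ := h2 o ho hsub
      exact ⟨g, htrans o' ho' g h3, h4⟩

theorem exists_eveCert [Finite Q] (hl : G.IsLimitedObservation)
    (h : G.assocGame.EveForce G.assocGame.init) : ∃ L, G.EveCert L := by
  classical
  have hinit : G.initFun = WFun.lift fun q => if q = G.init then some 0 else none := by
    funext q
    by_cases hq : q = G.init <;> simp [initFun, WFun.lift, hq]
  obtain ⟨L, hL, ⟨g, hg, hg'⟩, hstep⟩ := EveForce.exists_potentials hl h trivial hinit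
  have hno : ∀ g, ¬ WFun.lift g ∈ G.earlierFuns G.assocGame.init := fun g => by
    simp [assocGame, earlierFuns]
  refine ⟨L, hL, ⟨g, hg.resolve_right (hno _), ?_⟩, fun f hf => ?_⟩
  · rw [← WFun.mem_supp_lift, hg'.1, WFun.mem_supp_lift]
    simp
  · obtain ⟨h1, a, h2⟩ := hstep f hf
    refine ⟨a, fun q q₁ hΔ hq => ?_⟩
    obtain ⟨o, ho, hqo, hsub⟩ := hl.exists_obs_subset h1 (a := a) (q := q₁)
      ⟨q, WFun.mem_supp_lift.2 hq, hΔ⟩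
    obtain ⟨g, h3, rfl, h4⟩ := h2 o ho hsub
    refine ⟨g, h3.resolve_right (hno _), ?_⟩
    rintro q₂ ⟨o', ho', h5, h6⟩
    rw [obs_unique ho' ho h5 hqo] at h6
    obtain ⟨y, hy⟩ := Option.ne_none_iff_exists'.1 (WFun.mem_supp_lift.1 h6)
    exact ⟨y, hy, fun q' x hx hΔ => h4 q₂ y q' x hy hx hΔ⟩

/-- The functions in `earlierFuns` together with their indices. -/
noncomputable def indexedFuns (G : MPG Q A) : List (A × WFun Q) → Set (WFun Q × ℕ)
  | [] => ∅
  | (_, _) :: x => insert (G.lastFun x, x.length) (indexedFuns G x)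

theorem exists_mem_indexedFuns {x : List (A × WFun Q)} {g : WFun Q} (h : g ∈ G.earlierFuns x) :
    ∃ k, (g, k) ∈ G.indexedFuns x := by
  induction x with
  | nil => simp [earlierFuns] at h
  | cons p x ih =>
    rcases List.mem_cons.1 h with rfl | h
    · exact ⟨x.length, .inl rfl⟩
    · exact (ih h).imp fun k hk => .inr hk

/-- The nodes carry their depth in the tree, since there are two kinds of progress. An edge inside
the tree increases the depth, while a jump from a leaf back to an earlier function gains one unit by
`⪯₁`. A finite value at a successor is attained from a finite value before it, so states with value
`+∞` can be dropped. -/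
theorem AdamForce.exists_potentials [Finite A] [Nonempty A] {x : List (A × WFun Q)} (h : G.assocGame.AdamForce x) (hx : G.IsPosition x) :
    ∃ L : Set (WFun Q × ℕ), L.Finite ∧
      (∃ p, (p ∈ L ∨ p ∈ G.indexedFuns x) ∧ ¬ p.1.AllTop ∧
        (p = (G.lastFun x, x.length) ∨ (G.lastFun x).Prec 1 p.1)) ∧
      ∀ p ∈ L, ∀ a, ∃ r, (r ∈ L ∨ r ∈ G.indexedFuns x) ∧ r.1.supp ∈ G.Obs ∧ ¬ r.1.AllTop ∧
        ∀ q (y : ℤ), r.1 q = some y → ∃ q', ∃ z : ℤ, (q', a, q) ∈ G.Δ ∧ p.1 q' = some z ∧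
          ((z + G.w (q', a, q) ≤ y ∧ p.2 < r.2) ∨ z + G.w (q', a, q) + 1 ≤ y) := by
  induction h with
  | terminal h =>
    obtain ⟨-, g, hg, hg', q, hq, hqt⟩ := h
    obtain ⟨k, hk⟩ := exists_mem_indexedFuns hg
    refine ⟨∅, Set.finite_empty, ⟨(g, k), .inr hk, fun htop => hqt ?_, .inr hg'⟩, by simp⟩
    obtain ⟨v, hv⟩ := WFun.mem_supp.1 hq
    rw [hv, htop q v hv]
  | @move x m ht hm hf ih =>
    have hnt := AdamForce.not_allTop (.move m ht hm hf)
    have key : ∀ a, ∃ (f' : WFun Q) (L : Set (WFun Q × ℕ)), G.IsSucc (G.lastFun x) a f' ∧ L.Finite ∧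
        (∃ p, (p ∈ L ∨ p ∈ insert (G.lastFun x, x.length) (G.indexedFuns x)) ∧ ¬ p.1.AllTop ∧
          (p = (f', x.length + 1) ∨ f'.Prec 1 p.1)) ∧
        ∀ p ∈ L, ∀ a, ∃ r, (r ∈ L ∨ r ∈ insert (G.lastFun x, x.length) (G.indexedFuns x)) ∧
          r.1.supp ∈ G.Obs ∧ ¬ r.1.AllTop ∧
          ∀ q (y : ℤ), r.1 q = some y → ∃ q', ∃ z : ℤ, (q', a, q) ∈ G.Δ ∧ p.1 q' = some z ∧
            ((z + G.w (q', a, q) ≤ y ∧ p.2 < r.2) ∨ z + G.w (q', a, q) + 1 ≤ y) := by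
      intro a
      obtain ⟨-, hp, f', he⟩ := hm a
      have := ih a hp
      rw [he] at hp this
      exact ⟨f', this.choose, hp.2.1, this.choose_spec⟩
    choose F La hF hfin hLa hstep using key
    have htrans : ∀ a r, (r ∈ La a ∨ r ∈ insert (G.lastFun x, x.length) (G.indexedFuns x)) →
        (r ∈ {(G.lastFun x, x.length)} ∪ ⋃ a, La a) ∨ r ∈ G.indexedFuns x := by
      rintro a r (hr | rfl | hr)
      · exact .inl (.inr (Set.mem_iUnion.2 ⟨a, hr⟩))
      · exact .inl (.inl rfl)
      · exact .inr hr
    refine ⟨{(G.lastFun x, x.length)} ∪ ⋃ a, La a,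
      (Set.finite_singleton _).union (Set.finite_iUnion hfin),
      ⟨_, .inl (.inl rfl), hnt, .inl rfl⟩, ?_⟩
    rintro p (rfl | hp) a
    · obtain ⟨r, h1, h2, h3⟩ := hLa a
      have hs : r.1.supp = (F a).supp := by
        rcases h3 with rfl | h3
        · rfl
        · exact h3.1.symm
      refine ⟨r, htrans a r h1, hs ▸ (hF a).1, h2, fun q y hy => ?_⟩
      have hq : q ∈ (F a).supp := hs ▸ WFun.mem_supp.2 ⟨_, hy⟩
      -- Either `r` is the new node, with depth `x.length + 1`, or it is an earlier function,
      -- exceeding `F a` by at least one.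
      have hle : ∃ v : WithTop ℤ, F a q = some v ∧ v ≠ ⊤ ∧
          ((v ≤ y ∧ x.length < r.2) ∨ v + 1 ≤ y) := by
        rcases h3 with rfl | h3
        · exact ⟨y, hy, by simp, .inl ⟨le_rfl, Nat.lt_succ_self _⟩⟩
        · obtain ⟨v, hv⟩ := WFun.mem_supp.1 hq
          have := h3.2 q v y hv hy
          refine ⟨v, hv, ?_, .inr (by exact_mod_cast this)⟩
          rintro rfl
          simp at this
      obtain ⟨v, hv, hvt, hle⟩ := hle
      rcases (hF a).2.2 q hq with h4 | ⟨u, hu, ⟨q', z, hΔ, hz, hu'⟩, -⟩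
      · rw [hv] at h4
        exact absurd (Option.some.inj h4) hvt
      · rw [hv] at hu
        cases hu
        have hzt : z ≠ ⊤ := by
          rintro rfl
          exact hvt (by rw [hu', top_add])
        lift z to ℤ using hzt
        refine ⟨q', z, hΔ, hz, ?_⟩
        rw [hu'] at hle
        exact_mod_cast hle
    · obtain ⟨a', hp⟩ := Set.mem_iUnion.1 hp
      obtain ⟨r, h1, h2⟩ := hstep a' p hp a
      exact ⟨r, htrans a' r h1, h2⟩

/-- The finite values of `f`, multiplied by `N` and increased by `k`. -/
def scaledPotential (N : ℕ) (f : WFun Q) (k : ℕ) : Q → Option ℤ := fun q =>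
  (f q).bind fun v => WithTop.recTopCoe none (fun z : ℤ => some (N * z + k)) v

theorem scaledPotential_eq_some {N k : ℕ} {f : WFun Q} {q : Q} {y : ℤ} :
    scaledPotential N f k q = some y ↔ ∃ z : ℤ, f q = some z ∧ N * z + k = y := by
  rcases h : f q with _ | v
  · simp [scaledPotential, h]
  · induction v using WithTop.recTopCoe with
    | top => simp [scaledPotential, h]
    | coe z => simp [scaledPotential, h]

/-- The two kinds of progress are merged in the potential `(N + 1) * z + k` with the depth `k ≤ N`.
A tree edge raises `k`; a jump back loses at most `N` in the depth, which the gain of `N + 1`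
outweighs. -/
theorem exists_adamCert [Finite A] [Nonempty A]
    (h : G.assocGame.AdamForce G.assocGame.init) : ∃ N L, G.AdamCert N L := by
  obtain ⟨L, hL, ⟨p₀, h1, h2, h3⟩, hstep⟩ := AdamForce.exists_potentials h trivial
  have hno : ∀ p, p ∉ G.indexedFuns G.assocGame.init := fun p => by
    simp [assocGame, indexedFuns]
  replace h1 := h1.resolve_right (hno _)
  obtain ⟨N, hN⟩ := (hL.image Prod.snd).bddAbove
  have hfinite : ∀ p : WFun Q × ℕ, ¬ p.1.AllTop → ∃ q, scaledPotential (N + 1) p.1 p.2 q ≠ none := by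
    intro p hp
    simp only [WFun.AllTop, not_forall] at hp
    obtain ⟨q, v, hv, hvt⟩ := hp
    lift v to ℤ using hvt
    exact ⟨q, Option.ne_none_iff_exists'.2 ⟨_, scaledPotential_eq_some.2 ⟨v, hv, rfl⟩⟩⟩
  have hs : p₀.1.supp = {G.init} := by
    rw [← supp_initFun]
    rcases h3 with rfl | h3
    · rfl
    · exact h3.1.symm
  have honly : ∀ q, scaledPotential (N + 1) p₀.1 p₀.2 q ≠ none → q = G.init := by
    intro q hq
    obtain ⟨y, hy⟩ := Option.ne_none_iff_exists'.1 hq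
    obtain ⟨z, hz, -⟩ := scaledPotential_eq_some.1 hy
    have : q ∈ p₀.1.supp := WFun.mem_supp.2 ⟨_, hz⟩
    rwa [hs] at this
  refine ⟨N + 1, (fun p => scaledPotential (N + 1) p.1 p.2) '' L, N.succ_pos, hL.image _,
    ⟨_, ⟨p₀, h1, rfl⟩, ?_, honly⟩, ?_⟩
  · obtain ⟨q, hq⟩ := hfinite p₀ h2
    exact honly q hq ▸ hq
  · rintro _ ⟨p, hp, rfl⟩ a
    obtain ⟨r, hr, hobs, hnt, hr'⟩ := hstep p hp a
    replace hr := hr.resolve_right (hno _)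
    obtain ⟨q₀, hq₀⟩ := hfinite r hnt
    refine ⟨_, ⟨r, hr, rfl⟩, q₀, hq₀, fun q y hy => ?_⟩
    obtain ⟨z, hz, rfl⟩ := scaledPotential_eq_some.1 hy
    obtain ⟨y₀, hy₀⟩ := Option.ne_none_iff_exists'.1 hq₀
    obtain ⟨z₀, hz₀, -⟩ := scaledPotential_eq_some.1 hy₀
    refine ⟨⟨_, hobs, WFun.mem_supp.2 ⟨_, hz₀⟩, WFun.mem_supp.2 ⟨_, hz⟩⟩, ?_⟩
    obtain ⟨q', u, hΔ, hu, hle⟩ := hr' q z hz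
    refine ⟨q', _, hΔ, scaledPotential_eq_some.2 ⟨u, hu, rfl⟩, ?_⟩
    have hpN : p.2 ≤ N := hN ⟨p, hp, rfl⟩
    have hN0 : (0 : ℤ) ≤ N := by positivity
    push_cast
    rcases hle with ⟨hle, hlt⟩ | hle <;> nlinarith

theorem eveWins_of_assocGame [Finite Q] [Finite A] (hl : G.IsLimitedObservation)
    (h : G.assocGame.EveWins) : G.EveWins :=
  (exists_eveCert hl h.eveForce).choose_spec.eveWins hl

theorem not_eveWins_of_assocGame [Finite Q] [Finite A] [Nonempty A]
    (h : G.assocGame.AdamWins) : ¬ G.EveWins :=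
  (exists_adamCert h.adamForce).choose_spec.choose_spec.not_eveWins

end MPG

/-! ## Primitive recursive functions and predicates -/

attribute [fun_prop] Primrec
attribute [fun_prop] Primrec.id Primrec.const Primrec.comp Primrec.fst Primrec.snd Primrec.pair

section Primrec

variable {α β γ : Type*} [Primcodable α] [Primcodable β] [Primcodable γ]

namespace Primrec

@[fun_prop]
theorem fun_add {f g : α → ℕ} (hf : Primrec f) (hg : Primrec g) : Primrec fun x => f x + g x :=
  nat_add.comp hf hg

@[fun_prop]
theorem fun_mul {f g : α → ℕ} (hf : Primrec f) (hg : Primrec g) : Primrec fun x => f x * g x :=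
  nat_mul.comp hf hg

@[fun_prop]
theorem fun_getD {f : α → List β} {g : α → ℕ} {d : β} (hf : Primrec f) (hg : Primrec g) :
    Primrec fun x => (f x).getD (g x) d :=
  (list_getD d).comp hf hg

@[fun_prop]
theorem fun_cons {f : α → β} {g : α → List β} (hf : Primrec f) (hg : Primrec g) :
    Primrec fun x => f x :: g x :=
  list_cons.comp hf hg

@[fun_prop]
theorem fun_append {f g : α → List β} (hf : Primrec f) (hg : Primrec g) :
    Primrec fun x => f x ++ g x :=
  list_append.comp hf hg

@[fun_prop]
theorem fun_tail {f : α → List β} (hf : Primrec f) : Primrec fun x => (f x).tail :=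
  list_tail.comp hf

@[fun_prop]
theorem fun_headI [Inhabited β] {f : α → List β} (hf : Primrec f) : Primrec fun x => (f x).headI :=
  list_headI.comp hf

end Primrec

namespace PrimrecPred

theorem forall_lt_fun {f : α → ℕ} {R : α → ℕ → Prop} (hf : Primrec f)
    (hR : PrimrecPred fun p : α × ℕ => R p.1 p.2) : PrimrecPred fun a => ∀ x < f a, R a x :=
  ((PrimrecRel.forall_mem_list (R := fun x a => R a x)
    (PrimrecPred.comp hR (Primrec.snd.pair Primrec.fst))).comp
      (Primrec.list_range.comp hf) Primrec.id).of_eq fun a => by simp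

theorem exists_lt_fun {f : α → ℕ} {R : α → ℕ → Prop} (hf : Primrec f)
    (hR : PrimrecPred fun p : α × ℕ => R p.1 p.2) : PrimrecPred fun a => ∃ x < f a, R a x :=
  ((PrimrecRel.exists_mem_list (R := fun x a => R a x)
    (PrimrecPred.comp hR (Primrec.snd.pair Primrec.fst))).comp
      (Primrec.list_range.comp hf) Primrec.id).of_eq fun a => by simp

theorem imp {p q : α → Prop} (hp : PrimrecPred p) (hq : PrimrecPred q) :
    PrimrecPred fun a => p a → q a :=
  (hp.not.or hq).of_eq fun _ => imp_iff_not_or.symm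

theorem fun_eq [DecidableEq β] {f g : α → β} (hf : Primrec f) (hg : Primrec g) :
    PrimrecPred fun a => f a = g a :=
  Primrec.eq.comp hf hg

theorem fun_ne [DecidableEq β] {f g : α → β} (hf : Primrec f) (hg : Primrec g) :
    PrimrecPred fun a => f a ≠ g a :=
  (Primrec.eq.comp hf hg).not

theorem fun_le {f g : α → ℕ} (hf : Primrec f) (hg : Primrec g) : PrimrecPred fun a => f a ≤ g a :=
  Primrec.nat_le.comp hf hg

theorem fun_lt {f g : α → ℕ} (hf : Primrec f) (hg : Primrec g) : PrimrecPred fun a => f a < g a :=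
  Primrec.nat_lt.comp hf hg

end PrimrecPred

end Primrec

/-- The inverse of `natsToWord`. -/
def wordToNats (w : List Bool) : List ℕ :=
  w.foldr (fun b l => bif b then (l.headI + 1) :: l.tail else 0 :: l) []

theorem wordToNats_natsToWord (l : List ℕ) : wordToNats (natsToWord l) = l := by
  induction l with
  | nil => rfl
  | cons n l ih =>
    simp only [natsToWord, wordToNats, List.flatMap_cons, List.append_assoc,
      List.singleton_append, List.foldr_append, List.foldr_cons] at ih ⊢
    rw [ih]
    induction n with
    | zero => rfl
    | succ n ihn => rw [List.replicate_succ, List.foldr_cons, ihn]; simp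

@[fun_prop]
theorem primrec_wordToNats : Primrec wordToNats := by
  refine Primrec.list_foldr (h := fun _ p => bif p.1 then (p.2.headI + 1) :: p.2.tail else 0 :: p.2)
    Primrec.id (Primrec.const []) ?_
  refine Primrec.cond (c := fun p : List Bool × Bool × List ℕ => p.2.1) ?_ ?_ ?_ <;> fun_prop

/-! ## Search for certificates -/

namespace GameCode

/-- The entries of a list that describes a game. -/
def entry (d : List ℕ) (i : ℕ) : ℕ := d.getD i 0

/-- The entries of the `k`-th transition in a list that describes a game. -/
def transEntry (d : List ℕ) (k c : ℕ) : ℕ := entry d (4 + entry d 0 + 5 * k + c)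

/-- The `i`-th potential in the list `c`, at the state `q`; `0` means that it is undefined. -/
def potEntry (d c : List ℕ) (i q : ℕ) : ℕ := entry c (2 + i * entry d 0 + q)

/-- The list `c` codes a certificate that Eve wins. -/
def CodesEveCert (d c : List ℕ) : Prop :=
  (∃ i < entry c 0, potEntry d c i (entry d 2) ≠ 0) ∧
  ∀ i < entry c 0, ∃ a < entry d 1, ∀ k < entry d (3 + entry d 0),
    transEntry d k 1 = a → potEntry d c i (transEntry d k 0) ≠ 0 →
    ∃ j < entry c 0, ∀ q < entry d 0, entry d (3 + q) = entry d (3 + transEntry d k 2) →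
      potEntry d c j q ≠ 0 ∧ ∀ l < entry d (3 + entry d 0), transEntry d l 1 = a →
        transEntry d l 2 = q → potEntry d c i (transEntry d l 0) ≠ 0 →
        potEntry d c j q + transEntry d l 4 ≤
          potEntry d c i (transEntry d l 0) + transEntry d l 3

/-- The list `c` codes a certificate that Eve does not win. -/
def CodesAdamCert (d c : List ℕ) : Prop :=
  0 < entry c 1 ∧
  (∃ i < entry c 0, potEntry d c i (entry d 2) ≠ 0 ∧
    ∀ q < entry d 0, potEntry d c i q ≠ 0 → q = entry d 2) ∧
  ∀ i < entry c 0, ∀ a < entry d 1, ∃ j < entry c 0, ∃ q₀ < entry d 0, potEntry d c j q₀ ≠ 0 ∧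
    ∀ q < entry d 0, potEntry d c j q ≠ 0 → entry d (3 + q₀) = entry d (3 + q) ∧
      ∃ l < entry d (3 + entry d 0), transEntry d l 1 = a ∧ transEntry d l 2 = q ∧
        potEntry d c i (transEntry d l 0) ≠ 0 ∧
        potEntry d c i (transEntry d l 0) + entry c 1 * transEntry d l 3 + 1 ≤
          potEntry d c j q + entry c 1 * transEntry d l 4

/-- All quantifiers are bounded by entries of the lists, and the positive and negative parts of the
weights stand on different sides, so no subtraction in `ℕ` occurs. -/
theorem primrecPred_codesEveCert :
    PrimrecPred fun p : List ℕ × List ℕ => CodesEveCert p.1 p.2 := by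
  unfold CodesEveCert potEntry transEntry entry
  repeat' first
    | with_reducible apply PrimrecPred.fun_ne
    | with_reducible apply PrimrecPred.and
    | with_reducible apply PrimrecPred.exists_lt_fun
    | with_reducible apply PrimrecPred.forall_lt_fun
    | with_reducible apply PrimrecPred.imp
    | with_reducible apply PrimrecPred.fun_eq
    | with_reducible apply PrimrecPred.fun_le
    | fun_prop

theorem primrecPred_codesAdamCert :
    PrimrecPred fun p : List ℕ × List ℕ => CodesAdamCert p.1 p.2 := by
  unfold CodesAdamCert potEntry transEntry entry
  repeat' first
    | with_reducible apply PrimrecPred.fun_ne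
    | with_reducible apply PrimrecPred.and
    | with_reducible apply PrimrecPred.exists_lt_fun
    | with_reducible apply PrimrecPred.forall_lt_fun
    | with_reducible apply PrimrecPred.imp
    | with_reducible apply PrimrecPred.fun_eq
    | with_reducible apply PrimrecPred.fun_le
    | with_reducible apply PrimrecPred.fun_lt
    | fun_prop

theorem getD_flatMap {α β : Type*} (f : α → List β) (n : ℕ) (hf : ∀ a, (f a).length = n) (d : β)
    (l : List α) (k : ℕ) (hk : k < l.length) (c : ℕ) (hc : c < n) :
    (l.flatMap f).getD (n * k + c) d = (f l[k]).getD c d := by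
  induction l generalizing k with
  | nil => simp at hk
  | cons a l ih =>
    cases k with
    | zero => simp [List.getD_eq_getElem?_getD, List.getElem?_append, hf, hc]
    | succ k =>
      have h1 : n * (k + 1) + c = (f a).length + (n * k + c) := by rw [hf]; ring
      rw [List.flatMap_cons, h1, List.getD_append_right _ _ _ _ (Nat.le_add_right _ _),
        Nat.add_sub_cancel_left]
      exact ih k (by simpa using hk)

/-! ### Reading a game from the list that describes it. -/

variable (C : GameCode)

theorem entry_toNats_zero : entry C.toNats 0 = C.numStates := rfl

theorem entry_toNats_one : entry C.toNats 1 = C.numActions := rfl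

theorem entry_toNats_two : entry C.toNats 2 = C.init := rfl

theorem entry_toNats_label (q : Fin C.numStates) : entry C.toNats (3 + q) = C.label q := by
  have : (q : ℕ) < (List.ofFn C.label).length := by simp
  simp [entry, toNats, List.getD_eq_getElem?_getD, List.getElem?_append, add_comm 3]

theorem entry_toNats_length : entry C.toNats (3 + C.numStates) = C.trans.length := by
  simp [entry, toNats, List.getD_eq_getElem?_getD, add_comm 3]

/-- Three leading numbers, the labels and the number of transitions come first; this is the offset
`4 + numStates`. -/
theorem transEntry_toNats (k c : ℕ) (hk : k < C.trans.length) (hc : c < 5) :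
    transEntry C.toNats k c = [(C.trans[k].1 : ℕ), (C.trans[k].2.1 : ℕ), (C.trans[k].2.2.1 : ℕ),
      C.trans[k].2.2.2.toNat, (-C.trans[k].2.2.2).toNat].getD c 0 := by
  rw [transEntry, entry_toNats_zero, entry, toNats,
    List.getD_append_right _ _ _ _ (by simp; omega)]
  rw [← getD_flatMap (fun t : Fin C.numStates × Fin C.numActions × Fin C.numStates × ℤ =>
    [(t.1 : ℕ), (t.2.1 : ℕ), (t.2.2.1 : ℕ), t.2.2.2.toNat, (-t.2.2.2).toNat]) 5 (fun _ => rfl) 0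
    C.trans k hk c hc]
  congr 1
  simp
  omega

theorem transEntry_toNats_weight (k : ℕ) (hk : k < C.trans.length) :
    (transEntry C.toNats k 3 : ℤ) - transEntry C.toNats k 4 = C.trans[k].2.2.2 := by
  rw [transEntry_toNats C k 3 hk (by norm_num), transEntry_toNats C k 4 hk (by norm_num)]
  simp only [List.getD_cons_succ, List.getD_cons_zero]
  omega

theorem mem_toMPG_Δ {q : Fin C.numStates} {a : Fin C.numActions} {q' : Fin C.numStates} :
    (q, a, q') ∈ C.toMPG.Δ ↔ ∃ z, (q, a, q', z) ∈ C.trans := Iff.rfl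

theorem toMPG_w {q : Fin C.numStates} {a : Fin C.numActions} {q' : Fin C.numStates} {z : ℤ}
    (h : (q, a, q', z) ∈ C.trans) : C.toMPG.w (q, a, q') = z := by
  have hex : ∃ z, (q, a, q', z) ∈ C.trans := ⟨z, h⟩
  simp only [toMPG, hex, dite_true]
  exact C.weight_unique _ _ _ _ _ hex.choose_spec h

theorem toMPG_same {q q' : Fin C.numStates} : C.toMPG.Same q q' ↔ C.label q = C.label q' := by
  constructor
  · rintro ⟨o, ⟨r, rfl⟩, h1, h2⟩
    exact (show C.label q = C.label r from h1).trans (show C.label q' = C.label r from h2).symm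
  · intro h
    exact ⟨_, ⟨q', rfl⟩, h, rfl⟩

/-- Transitions and the indices of their entries. -/
theorem exists_index {q : Fin C.numStates} {a : Fin C.numActions} {q' : Fin C.numStates}
    (h : (q, a, q') ∈ C.toMPG.Δ) : ∃ k < C.trans.length, transEntry C.toNats k 0 = q ∧
      transEntry C.toNats k 1 = a ∧ transEntry C.toNats k 2 = q' ∧
      (transEntry C.toNats k 3 : ℤ) - transEntry C.toNats k 4 = C.toMPG.w (q, a, q') := by
  obtain ⟨z, hz⟩ := h
  obtain ⟨k, hk, he⟩ := List.getElem_of_mem hz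
  refine ⟨k, hk, ?_, ?_, ?_, ?_⟩
  · rw [transEntry_toNats C k 0 hk (by norm_num), he]; rfl
  · rw [transEntry_toNats C k 1 hk (by norm_num), he]; rfl
  · rw [transEntry_toNats C k 2 hk (by norm_num), he]; rfl
  · rw [transEntry_toNats_weight C k hk, he, toMPG_w C hz]

theorem exists_trans {k : ℕ} (hk : k < C.trans.length) : ∃ q a q', (q, a, q') ∈ C.toMPG.Δ ∧
    transEntry C.toNats k 0 = (q : ℕ) ∧ transEntry C.toNats k 1 = (a : ℕ) ∧
    transEntry C.toNats k 2 = (q' : ℕ) ∧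
    (transEntry C.toNats k 3 : ℤ) - transEntry C.toNats k 4 = C.toMPG.w (q, a, q') := by
  have hmem : C.trans[k] ∈ C.trans := List.getElem_mem hk
  refine ⟨C.trans[k].1, C.trans[k].2.1, C.trans[k].2.2.1, ⟨C.trans[k].2.2.2, hmem⟩, ?_, ?_, ?_, ?_⟩
  · rw [transEntry_toNats C k 0 hk (by norm_num)]; rfl
  · rw [transEntry_toNats C k 1 hk (by norm_num)]; rfl
  · rw [transEntry_toNats C k 2 hk (by norm_num)]; rfl
  · rw [transEntry_toNats_weight C k hk]
    exact (toMPG_w C hmem).symm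

/-- A potential that is coded by numbers. -/
def decodePot {n : ℕ} (φ : ℕ → ℕ) : Fin n → Option ℤ := fun q =>
  if φ q = 0 then none else some (φ q)

theorem decodePot_eq_some {n : ℕ} {φ : ℕ → ℕ} {q : Fin n} {y : ℤ} :
    decodePot φ q = some y ↔ φ q ≠ 0 ∧ (φ q : ℤ) = y := by
  by_cases h : φ q = 0 <;> simp [decodePot, h]

theorem decodePot_ne_none {n : ℕ} {φ : ℕ → ℕ} {q : Fin n} :
    decodePot φ q ≠ none ↔ φ q ≠ 0 := by
  by_cases h : φ q = 0 <;> simp [decodePot, h]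

theorem CodesEveCert.eveCert {c : List ℕ} (h : CodesEveCert C.toNats c) :
    ∃ L, C.toMPG.EveCert L := by
  obtain ⟨⟨i₀, hi₀, h0⟩, hstep⟩ := h
  rw [entry_toNats_two] at h0
  rw [entry_toNats_zero, entry_toNats_one, entry_toNats_length] at hstep
  refine ⟨(fun i => decodePot (potEntry C.toNats c i)) '' {i | i < entry c 0},
    (Set.finite_lt_nat _).image _, ⟨_, ⟨i₀, hi₀, rfl⟩, decodePot_ne_none.2 h0⟩, ?_⟩
  rintro _ ⟨i, hi, rfl⟩
  obtain ⟨a, ha, hstep⟩ := hstep i hi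
  refine ⟨⟨a, ha⟩, fun q q₁ hΔ hq => ?_⟩
  obtain ⟨k, hk, hk0, hk1, hk2, -⟩ := exists_index C hΔ
  obtain ⟨j, hj, hstep⟩ := hstep k hk hk1 (hk0 ▸ decodePot_ne_none.1 hq)
  refine ⟨_, ⟨j, hj, rfl⟩, fun q₂ hs => ?_⟩
  rw [toMPG_same] at hs
  obtain ⟨h1, h2⟩ := hstep q₂ q₂.2 (by rw [hk2, entry_toNats_label, entry_toNats_label, hs])
  refine ⟨_, decodePot_eq_some.2 ⟨h1, rfl⟩, fun q' x hx hΔ' => ?_⟩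
  obtain ⟨l, hl, hl0, hl1, hl2, hw⟩ := exists_index C hΔ'
  obtain ⟨hx0, rfl⟩ := decodePot_eq_some.1 hx
  have := h2 l hl hl1 hl2 (hl0 ▸ hx0)
  rw [hl0] at this
  rw [← hw]
  omega

theorem CodesAdamCert.adamCert {c : List ℕ} (h : CodesAdamCert C.toNats c) :
    ∃ N L, C.toMPG.AdamCert N L := by
  obtain ⟨hN, ⟨i₀, hi₀, h0, honly⟩, hstep⟩ := h
  rw [entry_toNats_two] at h0 honly
  rw [entry_toNats_zero, entry_toNats_one, entry_toNats_length] at hstep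
  refine ⟨entry c 1, (fun i => decodePot (potEntry C.toNats c i)) '' {i | i < entry c 0}, hN,
    (Set.finite_lt_nat _).image _, ⟨_, ⟨i₀, hi₀, rfl⟩, decodePot_ne_none.2 h0, fun q hq =>
      Fin.ext (honly q q.2 (decodePot_ne_none.1 hq))⟩, ?_⟩
  rintro _ ⟨i, hi, rfl⟩ a
  obtain ⟨j, hj, q₀, hq₀, hne, hstep⟩ := hstep i hi a a.2
  refine ⟨_, ⟨j, hj, rfl⟩, ⟨q₀, hq₀⟩, decodePot_ne_none.2 hne, fun q y hy => ?_⟩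
  obtain ⟨hy0, rfl⟩ := decodePot_eq_some.1 hy
  obtain ⟨hlab, l, hl, hl1, hl2, hl0, hle⟩ := hstep q q.2 hy0
  have hq₀' := entry_toNats_label C ⟨q₀, hq₀⟩
  simp only at hq₀'
  rw [hq₀', entry_toNats_label] at hlab
  obtain ⟨q', a', q'', hΔ, h3, h4, h5, hw⟩ := exists_trans C hl
  obtain rfl : a' = a := Fin.ext (h4.symm.trans hl1)
  obtain rfl : q'' = q := Fin.ext (h5.symm.trans hl2)
  rw [h3] at hl0 hle
  refine ⟨(toMPG_same C).2 hlab, q', _, hΔ, decodePot_eq_some.2 ⟨hl0, rfl⟩, ?_⟩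
  rw [← hw, mul_sub]
  zify at hle
  linarith

/-! ### Coding certificates by lists of numbers. -/

theorem exists_potEntry_eq (d : List ℕ) (M N : ℕ) (φ : ℕ → ℕ → ℕ) :
    ∃ c : List ℕ, entry c 0 = M ∧ entry c 1 = N ∧
      ∀ i < M, ∀ q < entry d 0, potEntry d c i q = φ i q := by
  -- Two leading entries, then the potentials row by row.
  refine ⟨M :: N :: (List.range (M * entry d 0)).map fun k => φ (k / entry d 0) (k % entry d 0),
    rfl, rfl, fun i hi q hq => ?_⟩
  have hlt : i * entry d 0 + q < M * entry d 0 := by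
    calc i * entry d 0 + q < i * entry d 0 + entry d 0 := by omega
      _ = (i + 1) * entry d 0 := by ring
      _ ≤ M * entry d 0 := Nat.mul_le_mul_right _ hi
  have hdiv : (i * entry d 0 + q) / entry d 0 = i := by
    rw [mul_comm, Nat.mul_add_div (by omega), Nat.div_eq_of_lt hq, add_zero]
  have hmod : (i * entry d 0 + q) % entry d 0 = q := by
    rw [mul_comm, Nat.mul_add_mod, Nat.mod_eq_of_lt hq]
  rw [potEntry, entry, show 2 + i * entry d 0 + q = (i * entry d 0 + q) + 1 + 1 by ring,
    List.getD_cons_succ, List.getD_cons_succ]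
  simp [List.getD_eq_getElem?_getD, hlt, hdiv, hmod]

/-- Potentials can be coded by numbers, after adding a constant. -/
theorem exists_codes (N : ℕ) {L : Set (Fin C.numStates → Option ℤ)} (hL : L.Finite) :
    ∃ (c : List ℕ) (B : ℤ), entry c 1 = N ∧
      (∀ f ∈ L, ∃ i < entry c 0, ∀ q y, f q = some y ↔
        potEntry C.toNats c i q ≠ 0 ∧ (potEntry C.toNats c i q : ℤ) = y + B) ∧
      ∀ i < entry c 0, ∃ f ∈ L, ∀ q y, f q = some y ↔
        potEntry C.toNats c i q ≠ 0 ∧ (potEntry C.toNats c i q : ℤ) = y + B := by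
  obtain ⟨B, hB⟩ := MPG.exists_potential_bound hL
  obtain ⟨l, hl⟩ := hL.exists_finset_coe
  -- The conditions on certificates are invariant under adding a constant to all potentials. Adding
  -- `B + 1` makes all values positive, so that `0` is free for undefined ones.
  obtain ⟨c, hc0, hc1, hc⟩ := exists_potEntry_eq C.toNats l.toList.length N fun i q =>
    if h : i < l.toList.length ∧ q < C.numStates then
      match l.toList[i] ⟨q, h.2⟩ with
      | none => 0
      | some y => (y + (B + 1)).toNat
    else 0
  have key : ∀ i, ∀ hi : i < l.toList.length, ∀ q y, l.toList[i] q = some y ↔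
      potEntry C.toNats c i q ≠ 0 ∧ (potEntry C.toNats c i q : ℤ) = y + (B + 1) := by
    intro i hi q y
    have hmem : l.toList[i] ∈ L := by
      rw [← hl]; exact Finset.mem_toList.1 (List.getElem_mem hi)
    rw [hc i hi q q.2]
    simp only [hi, q.2, and_self, dite_true]
    rcases h : l.toList[i] q with _ | z
    · simp
    · have := (abs_le.1 (hB _ hmem q z h)).1
      have h2 := abs_le.1 (hB _ hmem q z h)
      simp only [Option.some.injEq]
      omega
  refine ⟨c, B + 1, hc1, fun f hf => ?_, fun i hi => ?_⟩
  · rw [← hl, Finset.mem_coe, ← Finset.mem_toList] at hf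
    obtain ⟨i, hi, rfl⟩ := List.getElem_of_mem hf
    exact ⟨i, hc0 ▸ hi, key i hi⟩
  · rw [hc0] at hi
    exact ⟨l.toList[i], by rw [← hl]; exact Finset.mem_toList.1 (List.getElem_mem hi), key i hi⟩

theorem exists_codesEveCert {L : Set (Fin C.numStates → Option ℤ)} (h : C.toMPG.EveCert L) :
    ∃ c, CodesEveCert C.toNats c := by
  obtain ⟨c, B, -, hc1, hc2⟩ := exists_codes C 0 h.finite
  have hne : ∀ {f : Fin C.numStates → Option ℤ} {i : ℕ}, (∀ q y, f q = some y ↔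
      potEntry C.toNats c i q ≠ 0 ∧ (potEntry C.toNats c i q : ℤ) = y + B) → ∀ q, f q ≠ none ↔
        potEntry C.toNats c i q ≠ 0 := by
    intro f i hf q
    rw [Option.ne_none_iff_exists']
    exact ⟨fun ⟨y, hy⟩ => ((hf q y).1 hy).1, fun hp =>
      ⟨potEntry C.toNats c i q - B, (hf _ _).2 ⟨hp, by ring⟩⟩⟩
  refine ⟨c, ?_, ?_⟩
  · obtain ⟨f, hf, hf0⟩ := h.init
    obtain ⟨i, hi, hfi⟩ := hc1 f hf
    exact ⟨i, hi, (hne hfi _).1 hf0⟩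
  · intro i hi
    obtain ⟨f, hf, hfi⟩ := hc2 i hi
    obtain ⟨a, ha⟩ := h.step f hf
    refine ⟨a, a.2, fun k hk hka hkq => ?_⟩
    rw [entry_toNats_zero, entry_toNats_length] at hk
    obtain ⟨q, a', q₁, hΔ, h0, h1, h2, -⟩ := exists_trans C hk
    obtain rfl : a' = a := Fin.ext (h1.symm.trans hka)
    rw [h0] at hkq
    obtain ⟨g, hg, hg'⟩ := ha q q₁ hΔ ((hne hfi _).2 hkq)
    obtain ⟨j, hj, hgj⟩ := hc1 g hg
    refine ⟨j, hj, fun q₂ hq₂ hlab => ?_⟩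
    rw [entry_toNats_zero] at hq₂
    lift q₂ to Fin C.numStates using hq₂
    rw [h2, entry_toNats_label, entry_toNats_label] at hlab
    obtain ⟨y, hy, hy'⟩ := hg' q₂ ((toMPG_same C).2 hlab.symm)
    refine ⟨((hgj _ _).1 hy).1, fun l hl hla hlq hl0 => ?_⟩
    rw [entry_toNats_zero, entry_toNats_length] at hl
    obtain ⟨q', a'', q₂', hΔ', h0', h1', h2', hw⟩ := exists_trans C hl
    obtain rfl : a'' = a' := Fin.ext (h1'.symm.trans hla)
    obtain rfl : q₂' = q₂ := Fin.ext (h2'.symm.trans hlq)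
    rw [h0'] at hl0 ⊢
    obtain ⟨x, hx⟩ := Option.ne_none_iff_exists'.1 ((hne hfi q').2 hl0)
    have h3 := hy' q' x hx hΔ'
    have h4 := ((hfi _ _).1 hx).2
    have h5 := ((hgj _ _).1 hy).2
    rw [← hw] at h3
    omega

theorem exists_codesAdamCert {N : ℕ} {L : Set (Fin C.numStates → Option ℤ)}
    (h : C.toMPG.AdamCert N L) : ∃ c, CodesAdamCert C.toNats c := by
  obtain ⟨c, B, hN, hc1, hc2⟩ := exists_codes C N h.finite
  have hne : ∀ {f : Fin C.numStates → Option ℤ} {i : ℕ}, (∀ q y, f q = some y ↔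
      potEntry C.toNats c i q ≠ 0 ∧ (potEntry C.toNats c i q : ℤ) = y + B) → ∀ q, f q ≠ none ↔
        potEntry C.toNats c i q ≠ 0 := by
    intro f i hf q
    rw [Option.ne_none_iff_exists']
    exact ⟨fun ⟨y, hy⟩ => ((hf q y).1 hy).1, fun hp =>
      ⟨potEntry C.toNats c i q - B, (hf _ _).2 ⟨hp, by ring⟩⟩⟩
  refine ⟨c, hN ▸ h.pos, ?_, ?_⟩
  · obtain ⟨f, hf, hf0, honly⟩ := h.init
    obtain ⟨i, hi, hfi⟩ := hc1 f hf
    refine ⟨i, hi, (hne hfi _).1 hf0, fun q hq hq0 => ?_⟩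
    rw [entry_toNats_zero] at hq
    lift q to Fin C.numStates using hq
    rw [honly q ((hne hfi _).2 hq0)]
    rfl
  · intro i hi a ha
    rw [entry_toNats_one] at ha
    lift a to Fin C.numActions using ha
    obtain ⟨f, hf, hfi⟩ := hc2 i hi
    obtain ⟨g, hg, q₀, hq₀, hstep⟩ := h.step f hf a
    obtain ⟨j, hj, hgj⟩ := hc1 g hg
    refine ⟨j, hj, q₀, q₀.2, (hne hgj _).1 hq₀, fun q hq hq0 => ?_⟩
    rw [entry_toNats_zero] at hq
    lift q to Fin C.numStates using hq
    obtain ⟨y, hy⟩ := Option.ne_none_iff_exists'.1 ((hne hgj q).2 hq0)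
    obtain ⟨h1, q', x, hΔ, hx, hle⟩ := hstep q y hy
    refine ⟨by rw [entry_toNats_label, entry_toNats_label, (toMPG_same C).1 h1], ?_⟩
    obtain ⟨l, hl, hl0, hl1, hl2, hw⟩ := exists_index C hΔ
    rw [entry_toNats_zero, entry_toNats_length]
    refine ⟨l, hl, hl1, hl2, hl0 ▸ ((hfi _ _).1 hx).1, ?_⟩
    have h4 := ((hfi _ _).1 hx).2
    have h5 := ((hgj _ _).1 hy).2
    rw [hl0, hN]
    rw [← hw, mul_sub] at hle
    zify
    linarith

end GameCode

/-- Each kind of certificate is sound on its own, so whichever is found first gives the right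
answer. Forcible termination is used only to know that one exists. -/
theorem decidableOn_eveWins : DecidableOn LimObsGame.encode (fun G => G.game.ForciblyTerminating)
    (fun G => G.game.EveWins) := by
  classical
  let F : List Bool → ℕ → Option Bool := fun w n =>
    if GameCode.CodesEveCert (wordToNats w) (Denumerable.ofNat (List ℕ) n) then some true
    else if GameCode.CodesAdamCert (wordToNats w) (Denumerable.ofNat (List ℕ) n) then some false
    else none
  have hF : Primrec₂ F := by
    refine Primrec.ite ?_ (Primrec.const _) (Primrec.ite ?_ (Primrec.const _) (Primrec.const _))
    · exact GameCode.primrecPred_codesEveCert.comp ((primrec_wordToNats.comp Primrec.fst).pair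
        ((Primrec.ofNat (List ℕ)).comp Primrec.snd))
    · exact GameCode.primrecPred_codesAdamCert.comp ((primrec_wordToNats.comp Primrec.fst).pair
        ((Primrec.ofNat (List ℕ)).comp Primrec.snd))
  refine ⟨fun w => Nat.rfindOpt (F w), Partrec.rfindOpt hF.to_comp, ?_⟩
  rintro ⟨C, hl⟩ hft
  have hw : wordToNats (LimObsGame.encode ⟨C, hl⟩) = C.toNats := wordToNats_natsToWord _
  have hne : Nonempty (Fin C.numActions) := ⟨⟨0, C.numActions_pos⟩⟩
  have hdom : (Nat.rfindOpt (F (LimObsGame.encode ⟨C, hl⟩))).Dom := by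
    rw [Nat.rfindOpt_dom]
    have : ∃ c, GameCode.CodesEveCert C.toNats c ∨ GameCode.CodesAdamCert C.toNats c := by
      rcases hft with h | h
      · obtain ⟨N, L, hL⟩ := MPG.exists_adamCert h.adamForce
        exact (GameCode.exists_codesAdamCert C hL).imp fun c hc => .inr hc
      · obtain ⟨L, hL⟩ := MPG.exists_eveCert hl h.eveForce
        exact (GameCode.exists_codesEveCert C hL).imp fun c hc => .inl hc
    obtain ⟨c, hc⟩ := this
    refine ⟨Encodable.encode c, ?_⟩
    simp only [F, hw, Denumerable.ofNat_encode]
    split_ifs with h1 h2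
    · exact ⟨true, rfl⟩
    · exact ⟨false, rfl⟩
    · exact absurd hc (not_or.2 ⟨h1, h2⟩)
  obtain ⟨b, hb⟩ := Part.dom_iff_mem.1 hdom
  refine ⟨b, hb, ?_⟩
  obtain ⟨n, hn⟩ := Nat.rfindOpt_spec hb
  simp only [F, hw] at hn
  split_ifs at hn with h1 h2
  · obtain ⟨L, hL⟩ := h1.eveCert
    cases hn
    exact iff_of_true rfl (hL.eveWins hl)
  · obtain ⟨N, L, hL⟩ := h2.adamCert
    cases hn
    exact iff_of_false (by simp) hL.not_eveWins
  · cases hn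

/-! ## Counter machines -/

/-- Instructions of a counter machine: increment a register; jump if a register is zero, and
otherwise decrement it; halt. -/
inductive Instr
  | inc (c : ℕ)
  | jz (c t : ℕ)
  | halt (b : Bool)

namespace Instr

/-- The jump targets are increased by `k`. -/
def shift (k : ℕ) : Instr → Instr
  | inc c => inc c
  | jz c t => jz c (t + k)
  | halt b => halt b

/-- The registers are below `K` and the jump targets below `m`. -/
def Valid (K m : ℕ) : Instr → Prop
  | inc c => c < K
  | jz c t => c < K ∧ t < m
  | halt _ => True

end Instr

namespace CounterMachine

/-- One step; the machine stays where it is when it has halted. -/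
def step (code : List Instr) (p : ℕ × (ℕ → ℕ)) : ℕ × (ℕ → ℕ) :=
  match code[p.1]? with
  | some (.inc c) => (p.1 + 1, Function.update p.2 c (p.2 c + 1))
  | some (.jz c t) =>
    if p.2 c = 0 then (t, p.2) else (p.1 + 1, Function.update p.2 c (p.2 c - 1))
  | _ => p

/-- The configuration after `t` steps. -/
def run (code : List Instr) (t : ℕ) : ℕ × (ℕ → ℕ) := (step code)^[t] (0, fun _ => 0)

/-- The machine halts with the answer `b`. -/
def HaltsWith (code : List Instr) (b : Bool) : Prop :=
  ∃ t, code[(run code t).1]? = some (.halt b)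

theorem run_succ (code : List Instr) (t : ℕ) : run code (t + 1) = step code (run code t) :=
  Function.iterate_succ_apply' _ _ _

theorem run_eq_of_halt {code : List Instr} {t : ℕ} {b : Bool}
    (h : code[(run code t).1]? = some (.halt b)) {t' : ℕ} (ht : t ≤ t') :
    run code t' = run code t := by
  induction ht with
  | refl => rfl
  | step _ ih => rw [run_succ, ih, step, h]

theorem HaltsWith.unique {code : List Instr} {b b' : Bool} (h : HaltsWith code b)
    (h' : HaltsWith code b') : b = b' := by
  obtain ⟨t, ht⟩ := h
  obtain ⟨t', ht'⟩ := h'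
  have h1 := run_eq_of_halt ht (le_max_left t t')
  have h2 := run_eq_of_halt ht' (le_max_right t t')
  rw [← h1, h2, ht'] at ht
  simpa using ht.symm

/-- Structured programs; `loop c p` is: while register `c` is not zero, decrement it and do `p`. -/
inductive Prog
  | skip
  | inc (c : ℕ)
  | seq (p q : Prog)
  | loop (c : ℕ) (p : Prog)

namespace Prog

/-- The registers that occur are between `1` and `K - 1`. -/
def Uses (K : ℕ) : Prog → Prop
  | skip => True
  | inc c => 0 < c ∧ c < K
  | seq p q => Uses K p ∧ Uses K q
  | loop c p => 0 < c ∧ c < K ∧ Uses K p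

theorem Uses.mono {K L : ℕ} {p : Prog} (h : p.Uses K) (hL : K ≤ L) : p.Uses L := by
  induction p with
  | skip => trivial
  | inc c => exact ⟨h.1, h.2.trans_le hL⟩
  | seq p q hp hq => exact ⟨hp h.1, hq h.2⟩
  | loop c p hp => exact ⟨h.1, h.2.1.trans_le hL, hp h.2.2⟩

/-- The program can transform the first state into the second one. -/
inductive Run : Prog → (ℕ → ℕ) → (ℕ → ℕ) → Prop
  | skip {s} : Run skip s s
  | inc {c s} : Run (inc c) s (Function.update s c (s c + 1))
  | seq {p q s s' s''} : Run p s s' → Run q s' s'' → Run (seq p q) s s''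
  | loop_zero {c p s} : s c = 0 → Run (loop c p) s s
  | loop_succ {c p s s' s''} : s c ≠ 0 → Run p (Function.update s c (s c - 1)) s' →
      Run (loop c p) s' s'' → Run (loop c p) s s''

/-- The number of instructions of the compiled program. -/
def size : Prog → ℕ
  | skip => 0
  | inc _ => 1
  | seq p q => p.size + q.size
  | loop _ p => p.size + 2

/-- The compiled program; register `0` always has to be zero. -/
def compile : Prog → ℕ → List Instr
  | skip, _ => []
  | inc c, _ => [.inc c]
  | seq p q, base => p.compile base ++ q.compile (base + p.size)
  | loop c p, base => .jz c (base + p.size + 2) :: (p.compile (base + 1) ++ [.jz 0 base])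

theorem length_compile (p : Prog) (base : ℕ) : (p.compile base).length = p.size := by
  induction p generalizing base with
  | skip => rfl
  | inc c => rfl
  | seq p q hp hq => simp [compile, size, hp, hq]
  | loop c p hp => simp [compile, size, hp]

/-- Jump targets are absolute, and relocation changes nothing else. This makes the blocks for the
bits of a word shifted copies of each other. -/
theorem compile_add (p : Prog) (base k : ℕ) :
    p.compile (base + k) = (p.compile base).map (Instr.shift k) := by
  induction p generalizing base with
  | skip => rfl
  | inc c => rfl
  | seq p q hp hq =>
    simp only [compile, List.map_append, hp, ← hq]
    rw [add_right_comm]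
  | loop c p hp =>
    simp only [compile, List.map_append, List.map_cons, List.map_nil, ← hp, Instr.shift]
    rw [add_right_comm base 1 k, show base + k + p.size + 2 = base + p.size + 2 + k by ring]

/-- The bound is one larger than the last location of the program because a loop exits to the
location behind it. -/
theorem valid_of_mem_compile {K : ℕ} {p : Prog} (h : p.Uses K) (hK : 0 < K) {base : ℕ} {I : Instr}
    (hI : I ∈ p.compile base) : I.Valid K (base + p.size + 1) := by
  have hmono : ∀ {I : Instr} {m m' : ℕ}, m ≤ m' → I.Valid K m → I.Valid K m' := by
    intro I m m' hm hI
    cases I with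
    | inc c => exact hI
    | jz c t => exact ⟨hI.1, hI.2.trans_le hm⟩
    | halt b => trivial
  induction p generalizing base with
  | skip => simp [compile] at hI
  | inc c =>
    simp only [compile, List.mem_singleton] at hI
    subst hI
    exact h.2
  | seq p q hp hq =>
    simp only [compile, List.mem_append] at hI
    simp only [size]
    rcases hI with hI | hI
    · exact hmono (by omega) (hp h.1 hI)
    · exact hmono (by omega) (hq h.2 hI)
  | loop c p hp =>
    simp only [compile, List.mem_cons, List.mem_append, List.not_mem_nil, or_false] at hI
    simp only [size]
    rcases hI with rfl | hI | rfl
    · exact ⟨h.2.1, by omega⟩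
    · exact hmono (by omega) (hp h.2.2 hI)
    · exact ⟨hK, by omega⟩

end Prog

/-- `C` occurs in `code` at position `base`. -/
def Occurs (code C : List Instr) (base : ℕ) : Prop :=
  ∀ i I, C[i]? = some I → code[base + i]? = some I

theorem Occurs.append {code C D : List Instr} {base : ℕ} (h : Occurs code (C ++ D) base) :
    Occurs code C base ∧ Occurs code D (base + C.length) := by
  refine ⟨fun i I hi => h i I ?_, fun i I hi => ?_⟩
  · rw [List.getElem?_append_left (List.getElem?_eq_some_iff.1 hi).1]
    exact hi
  · rw [add_assoc]
    exact h _ _ (by rwa [List.getElem?_append_right (Nat.le_add_right _ _), Nat.add_sub_cancel_left])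

theorem Occurs.cons {code D : List Instr} {J : Instr} {base : ℕ} (h : Occurs code (J :: D) base) :
    code[base]? = some J ∧ Occurs code D (base + 1) :=
  ⟨h 0 J rfl, fun i I hi => by
    rw [add_assoc, add_comm 1]
    exact h (i + 1) I hi⟩

/-- Reachability in the transition graph of the machine. -/
def Reach (code : List Instr) (p p' : ℕ × (ℕ → ℕ)) : Prop := ∃ n, (step code)^[n] p = p'

theorem Reach.refl (code : List Instr) (p : ℕ × (ℕ → ℕ)) : Reach code p p := ⟨0, rfl⟩

theorem Reach.trans {code : List Instr} {p p' p'' : ℕ × (ℕ → ℕ)} (h : Reach code p p')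
    (h' : Reach code p' p'') : Reach code p p'' := by
  obtain ⟨n, rfl⟩ := h
  obtain ⟨m, rfl⟩ := h'
  exact ⟨m + n, Function.iterate_add_apply _ _ _ _⟩

theorem Reach.single {code : List Instr} {p p' : ℕ × (ℕ → ℕ)} (h : step code p = p') :
    Reach code p p' := ⟨1, h⟩

theorem step_inc {code : List Instr} {pc c : ℕ} (h : code[pc]? = some (.inc c)) (s : ℕ → ℕ) :
    step code (pc, s) = (pc + 1, Function.update s c (s c + 1)) := by
  simp [step, h]

theorem step_jz_zero {code : List Instr} {pc c t : ℕ} (h : code[pc]? = some (.jz c t)) {s : ℕ → ℕ}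
    (hs : s c = 0) : step code (pc, s) = (t, s) := by
  simp [step, h, hs]

theorem step_jz_pos {code : List Instr} {pc c t : ℕ} (h : code[pc]? = some (.jz c t)) {s : ℕ → ℕ}
    (hs : s c ≠ 0) : step code (pc, s) = (pc + 1, Function.update s c (s c - 1)) := by
  simp [step, h, hs]

/-- Programs do not touch register `0`; therefore `jz 0` serves as an unconditional jump. -/
theorem Prog.Run.zero {p : Prog} {s s' : ℕ → ℕ} (h : p.Run s s') {K : ℕ} (hp : p.Uses K)
    (hs : s 0 = 0) : s' 0 = 0 := by
  induction h with
  | skip => exact hs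
  | @inc c s =>
    rw [Function.update_of_ne hp.1.ne]
    exact hs
  | seq _ _ ih1 ih2 => exact ih2 hp.2 (ih1 hp.1 hs)
  | loop_zero => exact hs
  | loop_succ _ _ _ ih1 ih2 =>
    refine ih2 hp (ih1 hp.2.2 ?_)
    rw [Function.update_of_ne hp.1.ne]
    exact hs

theorem Prog.Run.reach {p : Prog} {s s' : ℕ → ℕ} (h : p.Run s s') {K : ℕ} (hp : p.Uses K)
    (hs : s 0 = 0) {code : List Instr} {base : ℕ} (hc : Occurs code (p.compile base) base) :
    Reach code (base, s) (base + p.size, s') := by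
  induction h generalizing base with
  | skip => exact Reach.refl _ _
  | inc => exact Reach.single (step_inc hc.cons.1 _)
  | @seq p q s s' s'' h1 h2 ih1 ih2 =>
    have h3 := hc.append
    rw [p.length_compile] at h3
    rw [Prog.size, ← add_assoc]
    exact (ih1 hp.1 hs h3.1).trans (ih2 hp.2 (h1.zero hp.1 hs) h3.2)
  | loop_zero h0 => exact Reach.single (step_jz_zero hc.cons.1 h0)
  | @loop_succ c p s s' s'' h0 h1 h2 ih1 ih2 =>
    have hs0 : Function.update s c (s c - 1) 0 = 0 := by
      rw [Function.update_of_ne hp.1.ne]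
      exact hs
    have hs' : s' 0 = 0 := h1.zero hp.2.2 hs0
    have h3 := hc.cons
    have h4 := h3.2.append
    refine (Reach.single (step_jz_pos h3.1 h0)).trans ?_
    refine (ih1 hp.2.2 hs0 h4.1).trans ?_
    rw [p.length_compile] at h4
    exact (Reach.single (step_jz_zero h4.2.cons.1 hs')).trans (ih2 hp hs' hc)

/-! ## Counter machines compute primitive recursive functions -/

namespace Prog

/-- `I k` is the state in which the loop register contains `k`: a loop invariant that is run through
downwards. -/
theorem Run.loop {c : ℕ} {p : Prog} (I : ℕ → ℕ → ℕ) {n : ℕ} (hc : ∀ k ≤ n, I k c = k)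
    (h : ∀ k < n, Run p (Function.update (I (k + 1)) c k) (I k)) : Run (loop c p) (I n) (I 0) := by
  induction n with
  | zero => exact .loop_zero (hc 0 le_rfl)
  | succ n ih =>
    refine .loop_succ (s' := I n) (by rw [hc _ le_rfl]; omega) ?_
      (ih (fun k hk => hc k (by omega)) fun k hk => h k (by omega))
    rw [hc _ le_rfl]
    exact h n n.lt_succ_self

theorem run_clear (c : ℕ) (s : ℕ → ℕ) : Run (loop c skip) s (Function.update s c 0) := by
  have := Run.loop (c := c) (p := skip) (n := s c) (fun k => Function.update s c k)
    (fun k _ => by simp) fun k _ => by simpa using Run.skip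
  simpa using this

theorem run_move {c d : ℕ} (hcd : c ≠ d) (s : ℕ → ℕ) :
    Run (loop c (inc d)) s (Function.update (Function.update s d (s d + s c)) c 0) := by
  have := Run.loop (c := c) (p := inc d) (n := s c)
    (fun k => Function.update (Function.update s d (s d + (s c - k))) c k)
    (fun k _ => by simp) fun k hk => by
      have h1 : ∀ u : ℕ → ℕ, ∀ v, v = Function.update u d (u d + 1) → Run (inc d) u v :=
        fun u v e => e ▸ Run.inc
      refine h1 _ _ ?_
      funext r
      simp only [Function.update_apply]
      split_ifs <;> simp_all <;> omega
  simpa using this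

/-- Adds register `c` to register `d`, with the help of register `t`. -/
def copy (c d t : ℕ) : Prog := seq (loop c (seq (inc d) (inc t))) (loop t (inc c))

theorem run_copy {c d t : ℕ} (hcd : c ≠ d) (hct : c ≠ t) (hdt : d ≠ t) (s : ℕ → ℕ) (ht : s t = 0) :
    Run (copy c d t) s (Function.update s d (s d + s c)) := by
  have h1 := Run.loop (c := c) (p := seq (inc d) (inc t)) (n := s c)
    (fun k => Function.update (Function.update (Function.update s d (s d + (s c - k))) c k)
      t (s c - k)) (fun k _ => by simp [hct]) fun k hk => by
      have h1 : ∀ u v : ℕ → ℕ, v = Function.update (Function.update u d (u d + 1)) t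
          (Function.update u d (u d + 1) t + 1) → Run (seq (inc d) (inc t)) u v :=
        fun u v e => e ▸ Run.seq Run.inc Run.inc
      refine h1 _ _ ?_
      funext r
      simp only [Function.update_apply]
      split_ifs <;> simp_all <;> omega
  have h2 := run_move hct.symm (Function.update (Function.update (Function.update s d
    (s d + (s c - 0))) c 0) t (s c - 0))
  have h3 : Function.update (Function.update (Function.update s d (s d + (s c - s c))) c (s c)) t
      (s c - s c) = s := by
    funext r
    simp only [Function.update_apply]
    split_ifs <;> simp_all
  have h4 : ∀ u v : ℕ → ℕ, u = v → Run (copy c d t) s u → Run (copy c d t) s v := fun _ _ e => e ▸ id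
  simp only [h3] at h1
  refine h4 _ _ ?_ (Run.seq h1 h2)
  funext r
  simp only [Function.update_apply]
  split_ifs <;> simp_all

/-- Clears the registers `b, …, b + n - 1`. -/
def clears (b : ℕ) : ℕ → Prog
  | 0 => skip
  | n + 1 => seq (clears b n) (loop (b + n) skip)

theorem run_clears (b n : ℕ) (s : ℕ → ℕ) :
    Run (clears b n) s fun r => if b ≤ r ∧ r < b + n then 0 else s r := by
  induction n with
  | zero =>
    have : (fun r => if b ≤ r ∧ r < b + 0 then 0 else s r) = s := by
      funext r
      rw [if_neg (by omega)]
    rw [this]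
    exact Run.skip
  | succ n ih =>
    have h := Run.seq ih (run_clear (b + n) _)
    have : Function.update (fun r => if b ≤ r ∧ r < b + n then 0 else s r) (b + n) 0 =
        fun r => if b ≤ r ∧ r < b + (n + 1) then 0 else s r := by
      funext r
      simp only [Function.update_apply]
      split_ifs <;> first | rfl | omega
    rwa [this] at h

theorem uses_clears {b n K : ℕ} (hb : 0 < b) (hK : b + n ≤ K) : (clears b n).Uses K := by
  induction n with
  | zero => trivial
  | succ n ih => exact ⟨ih (by omega), by omega, by omega, trivial⟩

/-- `f` can be computed for all choices of the input registers, the output register `o` and the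
bound `b` above which the registers are free. -/
def Computes {n : ℕ} (f : List.Vector ℕ n → ℕ) : Prop :=
  ∀ (b : ℕ) (ins : Fin n → ℕ) (o : ℕ), (∀ i, 0 < ins i ∧ ins i < b ∧ ins i ≠ o) → 0 < o → o < b →
    ∃ (p : Prog) (K : ℕ), p.Uses K ∧ ∀ s : ℕ → ℕ, (∀ r, b ≤ r → s r = 0) → s o = 0 →
      Run p s (Function.update s o (f (List.Vector.ofFn fun i => s (ins i))))

theorem Run.of_eq {p : Prog} {s u v : ℕ → ℕ} (h : Run p s u) (e : u = v) : Run p s v := e ▸ h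

theorem computes_zero : Computes fun _ : List.Vector ℕ 0 => 0 := by
  refine fun b ins o _ _ _ => ⟨skip, 0, trivial, fun s _ ho => ?_⟩
  refine Run.skip.of_eq ?_
  simp [← ho]

theorem computes_get {n : ℕ} (i : Fin n) : Computes fun v => v.get i := by
  intro b ins o hins ho hob
  refine ⟨copy (ins i) o b, b + 1, ?_, fun s hs ho => ?_⟩
  · have := hins i
    simp only [copy, Uses]
    omega
  · refine (run_copy (hins i).2.2 (hins i).2.1.ne hob.ne s (hs b le_rfl)).of_eq ?_
    simp [ho]

theorem computes_succ : Computes fun v : List.Vector ℕ 1 => v.head.succ := by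
  intro b ins o hins ho hob
  obtain ⟨p, K, hp, h⟩ := computes_get 0 b ins o hins ho hob
  refine ⟨seq p (inc o), max K b, ⟨hp.mono (le_max_left _ _), ho, by omega⟩, fun s hs hso => ?_⟩
  refine (Run.seq (h s hs hso) Run.inc).of_eq ?_
  simp [List.Vector.get_zero]

/-- The values of the `g i` go to the registers from `b` on. The program for `f` reads them there,
with its free registers starting at `b + n`, and afterwards they are cleared. -/
theorem computes_comp {m n : ℕ} {f : List.Vector ℕ n → ℕ} {g : Fin n → List.Vector ℕ m → ℕ}
    (hf : Computes f) (hg : ∀ i, Computes (g i)) :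
    Computes fun v => f (List.Vector.ofFn fun i => g i v) := by
  intro b ins o hins ho hob
  -- Induction on the number of functions already evaluated. The condition `r - b < n` only makes
  -- the index legal.
  have key : ∀ j ≤ n, ∃ (p : Prog) (K : ℕ), p.Uses K ∧ ∀ s : ℕ → ℕ, (∀ r, b ≤ r → s r = 0) →
      Run p s fun r => if h : b ≤ r ∧ r < b + j ∧ r - b < n then
        g ⟨r - b, h.2.2⟩ (List.Vector.ofFn fun i => s (ins i)) else s r := by
    intro j
    induction j with
    | zero =>
      refine fun _ => ⟨skip, 0, trivial, fun s _ => Run.skip.of_eq ?_⟩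
      funext r
      rw [dif_neg (by omega)]
    | succ j ih =>
      intro hj
      obtain ⟨p, K, hp, h⟩ := ih (by omega)
      obtain ⟨q, K', hq, h'⟩ := hg ⟨j, hj⟩ (b + n) ins (b + j)
        (fun i => ⟨(hins i).1, by have := (hins i).2.1; omega, by have := (hins i).2.1; omega⟩)
        (by omega) (by omega)
      refine ⟨seq p q, max K K', ⟨hp.mono (le_max_left _ _), hq.mono (le_max_right _ _)⟩,
        fun s hs => ?_⟩
      refine (Run.seq (h s hs) (h' _ (fun r hr => ?_) ?_)).of_eq ?_
      · rw [dif_neg (by omega)]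
        exact hs r (by omega)
      · rw [dif_neg (by omega)]
        exact hs _ (by omega)
      · have hins' : ∀ i, ¬ (b ≤ ins i ∧ ins i < b + j ∧ ins i - b < n) := fun i => by
          have := (hins i).2.1
          omega
        funext r
        simp only [Function.update_apply, hins', dite_false]
        by_cases hr : r = b + j
        · subst hr
          rw [if_pos rfl, dif_pos (by omega)]
          congr 2
          simp
        · rw [if_neg hr]
          by_cases h1 : b ≤ r ∧ r < b + j ∧ r - b < n
          · rw [dif_pos h1, dif_pos (by omega)]
          · rw [dif_neg h1, dif_neg (by omega)]
  obtain ⟨p, K, hp, h⟩ := key n le_rfl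
  obtain ⟨q, K', hq, h'⟩ := hf (b + n) (fun i => b + i) o
    (fun i => ⟨by omega, by omega, by omega⟩) ho (by omega)
  refine ⟨seq p (seq q (clears b n)), max (b + n) (max K K'), ⟨hp.mono (by omega),
    hq.mono (by omega), uses_clears (by omega) (by omega)⟩, fun s hs hso => ?_⟩
  refine (Run.seq (h s hs) (Run.seq (h' _ (fun r hr => ?_) ?_) (run_clears b n _))).of_eq ?_
  · rw [dif_neg (by omega)]
    exact hs r (by omega)
  · rw [dif_neg (by omega)]
    exact hso
  · funext r
    simp only [Function.update_apply]
    by_cases hr : b ≤ r ∧ r < b + n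
    · rw [if_pos hr, if_neg (by omega), hs r hr.1]
    · rw [if_neg hr]
      split_ifs with h1
      · congr 2
        funext i
        rw [dif_pos (by omega)]
        congr 2
        simp
      · omega
      · rfl

/-- Register `b` counts down the remaining rounds, `b + 1` holds the recursion argument, `o` the
current value and `b + 2` the next value; `b + 3` is auxiliary for copying. -/
theorem computes_prec {n : ℕ} {f : List.Vector ℕ n → ℕ} {g : List.Vector ℕ (n + 2) → ℕ}
    (hf : Computes f) (hg : Computes g) : Computes fun v : List.Vector ℕ (n + 1) =>
      v.head.rec (f v.tail) fun y IH => g (y ::ᵥ IH ::ᵥ v.tail) := by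
  intro b ins o hins ho hob
  obtain ⟨p, K, hp, h⟩ := hf b (fun i => ins i.succ) o (fun i => hins _) ho hob
  obtain ⟨q, K', hq, h'⟩ := hg (b + 4) (Fin.cons (b + 1) (Fin.cons o fun i => ins i.succ)) (b + 2)
    (fun i => by
      refine Fin.cases ?_ (fun i => Fin.cases ?_ (fun i => ?_) i) i
      · simp
      · simp only [Fin.cons_succ, Fin.cons_zero]
        omega
      · simp only [Fin.cons_succ]
        have := hins i.succ
        omega) (by omega) (by omega)
  have h0 := hins 0
  refine ⟨seq p (seq (copy (ins 0) b (b + 3)) (seq (loop b (seq q (seq (loop o skip)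
    (seq (loop (b + 2) (inc o)) (inc (b + 1)))))) (loop (b + 1) skip))), max (b + 4) (max K K'),
    ?_, fun s hs hso => ?_⟩
  · refine ⟨hp.mono (by omega), ?_, ⟨by omega, by omega, hq.mono (by omega), ?_, ?_, ?_⟩, ?_⟩ <;>
      simp only [copy, Uses, and_true] <;> omega
  · set a := s (ins 0) with ha
    set v := List.Vector.ofFn fun i => s (ins i.succ) with hv
    let R : ℕ → ℕ := fun k => Nat.rec (f v) (fun y IH => g (y ::ᵥ IH ::ᵥ v)) k
    have e : List.Vector.ofFn (fun i => s (ins i)) = a ::ᵥ v := rfl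
    simp only [e, List.Vector.head_cons, List.Vector.tail_cons]
    -- With `k` rounds left, `a - k` rounds have been done.
    let I : ℕ → ℕ → ℕ := fun k => Function.update (Function.update (Function.update s o (R (a - k)))
      (b + 1) (a - k)) b k
    have hloop := Run.loop (c := b) (p := seq q (seq (loop o skip)
      (seq (loop (b + 2) (inc o)) (inc (b + 1))))) (n := a) I (fun k _ => by simp [I]) (by
        intro k hk
        have h1 := h' (Function.update (I (k + 1)) b k) (fun r hr => by
          simp only [I, Function.update_apply]
          rw [if_neg (by omega), if_neg (by omega), if_neg (by omega), if_neg (by omega)]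
          exact hs r (by omega)) (by
          simp only [I, Function.update_apply]
          rw [if_neg (by omega), if_neg (by omega), if_neg (by omega), if_neg (by omega)]
          exact hs _ (by omega))
        refine (Run.seq h1 (Run.seq (run_clear _ _) (Run.seq (run_move (by omega) _) Run.inc))).of_eq ?_
        have e2 : List.Vector.ofFn (fun i => Function.update (I (k + 1)) b k
            (Fin.cons (α := fun _ => ℕ) (b + 1) (Fin.cons (α := fun _ => ℕ) o fun i => ins i.succ) i)) =
            (a - (k + 1)) ::ᵥ R (a - (k + 1)) ::ᵥ v := by
          have e3 : ∀ F : Fin (n + 2) → ℕ, List.Vector.ofFn F = F 0 ::ᵥ F 1 ::ᵥ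
            List.Vector.ofFn fun i => F i.succ.succ := fun F => rfl
          rw [e3]
          simp only [Fin.cons_zero, Fin.cons_succ, Fin.cons_one]
          congr 1
          · simp [I]
          congr 1
          · simp only [I, Function.update_apply]
            rw [if_neg (by omega), if_neg (by omega), if_neg (by omega), if_pos trivial]
          · rw [hv]
            congr 1
            funext i
            have := hins i.succ
            simp only [I, Function.update_apply]
            rw [if_neg (by omega), if_neg (by omega), if_neg (by omega), if_neg (by omega)]
        have e3 : R (a - k) = g ((a - (k + 1)) ::ᵥ R (a - (k + 1)) ::ᵥ v) := by
          rw [show a - k = a - (k + 1) + 1 by omega]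
        rw [e2, ← e3]
        have hz := hs (b + 2) (by omega)
        funext r
        simp only [I, Function.update_apply]
        split_ifs <;> first | omega | simp_all)
    have h1 := h s hs hso
    have h2 := run_copy (c := ins 0) (d := b) (t := b + 3) (by omega) (by omega) (by omega)
      (Function.update s o (f v)) (by
        rw [Function.update_of_ne (by omega)]
        exact hs _ (by omega))
    have e4 : Function.update (Function.update s o (f v)) b
        (Function.update s o (f v) b + Function.update s o (f v) (ins 0)) = I a := by
      have hz1 := hs b le_rfl
      have hz2 := hs (b + 1) (by omega)
      have hR : R (a - a) = f v := by rw [Nat.sub_self]; rfl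
      funext r
      simp only [I, Function.update_apply, hR]
      split_ifs <;> first | omega | simp_all
    rw [e4] at h2
    refine (Run.seq h1 (Run.seq h2 (Run.seq hloop (run_clear _ _)))).of_eq ?_
    have hz1 := hs b le_rfl
    have hz2 := hs (b + 1) (by omega)
    funext r
    simp only [I, Function.update_apply]
    split_ifs <;> first | omega | simp_all [R]

theorem computes_of_primrec' {n : ℕ} {f : List.Vector ℕ n → ℕ} (hf : Nat.Primrec' f) :
    Computes f := by
  induction hf with
  | zero => exact computes_zero
  | succ => exact computes_succ
  | get i => exact computes_get i
  | comp g _ _ hf hg => exact computes_comp hf hg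
  | prec _ _ hf hg => exact computes_prec hf hg

end Prog

/-! ### Counter machines that contain their input word in the code. -/

/-- Appends a binary digit to the number in register `1`. -/
def digitProg (b : Bool) : Prog :=
  .seq (.loop 1 (.seq (.inc 2) (.inc 2))) (.seq (.loop 2 (.inc 1)) (.seq (.inc 1)
    (.inc (bif b then 1 else 3))))

/-- The code that reads a word (as part of the code) and continues with `main`. -/
def wordCode (main : List Instr) : ℕ → List Bool → List Instr
  | i, [] => main.map (Instr.shift (9 * i))
  | i, b :: w => ((digitProg b).compile 0).map (Instr.shift (9 * i)) ++ wordCode main (i + 1) w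

/-- A word as a number in bijective binary notation. -/
def wordNum (w : List Bool) : ℕ := w.foldl (fun n b => 2 * n + 1 + bif b then 1 else 0) 0

theorem wordNum_append (w : List Bool) (b : Bool) :
    wordNum (w ++ [b]) = 2 * wordNum w + 1 + bif b then 1 else 0 := by
  simp [wordNum]

/-- The digits are `1` and `2`, so only the empty word has number `0`, and the parity determines the
last digit. -/
theorem wordNum_injective : Function.Injective wordNum := by
  intro w
  induction w using List.reverseRecOn with
  | nil =>
    intro w' h
    induction w' using List.reverseRecOn with
    | nil => rfl
    | append_singleton w' b _ =>
      rw [wordNum_append] at h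
      simp only [wordNum, List.foldl_nil] at h
      omega
  | append_singleton w b ih =>
    intro w' h
    induction w' using List.reverseRecOn with
    | nil =>
      rw [wordNum_append] at h
      simp only [wordNum, List.foldl_nil] at h
      omega
    | append_singleton w' b' _ =>
      rw [wordNum_append, wordNum_append] at h
      have : b = b' := by
        cases b <;> cases b' <;> simp only [cond_true, cond_false] at h ⊢ <;> omega
      subst this
      rw [ih (show wordNum w = wordNum w' by omega)]

theorem primrec_wordNum : Primrec wordNum := by
  refine Primrec.list_foldl (h := fun _ p => 2 * p.1 + 1 + bif p.2 then 1 else 0)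
    Primrec.id (Primrec.const 0) ?_
  have : Primrec fun p : List Bool × ℕ × Bool => bif p.2.2 then 1 else 0 :=
    Primrec.cond (by fun_prop) (Primrec.const 1) (Primrec.const 0)
  show Primrec fun p : List Bool × ℕ × Bool => 2 * p.2.1 + 1 + bif p.2.2 then 1 else 0
  fun_prop

/-- The registers in the course of the computation. -/
def regs (n j k : ℕ) : ℕ → ℕ := fun r => if r = 1 then n else if r = 3 then j else if r = 4 then k else 0

/-- Register `3` is a dump: for the bit `false` the last increment goes there, which gives both
digit programs the same length `9`. Its content `j` is never read. -/
theorem run_digitProg (b : Bool) (n j : ℕ) :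
    ∃ j', (digitProg b).Run (regs n j 0) (regs (2 * n + 1 + bif b then 1 else 0) j' 0) := by
  have h1 := Prog.Run.loop (c := 1) (p := .seq (.inc 2) (.inc 2)) (n := n)
    (fun k => Function.update (Function.update (regs n j 0) 1 k) 2 (2 * (n - k))) (fun k _ => by simp)
    fun k hk => by
      refine (Prog.Run.seq .inc .inc).of_eq ?_
      funext r
      simp only [Function.update_apply]
      split_ifs <;> simp_all
      omega
  have h2 := Prog.run_move (c := 2) (d := 1) (by norm_num)
    (Function.update (Function.update (regs n j 0) 1 0) 2 (2 * (n - 0)))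
  have h0 : Function.update (Function.update (regs n j 0) 1 n) 2 (2 * (n - n)) = regs n j 0 := by
    funext r
    simp only [Function.update_apply, regs]
    split_ifs <;> simp_all
  simp only [h0] at h1
  have h3 := fun c => Prog.Run.seq h1 (.seq h2 (.seq (.inc (c := 1)) (.inc (c := c))))
  cases b with
  | true =>
    refine ⟨j, (h3 1).of_eq ?_⟩
    funext r
    simp only [Function.update_apply, regs]
    split_ifs <;> first | omega | simp
  | false =>
    refine ⟨j + 1, (h3 3).of_eq ?_⟩
    funext r
    simp only [Function.update_apply, regs]
    split_ifs <;> simp <;> omega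

theorem uses_digitProg (b : Bool) : (digitProg b).Uses 4 := by
  cases b <;> simp [digitProg, Prog.Uses]

theorem size_digitProg (b : Bool) : (digitProg b).size = 9 := rfl

theorem reach_wordCode {code main : List Instr} (w : List Bool) {i : ℕ}
    (h : Occurs code (wordCode main i w) (9 * i)) (n j : ℕ) :
    ∃ j', Reach code (9 * i, regs n j 0) (9 * (i + w.length),
        regs (w.foldl (fun n b => 2 * n + 1 + bif b then 1 else 0) n) j' 0) ∧
      Occurs code (main.map (Instr.shift (9 * (i + w.length)))) (9 * (i + w.length)) := by
  induction w generalizing i n j with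
  | nil => exact ⟨j, Reach.refl _ _, h⟩
  | cons b w ih =>
    have h1 := Occurs.append h
    rw [List.length_map, Prog.length_compile, size_digitProg, ← Prog.compile_add, zero_add] at h1
    obtain ⟨j', hj'⟩ := run_digitProg b n j
    have h2 := hj'.reach (uses_digitProg b) rfl h1.1
    obtain ⟨j'', h3, h4⟩ := ih (i := i + 1) h1.2 (2 * n + 1 + bif b then 1 else 0) j'
    rw [show i + (b :: w).length = i + 1 + w.length by simp; ring]
    exact ⟨j'', h2.trans h3, h4⟩

/-- Searches for the least argument (in register `4`) where `p` yields a positive number (in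
register `5`); the answer is `true` if this number is `1`. -/
def searchCode (p : Prog) : List Instr :=
  p.compile 0 ++ [.jz 5 (p.size + 4), .jz 5 (p.size + 3), .halt false, .halt true, .inc 4, .jz 0 0,
    .halt true]

theorem length_wordCode (main : List Instr) (i : ℕ) (w : List Bool) :
    (wordCode main i w).length = 9 * w.length + main.length := by
  induction w generalizing i with
  | nil => simp [wordCode]
  | cons b w ih =>
    rw [wordCode, List.length_append, ih, List.length_map, Prog.length_compile, size_digitProg,
      List.length_cons]
    ring

/-- After the word has been read, the arguments `0, 1, …` are tried in turn. A result `0` leaves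
register `5` as it was, so the next round starts from a clean state. -/
theorem haltsWith_wordCode {p : Prog} {K : ℕ} (hp : p.Uses K) {g : ℕ → ℕ → ℕ}
    (hg : ∀ s : ℕ → ℕ, (∀ r, 5 ≤ r → s r = 0) → p.Run s (Function.update s 5 (g (s 1) (s 4))))
    (w : List Bool) (b : Bool) : HaltsWith (wordCode (searchCode p) 0 w) b ↔
      ∃ k, (∀ l < k, g (wordNum w) l = 0) ∧ g (wordNum w) k ≠ 0 ∧
        (b = true ↔ g (wordNum w) k = 1) := by
  set code := wordCode (searchCode p) 0 w with hcode
  obtain ⟨j, h1, h2⟩ := reach_wordCode (code := code) (main := searchCode p) w (i := 0)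
    (fun i I hi => by rwa [mul_zero, zero_add]) 0 0
  have h0 : regs 0 0 0 = fun _ => 0 := by
    funext r
    simp [regs]
  rw [← wordNum, mul_zero, zero_add, h0] at h1
  rw [zero_add] at h2
  set B := 9 * w.length with hB
  set N := wordNum w with hN
  rw [searchCode, List.map_append, ← Prog.compile_add, zero_add] at h2
  have h3 := h2.append
  rw [Prog.length_compile] at h3
  simp only [List.map_cons, List.map_nil, Instr.shift] at h3
  obtain ⟨h3, h4⟩ := h3
  obtain ⟨i0, h4⟩ := h4.cons
  obtain ⟨i1, h4⟩ := h4.cons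
  obtain ⟨i2, h4⟩ := h4.cons
  obtain ⟨i3, h4⟩ := h4.cons
  obtain ⟨i4, h4⟩ := h4.cons
  obtain ⟨i5, -⟩ := h4.cons
  have hbody : ∀ k, Reach code (B, regs N j k)
      (B + p.size, Function.update (regs N j k) 5 (g N k)) := fun k => by
    refine (hg (regs N j k) fun r hr => ?_).reach hp rfl h3
    simp only [regs]
    rw [if_neg (by omega), if_neg (by omega), if_neg (by omega)]
  have hupd : ∀ k, Function.update (regs N j k) 5 0 = regs N j k := fun k => by
    rw [Function.update_eq_self_iff]
    rfl
  have hzero : ∀ k, g N k = 0 → Reach code (B, regs N j k) (B + p.size + 4, regs N j k) := by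
    intro k hk
    have h := hbody k
    rw [hk, hupd] at h
    refine h.trans (Reach.single ?_)
    rw [step_jz_zero i0 rfl]
    congr 1
    ring
  have hback : ∀ k, (step code)^[2] (B + p.size + 4, regs N j k) = (B, regs N j (k + 1)) := by
    intro k
    rw [Function.iterate_succ_apply', Function.iterate_one, step_inc i4]
    have : Function.update (regs N j k) 4 (regs N j k 4 + 1) = regs N j (k + 1) := by
      funext r
      simp only [Function.update_apply, regs]
      split_ifs <;> simp_all
    rw [this, step_jz_zero i5 rfl, zero_add]
  have hloop : ∀ k, (∀ l < k, g N l = 0) → Reach code (0, fun _ => 0) (B, regs N j k) := by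
    intro k hk
    induction k with
    | zero => exact h1
    | succ k ih =>
      exact ((ih fun l hl => hk l (by omega)).trans (hzero k (hk k k.lt_succ_self))).trans
        ⟨2, hback k⟩
  have hfin : ∀ k, (∀ l < k, g N l = 0) → g N k ≠ 0 → HaltsWith code (g N k = 1) := by
    intro k hk hk0
    have h5 := (hloop k hk).trans (hbody k)
    -- The first test also decrements register `5`, so the second test separates the result `1` from
    -- larger ones.
    have h6 := h5.trans (Reach.single (step_jz_pos i0 (by simpa using hk0)))
    by_cases hk1 : g N k = 1
    · have h7 := h6.trans (Reach.single (step_jz_zero i1 (by simp [hk1])))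
      obtain ⟨t, ht⟩ := h7
      refine ⟨t, ?_⟩
      rw [run, ht]
      simp only [hk1, decide_true]
      rw [← i3]
      congr 1
      ring
    · have h7 := h6.trans (Reach.single (step_jz_pos i1 (by simp; omega)))
      obtain ⟨t, ht⟩ := h7
      refine ⟨t, ?_⟩
      rw [run, ht]
      simp only [hk1, decide_false]
      exact i2
  constructor
  · intro h
    have hex : ∃ k, g N k ≠ 0 := by
      by_contra hcon
      push Not at hcon
      -- Without a positive result the location of `inc 4` is visited at arbitrarily late times,
      -- whereas a halted machine would stay at a `halt`.
      have hinf : ∀ k, ∃ t ≥ k, run code t = (B + p.size + 4, regs N j k) := by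
        intro k
        induction k with
        | zero =>
          obtain ⟨t, ht⟩ := h1.trans (hzero 0 (hcon 0))
          exact ⟨t, Nat.zero_le _, ht⟩
        | succ k ih =>
          obtain ⟨t, ht, he⟩ := ih
          obtain ⟨m, hm⟩ := hzero (k + 1) (hcon _)
          refine ⟨m + (2 + t), by omega, ?_⟩
          rw [run, Function.iterate_add_apply, Function.iterate_add_apply, ← run, he, hback, hm]
      obtain ⟨t₀, ht₀⟩ := h
      obtain ⟨t, ht, he⟩ := hinf t₀
      rw [← run_eq_of_halt ht₀ ht, he, i4] at ht₀
      simp at ht₀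
    classical
    refine ⟨Nat.find hex, fun l hl => not_not.1 (Nat.find_min hex hl), Nat.find_spec hex, ?_⟩
    rw [h.unique (hfin _ (fun l hl => not_not.1 (Nat.find_min hex hl)) (Nat.find_spec hex))]
    exact decide_eq_true_iff
  · rintro ⟨k, hk, hk0, hb⟩
    have : b = decide (g N k = 1) := by
      rw [Bool.eq_iff_iff, hb, decide_eq_true_iff]
    exact this ▸ hfin k hk hk0

/-- `wordNum` is inverted by an unbounded search through all words. The results are `1` and `2`,
which keeps `0` free to mean that there is no result yet. -/
theorem exists_evaln_code {φ : List Bool →. Bool} (hφ : Partrec φ) :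
    ∃ c : Nat.Partrec.Code, ∀ w x, x ∈ c.eval (wordNum w) ↔
      ∃ b ∈ φ w, x = bif b then 1 else 2 := by
  classical
  let F : ℕ → ℕ → Option (List Bool) := fun n k =>
    if wordNum ((Encodable.decode k).getD []) = n then some ((Encodable.decode k).getD [])
    else none
  have hF : Primrec₂ F := by
    have h1 : Primrec fun p : ℕ × ℕ => (Encodable.decode (α := List Bool) p.2).getD [] :=
      Primrec.option_getD.comp (Primrec.decode.comp Primrec.snd) (Primrec.const [])
    exact Primrec.ite (PrimrecPred.fun_eq (primrec_wordNum.comp h1) Primrec.fst)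
      (Primrec.option_some.comp h1) (Primrec.const _)
  have hspec : ∀ w, Nat.rfindOpt (F (wordNum w)) = Part.some w := by
    intro w
    have hdom : (Nat.rfindOpt (F (wordNum w))).Dom :=
      Nat.rfindOpt_dom.2 ⟨Encodable.encode w, w, by simp [F]⟩
    obtain ⟨w', hw'⟩ := Part.dom_iff_mem.1 hdom
    obtain ⟨n, hn⟩ := Nat.rfindOpt_spec hw'
    simp only [F] at hn
    split_ifs at hn with h
    · cases hn
      rw [wordNum_injective h] at hw'
      exact Part.eq_some_iff.2 hw'
    · cases hn
  have hcode : Primrec fun b : Bool => bif b then 1 else 2 := Primrec.dom_bool _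
  have hψ : Partrec fun n => (Nat.rfindOpt (F n)).bind fun w => (φ w).map fun b =>
      bif b then 1 else 2 :=
    (Partrec.rfindOpt hF.to_comp).bind
      ((hφ.comp Computable.snd).map (hcode.to_comp.comp Computable.snd).to₂)
  obtain ⟨c, hc⟩ := Nat.Partrec.Code.exists_code.1 (Partrec.nat_iff.1 hψ)
  refine ⟨c, fun w x => ?_⟩
  rw [hc]
  simp only [hspec, Part.bind_some, Part.mem_map_iff, eq_comm (a := x)]

/-- Every partial recursive predicate is computed by a counter machine. -/
theorem exists_wordCode {φ : List Bool →. Bool} (hφ : Partrec φ) :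
    ∃ (main : List Instr) (K : ℕ), 4 ≤ K ∧ (∃ c, main = c ++ [.halt true]) ∧ (∀ I ∈ main, I.Valid K main.length) ∧
      ∀ w b, HaltsWith (wordCode main 0 w) b ↔ b ∈ φ w := by
  obtain ⟨c, hc⟩ := exists_evaln_code hφ
  -- `k` is the step bound of the evaluation, and `0` stands for no result.
  let g : ℕ → ℕ → ℕ := fun n k => (c.evaln k n).getD 0
  have hg : Primrec₂ g := by
    have h1 : Primrec fun p : ℕ × ℕ => c.evaln p.2 p.1 :=
      Nat.Partrec.Code.primrec_evaln.comp
        ((Primrec.snd.pair (Primrec.const c)).pair Primrec.fst)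
    exact Primrec.option_getD.comp h1 (Primrec.const 0)
  -- Register `1` holds the number of the word, `4` the step bound, `5` the result; the registers
  -- from `6` on are free.
  obtain ⟨p, K, hp, hrun⟩ := Prog.computes_of_primrec' (Nat.Primrec'.prim_iff₂.2 hg) 6
    (fun i => if i = 0 then 1 else 4) 5 (fun i => by split_ifs <;> norm_num) (by norm_num)
    (by norm_num)
  have hKp : p.Uses (max K 6) := hp.mono (le_max_left _ _)
  refine ⟨searchCode p, max K 6, by omega, ?_, ?_, fun w b => ?_⟩
  -- The last `halt true` is never reached. It is there because a valid code has to end with `halt`.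
  · rw [searchCode]
    exact ⟨p.compile 0 ++ [.jz 5 (p.size + 4), .jz 5 (p.size + 3), .halt false, .halt true, .inc 4,
      .jz 0 0], by simp⟩
  · have hlen : (searchCode p).length = p.size + 7 := by
      simp [searchCode, Prog.length_compile]
    intro I hI
    rw [hlen]
    simp only [searchCode, List.mem_append, List.mem_cons, List.not_mem_nil, or_false] at hI
    rcases hI with hI | rfl | rfl | rfl | rfl | rfl | rfl | rfl
    · have := Prog.valid_of_mem_compile hKp (by omega) hI
      cases I with
      | inc c => exact this
      | jz c t => exact ⟨this.1, by have := this.2; omega⟩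
      | halt b => trivial
    all_goals simp [Instr.Valid]
  · rw [haltsWith_wordCode (g := g) hKp (fun s hs => ?_)]
    · have hpos : ∀ k x, x ∈ c.evaln k (wordNum w) → g (wordNum w) k = x ∧ x ≠ 0 := by
        intro k x hx
        refine ⟨by simp [g, Option.mem_def.1 hx], ?_⟩
        obtain ⟨b, -, rfl⟩ := (hc w x).1 (Nat.Partrec.Code.evaln_sound hx)
        cases b <;> simp
      constructor
      · rintro ⟨k, hk, hk0, hb⟩
        obtain ⟨x, hx⟩ : ∃ x, x ∈ c.evaln k (wordNum w) := by
          rcases h : c.evaln k (wordNum w) with _ | x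
          · simp [g, h] at hk0
          · exact ⟨x, rfl⟩
        rw [(hpos k x hx).1] at hb
        obtain ⟨b', hb', rfl⟩ := (hc w x).1 (Nat.Partrec.Code.evaln_sound hx)
        have : b = b' := by
          cases b <;> cases b' <;> simp_all
        exact this ▸ hb'
      · intro hb
        obtain ⟨k, hk⟩ := Nat.Partrec.Code.evaln_complete.1 ((hc w _).2 ⟨b, hb, rfl⟩)
        classical
        have hex : ∃ k, g (wordNum w) k ≠ 0 := ⟨k, by
          have := hpos k _ hk
          rw [this.1]
          exact this.2⟩
        refine ⟨Nat.find hex, fun l hl => not_not.1 (Nat.find_min hex hl), Nat.find_spec hex, ?_⟩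
        have hle : Nat.find hex ≤ k := Nat.find_min' hex (by
          have := hpos k _ hk
          rw [this.1]
          exact this.2)
        have hs := Nat.find_spec hex
        obtain ⟨x, hx⟩ : ∃ x, x ∈ c.evaln (Nat.find hex) (wordNum w) := by
          rcases h : c.evaln (Nat.find hex) (wordNum w) with _ | x
          · simp [g, h] at hs
          · exact ⟨x, rfl⟩
        -- `evaln` is monotone in the step bound, so the result at the least bound is the result at
        -- `k`.
        rw [(hpos _ x hx).1, Option.mem_unique (Nat.Partrec.Code.evaln_mono hle hx) hk]
        cases b <;> simp
    · by_cases h6 : ∀ r, 6 ≤ r → s r = 0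
      · refine (hrun s h6 (hs 5 le_rfl)).of_eq ?_
        rfl
      · exact absurd (fun r hr => hs r (by omega)) h6

end CounterMachine

/-! ## The game that simulates a counter machine -/

/-- The states of the simulating game: the initial state, two sinks, and one state for each location
of the code and each lane. Lanes `2 * c` and `2 * c + 1` hold the value of register `c` and its
negative; the last register is a timer. -/
inductive SimState
  | init
  | win
  | lose
  | cell (ℓ x : ℕ)

namespace SimState

/-- The observation: the lane is hidden. -/
def obs : SimState → ℕ
  | init => 0
  | win => 1
  | lose => 2
  | cell ℓ _ => ℓ + 3

/-- The states of the game for a code of length `m` with registers below `K`. -/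
def Valid (m K : ℕ) : SimState → Prop
  | cell ℓ x => ℓ < m ∧ x < 2 * (K + 1)
  | _ => True

end SimState

/-- The change of lane `x` when register `c` is increased. -/
def laneInd (c x : ℕ) : ℤ := if x = 2 * c then 1 else if x = 2 * c + 1 then -1 else 0

/-- The content of lane `x`. -/
def laneVal (s : ℕ → ℕ) (x : ℕ) : ℤ := if x % 2 = 0 then (s (x / 2) : ℤ) else -(s (x / 2) : ℤ)

/-- The successors of the lane `x` at a location with the instruction `I`, when Eve plays `a < 2`. -/
def instrSuccs (K : ℕ) (I : Instr) (ℓ x a : ℕ) : List (SimState × ℤ) :=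
  match I with
  | .inc c => [(.cell (ℓ + 1) x, laneInd c x + laneInd K x)]
  | .jz c t =>
    if a = 0 then (.cell t x, laneInd K x) :: if x = 2 * c + 1 then [(.init, 0)] else []
    else (.cell (ℓ + 1) x, laneInd K x - laneInd c x) :: if x = 2 * c then [(.init, -1)] else []
  | .halt b => [(if b = false ∧ x = 0 then .lose else .win, 0)]

/-- The successors of a state, with the weights of the transitions. With the action `y + 2` Eve
claims that the value of lane `y` is infinite. -/
def simSuccs (code : List Instr) (K : ℕ) (s : SimState) (a : ℕ) : List (SimState × ℤ) :=
  match s with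
  | .init => (List.range (2 * (K + 1))).map fun x => (.cell 0 x, 0)
  | .win => [(.win, 0)]
  | .lose => [(.lose, -1)]
  | .cell ℓ x =>
    if 2 ≤ a then [(if a = x + 2 then .lose else .win, 0)]
    else (code[ℓ]?.map fun I => instrSuccs K I ℓ x a).getD []

/-- All registers and jump targets are in the allowed range, and the last instruction is `halt`. -/
def ValidCode (code : List Instr) (K : ℕ) : Prop :=
  code ≠ [] ∧ ∀ ℓ I, code[ℓ]? = some I →
    I.Valid K code.length ∧ (ℓ + 1 < code.length ∨ ∃ b, I = .halt b)

theorem laneVal_update_succ (s : ℕ → ℕ) (c x : ℕ) :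
    laneVal (Function.update s c (s c + 1)) x = laneVal s x + laneInd c x := by
  unfold laneVal laneInd
  simp only [Function.update_apply]
  rcases Nat.mod_two_eq_zero_or_one x with h | h
  · rw [if_pos h, if_pos h]
    by_cases hx : x = 2 * c
    · subst hx; simp
    · rw [if_neg hx, if_neg (by omega), if_neg (by omega), add_zero]
  · have h0 : ¬ x % 2 = 0 := by omega
    rw [if_neg h0, if_neg h0, if_neg (by omega : ¬ x = 2 * c)]
    by_cases hx : x = 2 * c + 1
    · subst hx
      rw [show (2 * c + 1) / 2 = c by omega]
      simp
      omega
    · rw [if_neg hx, if_neg (by omega), add_zero]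

theorem laneVal_update_pred (s : ℕ → ℕ) (c x : ℕ) (hc : s c ≠ 0) :
    laneVal (Function.update s c (s c - 1)) x = laneVal s x - laneInd c x := by
  have h := laneVal_update_succ (Function.update s c (s c - 1)) c x
  rw [Function.update_self, Nat.sub_add_cancel (by omega), Function.update_idem,
    Function.update_eq_self] at h
  omega

theorem laneVal_two_mul (s : ℕ → ℕ) (c : ℕ) : laneVal s (2 * c) = s c := by
  simp [laneVal]

theorem laneVal_two_mul_succ (s : ℕ → ℕ) (c : ℕ) : laneVal s (2 * c + 1) = -(s c : ℤ) := by
  have h1 : (2 * c + 1) % 2 = 1 := by omega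
  have h2 : (2 * c + 1) / 2 = c := by omega
  simp [laneVal, h1, h2]

namespace CounterMachine

/-- The registers after `t` steps, with the timer in register `K`. -/
def timed (code : List Instr) (K t : ℕ) : ℕ → ℕ := Function.update (run code t).2 K t

/-- The right answer (`0`: zero, `1`: positive, or any answer if nothing is tested). -/
def RightAction (code : List Instr) (t a : ℕ) : Prop :=
  a < 2 ∧ ∀ c t', code[(run code t).1]? = some (.jz c t') → (a = 0 ↔ (run code t).2 c = 0)

variable {code : List Instr} {K : ℕ}

theorem run_fst_lt (hc : ValidCode code K) (t : ℕ) : (run code t).1 < code.length := by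
  induction t with
  | zero => exact List.length_pos_iff.2 hc.1
  | succ t ih =>
    rw [run_succ, step]
    have h1 := List.getElem?_eq_getElem ih
    obtain ⟨hv, hl⟩ := hc.2 _ _ h1
    rw [h1]
    generalize code[(run code t).1] = I at hv hl
    cases I with
    | inc c => exact hl.resolve_right (by simp)
    | jz c t' =>
      have := hl.resolve_right (by simp)
      dsimp only
      split_ifs
      · exact hv.2
      · exact this
    | halt b => exact ih

theorem exists_rightAction (code : List Instr) (t : ℕ) : ∃ a, RightAction code t a := by
  classical
  by_cases h : ∃ c t', code[(run code t).1]? = some (.jz c t') ∧ (run code t).2 c = 0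
  · obtain ⟨c, t', h, h0⟩ := h
    refine ⟨0, by norm_num, fun c' t'' h' => ?_⟩
    rw [h] at h'
    cases h'
    simpa using h0
  · refine ⟨1, by norm_num, fun c' t'' h' => ?_⟩
    simpa using fun h0 => h ⟨c', t'', h', h0⟩

/-- A return to `.init` is possible from lane `2 * c + 1` after the answer "zero", with value `-0`,
and from lane `2 * c` with weight `-1` after the answer "positive", with value at least `1 - 1`. The
other successors keep the lane and update its content. -/
theorem succs_of_rightAction (hc : ValidCode code K) {t a x : ℕ} (ha : RightAction code t a)
    (hh : ∀ b, code[(run code t).1]? ≠ some (.halt b)) :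
    (∀ p ∈ simSuccs code K (.cell (run code t).1 x) a,
      (p.1 = .init ∧ 0 ≤ laneVal (timed code K t) x + p.2) ∨
      (p.1 = .cell (run code (t + 1)).1 x ∧
        laneVal (timed code K t) x + p.2 = laneVal (timed code K (t + 1)) x)) ∧
    ∃ z, (.cell (run code (t + 1)).1 x, z) ∈ simSuccs code K (.cell (run code t).1 x) a := by
  have hlt := List.getElem?_eq_getElem (run_fst_lt hc t)
  obtain ⟨hv, -⟩ := hc.2 _ _ hlt
  rw [hlt] at hh
  have hr := ha.2
  rw [hlt] at hr
  simp only [simSuccs, if_neg (by have := ha.1; omega : ¬ 2 ≤ a), hlt, Option.map_some,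
    Option.getD_some, timed, run_succ, step]
  generalize code[(run code t).1]'(run_fst_lt hc t) = I at hv hh hr
  generalize (run code t).2 = s at hr
  generalize (run code t).1 = ℓ
  -- The timer advances in every step; its register `K` differs from those in the code.
  have hT : ∀ s : ℕ → ℕ, laneVal (Function.update s K (t + 1)) x =
      laneVal (Function.update s K t) x + laneInd K x := by
    intro s
    have := laneVal_update_succ (Function.update s K t) K x
    rwa [Function.update_self, Function.update_idem] at this
  cases I with
  | halt b => exact absurd rfl (hh b)
  | inc c =>
    have hcK : c ≠ K := (show c < K from hv).ne
    have h1 := laneVal_update_succ (Function.update s K t) c x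
    rw [Function.update_of_ne hcK, Function.update_comm hcK.symm] at h1
    simp only [instrSuccs, List.mem_singleton, forall_eq, hT]
    refine ⟨Or.inr ⟨by simp, ?_⟩, _, rfl⟩
    rw [h1]
    ring
  | jz c t' =>
    have hcK : c ≠ K := (show c < K from hv.1).ne
    have hr := hr c t' rfl
    by_cases h0 : s c = 0
    · simp only [instrSuccs, if_pos (hr.2 h0), if_pos h0, hT]
      refine ⟨?_, _, List.mem_cons_self⟩
      intro p hp
      rcases List.mem_cons.1 hp with rfl | hp
      · right
        simp
      · left
        split_ifs at hp with hx
        · rw [List.mem_singleton] at hp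
          subst hp hx
          rw [laneVal_two_mul_succ, Function.update_of_ne hcK, h0]
          simp
        · simp at hp
    · have h1 := laneVal_update_pred (Function.update s K t) c x
        (by rwa [Function.update_of_ne hcK])
      rw [Function.update_of_ne hcK, Function.update_comm hcK.symm] at h1
      simp only [instrSuccs, if_neg (fun h => h0 (hr.1 h)), if_neg h0, hT]
      refine ⟨?_, _, List.mem_cons_self⟩
      intro p hp
      rcases List.mem_cons.1 hp with rfl | hp
      · right
        refine ⟨rfl, ?_⟩
        rw [h1]
        ring
      · left
        split_ifs at hp with hx
        · rw [List.mem_singleton] at hp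
          subst hp hx
          rw [laneVal_two_mul, Function.update_of_ne hcK]
          simp
          omega
        · simp at hp

/-- The lane that refutes the answer: `2 * c + 1` with a negative content if the register is wrongly
called zero, `2 * c` with content `0` and weight `-1` if it is wrongly called positive. -/
theorem succs_of_not_rightAction (hc : ValidCode code K) {t a : ℕ} (ha : a < 2)
    (hr : ¬ RightAction code t a) : ∃ x < 2 * (K + 1), ∃ z,
      (.init, z) ∈ simSuccs code K (.cell (run code t).1 x) a ∧
      laneVal (timed code K t) x + z < 0 := by
  simp only [RightAction, ha, true_and] at hr
  push Not at hr
  obtain ⟨c, t', h, hr⟩ := hr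
  have hv := (hc.2 _ _ h).1
  have hcK : c < K := hv.1
  by_cases h0 : a = 0
  · refine ⟨2 * c + 1, by omega, 0, ?_, ?_⟩
    · simp [simSuccs, h, instrSuccs, h0]
    · rw [laneVal_two_mul_succ, timed, Function.update_of_ne hcK.ne]
      have : (run code t).2 c ≠ 0 := by tauto
      omega
  · refine ⟨2 * c, by omega, -1, ?_, ?_⟩
    · simp [simSuccs, h, instrSuccs, h0, show ¬ 2 ≤ a by omega]
    · rw [laneVal_two_mul, timed, Function.update_of_ne hcK.ne]
      have : (run code t).2 c = 0 := by tauto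
      omega

end CounterMachine

open CounterMachine

theorem SimState.obs_eq_init {s : SimState} : s.obs = SimState.init.obs ↔ s = .init := by
  cases s <;> simp [SimState.obs]

theorem SimState.obs_eq_win {s : SimState} : s.obs = SimState.win.obs ↔ s = .win := by
  cases s <;> simp [SimState.obs]

theorem SimState.obs_eq_lose {s : SimState} : s.obs = SimState.lose.obs ↔ s = .lose := by
  cases s <;> simp [SimState.obs]

theorem SimState.obs_eq_cell {s : SimState} {ℓ x : ℕ} :
    s.obs = (SimState.cell ℓ x).obs ↔ ∃ y, s = .cell ℓ y := by
  cases s <;> simp [SimState.obs]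

/-! ### Functions that represent configurations, and play in the sinks. -/

namespace MPG

variable {Q A : Type}

/-- `G` is the game that simulates the counter machine `code`. -/
structure Simulates (G : MPG Q A) (code : List Instr) (K : ℕ) (e : Q → SimState) (α : A → ℕ) :
    Prop where
  validCode : ValidCode code K
  injective : Function.Injective e
  valid_iff : ∀ s, s.Valid code.length K ↔ ∃ q, e q = s
  init : e G.init = .init
  act_iff : ∀ n, n < 2 * (K + 1) + 2 ↔ ∃ a, α a = n
  mem_obs : ∀ o ∈ G.Obs, ∀ q ∈ o, ∀ q', q' ∈ o ↔ (e q').obs = (e q).obs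
  mem_Δ : ∀ q a q', (q, a, q') ∈ G.Δ ↔ ∃ z, (e q', z) ∈ simSuccs code K (e q) (α a)
  weight : ∀ q a q' z, (e q', z) ∈ simSuccs code K (e q) (α a) → G.w (q, a, q') = z

/-- The function that represents the configuration after `t` steps. -/
def confFun (code : List Instr) (K : ℕ) (e : Q → SimState) (t : ℕ) : WFun Q := fun q =>
  match e q with
  | .cell ℓ x => if ℓ = (run code t).1 then some (laneVal (timed code K t) x : ℤ) else none
  | _ => none

/-- The earlier functions represent earlier configurations. -/
def Traced (G : MPG Q A) (code : List Instr) (K : ℕ) (e : Q → SimState) (t : ℕ)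
    (x : List (A × WFun Q)) : Prop :=
  G.IsPosition x ∧ ∀ g ∈ G.earlierFuns x, g = G.initFun ∨ ∃ t' < t, g = confFun code K e t'

variable {G : MPG Q A} {code : List Instr} {K : ℕ} {e : Q → SimState} {α : A → ℕ}

theorem confFun_eq_some {t : ℕ} {q : Q} {v : WithTop ℤ} : confFun code K e t q = some v ↔
    ∃ x, e q = .cell (run code t).1 x ∧ v = (laneVal (timed code K t) x : ℤ) := by
  unfold confFun
  rcases e q with _ | _ | _ | ⟨ℓ, x⟩
  · simp
  · simp
  · simp
  · dsimp only
    split_ifs with h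
    · subst h
      simp [eq_comm]
    · simp [h]

theorem mem_supp_confFun {t : ℕ} {q : Q} : q ∈ (confFun code K e t).supp ↔
    ∃ x, e q = .cell (run code t).1 x := by
  simp [WFun.mem_supp, confFun_eq_some]

namespace Simulates

variable (S : G.Simulates code K e α)
include S

theorem exists_cell (t : ℕ) {x : ℕ} (hx : x < 2 * (K + 1)) : ∃ q, e q = .cell (run code t).1 x :=
  (S.valid_iff _).1 ⟨run_fst_lt S.validCode t, hx⟩

theorem lt_of_cell {q : Q} {ℓ x : ℕ} (h : e q = .cell ℓ x) : x < 2 * (K + 1) :=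
  ((S.valid_iff _).2 ⟨q, h⟩ : SimState.Valid _ _ (.cell ℓ x)).2

theorem mem_supp {f : WFun Q} (hf : f.supp ∈ G.Obs) {q q' : Q} (hq : q ∈ f.supp) :
    q' ∈ f.supp ↔ (e q').obs = (e q).obs := S.mem_obs _ hf q hq q'

theorem mem_stepValues {t : ℕ} {a : A} {q : Q} {v : WithTop ℤ} :
    v ∈ G.stepValues (confFun code K e t) a q ↔ ∃ x < 2 * (K + 1), ∃ z,
      (e q, z) ∈ simSuccs code K (.cell (run code t).1 x) (α a) ∧
      v = ((laneVal (timed code K t) x + z : ℤ) : WithTop ℤ) := by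
  constructor
  · rintro ⟨q', y, h1, h2, rfl⟩
    obtain ⟨x, hx, rfl⟩ := confFun_eq_some.1 h2
    obtain ⟨z, hz⟩ := (S.mem_Δ _ _ _).1 h1
    have hw := S.weight _ _ _ _ hz
    rw [hx] at hz
    exact ⟨x, S.lt_of_cell hx, z, hz, by rw [hw, WithTop.coe_add]⟩
  · rintro ⟨x, hx, z, hz, rfl⟩
    obtain ⟨q', hq'⟩ := S.exists_cell t hx
    rw [← hq'] at hz
    exact ⟨q', _, (S.mem_Δ _ _ _).2 ⟨z, hz⟩, confFun_eq_some.2 ⟨x, hq', rfl⟩, by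
      rw [S.weight _ _ _ _ hz, WithTop.coe_add]⟩

theorem mem_post {t : ℕ} {a : A} {q : Q} : q ∈ G.post a (confFun code K e t).supp ↔
    ∃ x < 2 * (K + 1), ∃ z, (e q, z) ∈ simSuccs code K (.cell (run code t).1 x) (α a) := by
  have h := fun v => S.mem_stepValues (t := t) (a := a) (q := q) (v := v)
  constructor
  · rintro ⟨q', h1, h2⟩
    obtain ⟨y, hy⟩ := WFun.mem_supp.1 h1
    obtain ⟨x, hx, z, hz, -⟩ := (h _).1 ⟨q', y, h2, hy, rfl⟩
    exact ⟨x, hx, z, hz⟩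
  · rintro ⟨x, hx, z, hz⟩
    obtain ⟨q', y, h1, h2, -⟩ := (h _).2 ⟨x, hx, z, hz, rfl⟩
    exact ⟨q', WFun.mem_supp.2 ⟨y, h2⟩, h1⟩

theorem mem_supp_initFun {q : Q} : q ∈ G.initFun.supp ↔ e q = .init := by
  rw [supp_initFun, Set.mem_singleton_iff, ← S.init, S.injective.eq_iff]

-- Both stopping conditions require an earlier function with the same support.
omit S in
theorem not_mem_of_fresh {y : List (A × WFun Q)}
    (hy : ∀ g ∈ G.earlierFuns y, g.supp ≠ (G.lastFun y).supp) :
    y ∉ G.assocGame.TE ∪ G.assocGame.TA := by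
  rintro (⟨-, g, hg, h⟩ | ⟨-, g, hg, h, -⟩)
  · exact hy g hg h.1
  · exact hy g hg h.1.symm

theorem fresh_of_sink {t ℓ : ℕ} {x : List (A × WFun Q)} (hx : G.Traced code K e t x)
    (hlast : ∀ q ∈ (G.lastFun x).supp, ∃ y, e q = .cell ℓ y) {a : A} {f : WFun Q}
    {q : Q} (hq : q ∈ f.supp) (he : e q = .win ∨ e q = .lose) :
    ∀ g ∈ G.earlierFuns ((a, f) :: x), g.supp ≠ f.supp := by
  intro g hg h
  rw [← h] at hq
  rcases List.mem_cons.1 hg with rfl | hg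
  · obtain ⟨y, hy⟩ := hlast q hq
    simp [hy] at he
  rcases hx.2 g hg with rfl | ⟨t', -, rfl⟩
  · rw [S.mem_supp_initFun] at hq
    simp [hq] at he
  · obtain ⟨x, hx⟩ := mem_supp_confFun.1 hq
    simp [hx] at he

theorem supp_eq_of_sink {f : WFun Q} (hf : f.supp ∈ G.Obs) {q : Q} (hq : q ∈ f.supp)
    (he : e q = .win ∨ e q = .lose) : f.supp = {q} := by
  ext q'
  rw [S.mem_supp hf hq, Set.mem_singleton_iff, ← S.injective.eq_iff (b := q)]
  rcases he with he | he
  · rw [he, SimState.obs_eq_win]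
  · rw [he, SimState.obs_eq_lose]

theorem mem_Δ_win {q q' : Q} {a : A} (hq : e q = .win) : (q, a, q') ∈ G.Δ ↔ q' = q := by
  rw [S.mem_Δ, hq, ← S.injective.eq_iff (a := q'), hq]
  simp [simSuccs]

theorem mem_Δ_lose {q q' : Q} {a : A} (hq : e q = .lose) : (q, a, q') ∈ G.Δ ↔ q' = q := by
  rw [S.mem_Δ, hq, ← S.injective.eq_iff (a := q'), hq]
  simp [simSuccs]

/-- Eve wins in the sinks: in `win`, and in `lose` if the value is infinite. -/
theorem eveForceIn_sink {x : List (A × WFun Q)} {a : A}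
    {f : WFun Q} (hy : G.IsPosition ((a, f) :: x))
    (hfresh : ∀ g ∈ G.earlierFuns ((a, f) :: x), g.supp ≠ f.supp) {q : Q} (hq : q ∈ f.supp)
    (he : e q = .win ∨ e q = .lose ∧ f q = some ⊤) :
    G.assocGame.EveForceIn 1 ((a, f) :: x) := by
  have he' : e q = .win ∨ e q = .lose := he.imp_right And.left
  have hs := S.supp_eq_of_sink hy.2.1.1 hq he'
  refine Or.inr ⟨not_mem_of_fresh hfresh, a, ?_⟩
  rintro _ ⟨-, hz, f', rfl⟩
  have hΔ : ∀ q', (q, a, q') ∈ G.Δ ↔ q' = q := fun q' =>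
    he'.elim (fun h => S.mem_Δ_win h) fun h => S.mem_Δ_lose h
  have hs' : f'.supp = {q} := by
    have hsub := hz.2.1.2.1
    obtain ⟨q', hq'⟩ := obs_nonempty hz.2.1.1
    have hsub' : f'.supp ⊆ {q} := by
      intro r hr
      obtain ⟨p, hp, hpr⟩ := hsub hr
      rw [lastFun, hs, Set.mem_singleton_iff] at hp
      subst hp
      exact (hΔ r).1 hpr
    obtain rfl : q' = q := hsub' hq'
    exact hsub'.antisymm (by simpa using hq')
  -- One round of the loop suffices: the value does not drop, because the weight is `0` or the value
  -- is infinite.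
  refine ⟨hz, f, List.mem_cons_self, hs.trans hs'.symm, ?_⟩
  intro r v v' hv hv'
  change f' r = some v' at hv'
  have hr : r = q := by
    have : r ∈ f.supp := WFun.mem_supp.2 ⟨v, hv⟩
    rwa [hs] at this
  subst hr
  rcases hz.2.1.2.2 r (WFun.mem_supp.2 ⟨v', hv'⟩) with h | ⟨u, hu, ⟨p, y, hp, hpy, rfl⟩, -⟩
  · rw [hv'] at h
    cases h
    simp
  · rw [hv'] at hu
    cases hu
    have hpr : p = r := by
      have : p ∈ f.supp := WFun.mem_supp.2 ⟨y, hpy⟩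
      rwa [hs] at this
    subst hpr
    change f p = some y at hpy
    rw [hv] at hpy
    cases hpy
    rcases he with he | ⟨-, he⟩
    · rw [S.weight p a p 0 (by rw [he]; simp [simSuccs])]
      simp
    · rw [hv] at he
      cases he
      simp

/-- Adam wins in `lose` if the value is finite. -/
theorem adamForceIn_lose [Finite Q] {x : List (A × WFun Q)} {a : A}
    {f : WFun Q} (hy : G.IsPosition ((a, f) :: x))
    (hfresh : ∀ g ∈ G.earlierFuns ((a, f) :: x), g.supp ≠ f.supp) {q : Q} {z : ℤ} (hq : f q = some z) (he : e q = .lose) :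
    G.assocGame.AdamForceIn 1 ((a, f) :: x) := by
  have hqs : q ∈ f.supp := WFun.mem_supp.2 ⟨_, hq⟩
  have hs := S.supp_eq_of_sink hy.2.1.1 hqs (Or.inr he)
  have ht := not_mem_of_fresh hfresh
  have hsucc : ∀ b, ∃ f', G.IsSucc f b f' ∧ f'.supp = f.supp ∧
      ∀ r v, f' r = some v → IsLeast (G.stepValues f b r) v := fun b => by
    refine exists_min_isSucc hy.2.1.1 ?_
    rw [hs]
    rintro r rfl
    exact ⟨r, rfl, (S.mem_Δ_lose he).2 rfl⟩
  choose F hF1 hF2 hF3 using hsucc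
  -- One round of the loop lowers the finite value by one, so the new function is `⪯₁ f`.
  refine Or.inr ⟨ht, fun b => (b, F b) :: (a, f) :: x, fun b => ⟨assocGame_Δ_cons hy ht (hF1 b), ?_⟩⟩
  refine ⟨isPosition_cons hy ht (hF1 b), f, List.mem_cons_self, ⟨hF2 b, ?_⟩, q, hqs, ?_⟩
  · intro r v v' hv hv'
    obtain ⟨⟨p, y, hp, hpy, rfl⟩, -⟩ := hF3 b r v hv
    have h1 : r = q := by
      have : r ∈ f.supp := WFun.mem_supp.2 ⟨_, hv'⟩
      rwa [hs] at this
    have h2 : p = q := by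
      have : p ∈ f.supp := WFun.mem_supp.2 ⟨y, hpy⟩
      rwa [hs] at this
    subst h1 h2
    rw [hpy] at hq hv'
    cases hq
    cases hv'
    rw [S.weight p b p (-1) (by rw [he]; simp [simSuccs])]
    rw [← WithTop.coe_add]
    norm_cast
    omega
  · rw [hq]
    simp

/-- A value above all earlier ones at the same state rules out `⪯₁`. Such a value is provided by the
timer or by `+∞`. -/
theorem not_mem_of_cells {t : ℕ} {x : List (A × WFun Q)} (hx : G.Traced code K e t x)
    {q : Q} {v : WithTop ℤ} (hq : G.lastFun x q = some v)
    (hv : ∀ t' < t, ∀ ℓ y, e q = .cell ℓ y → laneVal (timed code K t') y < v)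
    {ℓ y : ℕ} (he : e q = .cell ℓ y) :
    x ∉ G.assocGame.TA := by
  rintro ⟨-, g, hg, h, -⟩
  have hqg : q ∈ g.supp := h.1 ▸ WFun.mem_supp.2 ⟨v, hq⟩
  rcases hx.2 g hg with rfl | ⟨t', ht', rfl⟩
  · rw [S.mem_supp_initFun, he] at hqg
    cases hqg
  · obtain ⟨u, hu⟩ := WFun.mem_supp.1 hqg
    obtain ⟨y', hy', rfl⟩ := confFun_eq_some.1 hu
    have h1 := h.2 q _ _ hq hu
    have h2 := hv t' ht' _ _ hy'
    have h3 : v ≤ v + ((1 : ℕ) : WithTop ℤ) := le_add_of_nonneg_right (by simp)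
    exact absurd (h3.trans h1) (not_le.2 h2)

/-- This is the purpose of the timer: the decreasing lane `2 * K + 1` prevents `⪯₀` from an earlier
function, and the increasing lane `2 * K` prevents `⪯₁` to one. -/
theorem not_mem_of_confFun {t : ℕ} {x : List (A × WFun Q)} (hx : G.Traced code K e t x)
    (hlast : G.lastFun x = confFun code K e t) : x ∉ G.assocGame.TE ∪ G.assocGame.TA := by
  have htimer : ∀ t, timed code K t K = t := fun t => by simp [timed]
  rintro (h | h)
  · obtain ⟨-, g, hg, h⟩ := h
    obtain ⟨q, hq⟩ := S.exists_cell t (x := 2 * K + 1) (by omega)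
    have hqx : G.lastFun x q = some (laneVal (timed code K t) (2 * K + 1) : ℤ) := by
      rw [hlast]
      exact confFun_eq_some.2 ⟨_, hq, rfl⟩
    have hqg : q ∈ g.supp := h.1 ▸ WFun.mem_supp.2 ⟨_, hqx⟩
    rcases hx.2 g hg with rfl | ⟨t', ht', rfl⟩
    · rw [S.mem_supp_initFun, hq] at hqg
      cases hqg
    · obtain ⟨u, hu⟩ := WFun.mem_supp.1 hqg
      obtain ⟨y', hy', rfl⟩ := confFun_eq_some.1 hu
      rw [hq, SimState.cell.injEq] at hy'
      obtain ⟨-, rfl⟩ := hy'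
      have h1 := h.2 q _ _ hu hqx
      rw [laneVal_two_mul_succ, laneVal_two_mul_succ, htimer, htimer] at h1
      simp only [Nat.cast_zero, add_zero, WithTop.coe_le_coe] at h1
      omega
  · obtain ⟨q, hq⟩ := S.exists_cell t (x := 2 * K) (by omega)
    refine S.not_mem_of_cells hx (q := q) (v := (laneVal (timed code K t) (2 * K) : ℤ)) ?_ ?_ hq h
    · rw [hlast]
      exact confFun_eq_some.2 ⟨_, hq, rfl⟩
    · intro t' ht' ℓ y hy
      rw [hq] at hy
      cases hy
      rw [laneVal_two_mul, laneVal_two_mul, htimer, htimer]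
      exact_mod_cast ht'

end Simulates

end MPG

/-! ### Eve's play in the simulating game. -/

namespace MPG

variable {Q A : Type} {G : MPG Q A} {code : List Instr} {K : ℕ} {e : Q → SimState} {α : A → ℕ}

namespace Simulates

variable (S : G.Simulates code K e α)
include S

/-- If the observation is the right one and each value is right or infinite, then either Eve wins by
claiming a lane, or the configuration is represented. -/
theorem eveForceIn_or_eq_confFun {t : ℕ} {x : List (A × WFun Q)} (hx : G.Traced code K e t x)
    (hs : ∀ q, q ∈ (G.lastFun x).supp ↔ ∃ y, e q = .cell (run code t).1 y)
    (hv : ∀ q v y, G.lastFun x q = some v → e q = .cell (run code t).1 y →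
      v = ⊤ ∨ v = (laneVal (timed code K t) y : ℤ)) :
    G.assocGame.EveForceIn 2 x ∨ G.lastFun x = confFun code K e t := by
  by_cases htop : ∃ q, G.lastFun x q = some ⊤
  · left
    obtain ⟨q, hq⟩ := htop
    obtain ⟨y, hy⟩ := (hs q).1 (WFun.mem_supp.2 ⟨_, hq⟩)
    by_cases hE : x ∈ G.assocGame.TE
    · exact Or.inl hE
    -- Eve claims the infinite lane `y`. The state `lose` is entered from this lane only and so
    -- inherits `+∞`; all other lanes lead to `win`.
    obtain ⟨a, ha⟩ := (S.act_iff (y + 2)).1 (by have := S.lt_of_cell hy; omega)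
    refine Or.inr ⟨?_, a, ?_⟩
    · rintro (h | h)
      · exact hE h
      · exact S.not_mem_of_cells hx hq (fun t' _ _ _ _ => WithTop.coe_lt_top _) hy h
    · rintro _ ⟨-, hz, f, rfl⟩
      obtain ⟨r, hr⟩ := obs_nonempty hz.2.1.1
      have hcase : ∀ {p y' z}, e p = .cell (run code t).1 y' →
          (e r, z) ∈ simSuccs code K (e p) (α a) → z = 0 ∧
          e r = if y = y' then .lose else .win := by
        intro p y' z hp h
        simpa [hp, simSuccs, ha, and_comm] using h
      have hsink : e r = .win ∨ e r = .lose ∧ f r = some ⊤ := by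
        obtain ⟨p, hp, hpr⟩ := hz.2.1.2.1 hr
        obtain ⟨y', hy'⟩ := (hs p).1 hp
        obtain ⟨z, hz'⟩ := (S.mem_Δ _ _ _).1 hpr
        have h1 := (hcase hy' hz').2
        by_cases hyy : y = y'
        · rw [if_pos hyy] at h1
          refine Or.inr ⟨h1, ?_⟩
          rcases hz.2.1.2.2 r hr with h | ⟨u, hu, ⟨p', v, hp', hpv, rfl⟩, -⟩
          · exact h
          · obtain ⟨y'', hy''⟩ := (hs p').1 (WFun.mem_supp.2 ⟨_, hpv⟩)
            obtain ⟨z', hz''⟩ := (S.mem_Δ _ _ _).1 hp'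
            have h2 := (hcase hy'' hz'').2
            rw [h1] at h2
            have h3 : y = y'' := by
              by_contra h
              simp [h] at h2
            subst h3
            have : p' = q := S.injective (hy''.trans hy.symm)
            subst this
            rw [hq] at hpv
            cases hpv
            rw [hu, WithTop.top_add]
        · rw [if_neg hyy] at h1
          exact Or.inl h1
      exact S.eveForceIn_sink hz
        (S.fresh_of_sink hx (fun q hq => (hs q).1 hq) hr (hsink.imp_right And.left)) hr hsink
  · right
    funext q
    rcases h : G.lastFun x q with _ | v
    · symm
      by_contra hn
      obtain ⟨v, hv⟩ := Option.ne_none_iff_exists'.1 hn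
      obtain ⟨y, hy, -⟩ := confFun_eq_some.1 hv
      exact (hs q).2 ⟨y, hy⟩ h
    · obtain ⟨y, hy⟩ := (hs q).1 (WFun.mem_supp.2 ⟨_, h⟩)
      symm
      rw [confFun_eq_some]
      refine ⟨y, hy, (hv q v y h hy).resolve_left ?_⟩
      rintro rfl
      exact htop ⟨q, h⟩

theorem supp_iff_cell {f : WFun Q} (hf : f.supp ∈ G.Obs) {q : Q} (hq : q ∈ f.supp) {ℓ y : ℕ}
    (he : e q = .cell ℓ y) (r : Q) : r ∈ f.supp ↔ ∃ y, e r = .cell ℓ y := by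
  rw [S.mem_supp hf hq, he, SimState.obs_eq_cell]

omit S in
theorem initFun_mem_earlierFuns (p : A × WFun Q) (x : List (A × WFun Q)) :
    G.initFun ∈ G.earlierFuns (p :: x) := by
  induction x generalizing p with
  | nil => exact List.mem_cons_self
  | cons p' x ih => exact List.mem_cons_of_mem _ (ih p')

omit S in
theorem traced_cons {t : ℕ} {x : List (A × WFun Q)} (hx : G.Traced code K e t x)
    (hlast : G.lastFun x = confFun code K e t) {a : A} {f : WFun Q}
    (hy : G.IsPosition ((a, f) :: x)) : G.Traced code K e (t + 1) ((a, f) :: x) := by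
  refine ⟨hy, fun g hg => ?_⟩
  rcases List.mem_cons.1 hg with rfl | hg
  · exact Or.inr ⟨t, by omega, hlast⟩
  · exact (hx.2 g hg).imp_right fun ⟨u, hu, h⟩ => ⟨u, by omega, h⟩

/-- Against the right answer Adam has three kinds of replies: a return to the initial state, which
loses at once; some value `+∞`, which Eve punishes by a claim; or the faithful next configuration.
-/
theorem eve_step {t : ℕ} {x : List (A × WFun Q)} (hx : G.Traced code K e t x)
    (hlast : G.lastFun x = confFun code K e t)
    (hh : ∀ b, code[(run code t).1]? ≠ some (.halt b)) {a : A} (ha : RightAction code t (α a))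
    {x' : List (A × WFun Q)} (hΔ : G.assocGame.Δ x a x') :
    G.assocGame.EveForceIn 2 x' ∨ G.Traced code K e (t + 1) x' ∧
      G.lastFun x' = confFun code K e (t + 1) := by
  obtain ⟨-, hy, f, rfl⟩ := hΔ
  have hsucc := hy.2.1
  rw [hlast] at hsucc
  obtain ⟨r, hr⟩ := obs_nonempty hsucc.1
  obtain ⟨y, hyL, z, hz⟩ := S.mem_post.1 (hsucc.2.1 hr)
  rcases (succs_of_rightAction S.validCode ha hh).1 _ hz with ⟨h1, -⟩ | ⟨h1, -⟩
  · left
    have hG : ∀ q ∈ f.supp, q = G.init := by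
      intro q hq
      apply S.injective
      rw [S.init, ← SimState.obs_eq_init, (S.mem_supp hsucc.1 hr).1 hq]
      exact congrArg SimState.obs h1
    -- The initial function is an earlier one, and a right answer makes every returning value
    -- nonnegative, hence `⪯₀` holds.
    refine Or.inl ⟨hy, G.initFun, initFun_mem_earlierFuns _ _, ?_, ?_⟩
    · rw [supp_initFun]
      exact (Set.Subset.antisymm (b := {G.init}) hG
        (Set.singleton_subset_iff.2 (hG r hr ▸ hr))).symm
    · intro q v v' hv hv'
      obtain ⟨rfl, rfl⟩ := initFun_eq_some.1 hv
      change f G.init = some v' at hv'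
      rcases hsucc.2.2 _ (WFun.mem_supp.2 ⟨_, hv'⟩) with h | ⟨u, hu, hu', -⟩
      · rw [h] at hv'
        cases hv'
        exact le_top
      · rw [hv'] at hu
        cases hu
        obtain ⟨y', -, z', hz', rfl⟩ := S.mem_stepValues.1 hu'
        rcases (succs_of_rightAction S.validCode ha hh).1 _ hz' with ⟨-, h2⟩ | ⟨h2, -⟩
        · simpa using (by exact_mod_cast h2 : (0 : WithTop ℤ) ≤ _)
        · rw [S.init] at h2
          cases h2
  · have hs := S.supp_iff_cell hsucc.1 hr h1
    have ht := traced_cons hx hlast hy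
    refine (S.eveForceIn_or_eq_confFun ht hs ?_).imp_right fun h => ⟨ht, h⟩
    intro q v y' hv hq
    change f q = some v at hv
    rcases hsucc.2.2 _ (WFun.mem_supp.2 ⟨_, hv⟩) with h | ⟨u, hu, hu', -⟩
    · rw [h] at hv
      cases hv
      exact Or.inl rfl
    · rw [hv] at hu
      cases hu
      right
      obtain ⟨y'', -, z', hz', rfl⟩ := S.mem_stepValues.1 hu'
      rw [hq] at hz'
      rcases (succs_of_rightAction S.validCode ha hh).1 _ hz' with ⟨h2, -⟩ | ⟨h2, h3⟩
      · cases h2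
      · simp only [SimState.cell.injEq, true_and] at h2
        subst h2
        rw [h3]

theorem eve_start {a : A} {x : List (A × WFun Q)} (hΔ : G.assocGame.Δ [] a x) :
    G.assocGame.EveForceIn 2 x ∨ G.Traced code K e 0 x ∧ G.lastFun x = confFun code K e 0 := by
  obtain ⟨-, hy, f, rfl⟩ := hΔ
  have hsucc : G.IsSucc G.initFun a f := hy.2.1
  have hsuc : ∀ {p r}, (p, a, r) ∈ G.Δ → p ∈ G.initFun.supp →
      (∃ y, e r = .cell 0 y) ∧ G.w (p, a, r) = 0 := by
    intro p r h hp
    obtain ⟨z, hz⟩ := (S.mem_Δ _ _ _).1 h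
    rw [S.weight _ _ _ _ hz]
    rw [(S.mem_supp_initFun).1 hp] at hz
    simp only [simSuccs, List.mem_map, List.mem_range, Prod.mk.injEq] at hz
    obtain ⟨y, -, h1, h2⟩ := hz
    exact ⟨⟨y, h1.symm⟩, h2.symm⟩
  obtain ⟨r, hr⟩ := obs_nonempty hsucc.1
  obtain ⟨p, hp, hpr⟩ := hsucc.2.1 hr
  obtain ⟨y, h1⟩ := (hsuc hpr hp).1
  have hs := S.supp_iff_cell hsucc.1 hr h1
  have ht : G.Traced code K e 0 [(a, f)] :=
    ⟨hy, fun g hg => Or.inl (by simpa [earlierFuns, lastFun] using hg)⟩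
  refine (S.eveForceIn_or_eq_confFun ht hs ?_).imp_right fun h => ⟨ht, h⟩
  intro q v y' hv hq
  change f q = some v at hv
  rcases hsucc.2.2 _ (WFun.mem_supp.2 ⟨_, hv⟩) with h | ⟨u, hu, ⟨p', u', h2, h3, rfl⟩, -⟩
  · rw [h] at hv
    cases hv
    exact Or.inl rfl
  · rw [hv] at hu
    cases hu
    right
    rw [(hsuc h2 (WFun.mem_supp.2 ⟨_, h3⟩)).2, (initFun_eq_some.1 h3).2]
    simp [timed, run, laneVal]

theorem eve_halt {t : ℕ} {x : List (A × WFun Q)} (hx : G.Traced code K e t x)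
    (hlast : G.lastFun x = confFun code K e t) (hh : code[(run code t).1]? = some (.halt true)) :
    G.assocGame.EveForceIn 2 x := by
  obtain ⟨a, ha⟩ := (S.act_iff 0).1 (by omega)
  refine Or.inr ⟨S.not_mem_of_confFun hx hlast, a, ?_⟩
  rintro _ ⟨-, hy, f, rfl⟩
  have hsucc := hy.2.1
  rw [hlast] at hsucc
  obtain ⟨r, hr⟩ := obs_nonempty hsucc.1
  obtain ⟨y, hyL, z, hz⟩ := S.mem_post.1 (hsucc.2.1 hr)
  have hw : e r = .win := by
    simpa [simSuccs, ha, hh, instrSuccs] using congrArg Prod.fst (List.mem_singleton.1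
      (by simpa [simSuccs, ha, hh, instrSuccs] using hz :
        (e r, z) ∈ [(SimState.win, (0 : ℤ))]))
  refine S.eveForceIn_sink hy (S.fresh_of_sink hx (ℓ := (run code t).1) ?_ hr (Or.inl hw)) hr
    (Or.inl hw)
  intro q hq
  rw [hlast] at hq
  exact mem_supp_confFun.1 hq

omit S in
theorem nil_not_mem : ([] : List (A × WFun Q)) ∉ G.assocGame.TE ∪ G.assocGame.TA := by
  rintro (⟨-, g, hg, -⟩ | ⟨-, g, hg, -⟩) <;> exact absurd hg List.not_mem_nil

/-- If the code halts with `true`, then Eve wins. -/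
theorem exists_eveForceIn (h : HaltsWith code true) :
    ∃ N, G.assocGame.EveForceIn N [] := by
  obtain ⟨T, hT⟩ := h
  -- `n` bounds the remaining steps of the machine; two more moves enter the sink and go round its
  -- loop.
  have key : ∀ n t, T ≤ t + n → ∀ x : List (A × WFun Q), G.Traced code K e t x →
      G.lastFun x = confFun code K e t → G.assocGame.EveForceIn (n + 2) x := by
    intro n
    induction n with
    | zero =>
      intro t ht x hx hl
      exact S.eve_halt hx hl (by rw [run_eq_of_halt hT (by omega)]; exact hT)
    | succ n ih =>
      intro t ht x hx hl
      by_cases hh : ∃ b, code[(run code t).1]? = some (.halt b)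
      · obtain ⟨b, hb⟩ := hh
        obtain rfl : b = true := HaltsWith.unique ⟨t, hb⟩ ⟨T, hT⟩
        exact ReachGame.EveForceIn.mono (S.eve_halt hx hl hb) (by omega)
      · push Not at hh
        obtain ⟨a', ha'⟩ := exists_rightAction code t
        obtain ⟨a, rfl⟩ := (S.act_iff a').1 (by have := ha'.1; omega)
        refine Or.inr ⟨S.not_mem_of_confFun hx hl, a, fun x' hx' => ?_⟩
        rcases S.eve_step hx hl hh ha' hx' with h | ⟨h1, h2⟩
        · exact ReachGame.EveForceIn.mono h (by omega)
        · exact ih (t + 1) (by omega) x' h1 h2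
  obtain ⟨a, -⟩ := (S.act_iff 0).1 (by omega)
  refine ⟨T + 3, Or.inr ⟨nil_not_mem, a, fun x hx => ?_⟩⟩
  rcases S.eve_start hx with h | ⟨h1, h2⟩
  · exact ReachGame.EveForceIn.mono h (by omega)
  · exact key T 0 (by omega) x h1 h2

end Simulates

end MPG

/-! ### Adam's play in the simulating game, and the converse implications. -/

namespace MPG

variable {Q A : Type} {G : MPG Q A} {code : List Instr} {K : ℕ} {e : Q → SimState} {α : A → ℕ}

/-- All lanes move in parallel. This is what makes the successors of an observation a union of
observations. -/
theorem exists_mem_simSuccs_cell {ℓ x ℓ' x' a : ℕ} {z : ℤ}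
    (h : (.cell ℓ' x', z) ∈ simSuccs code K (.cell ℓ x) a) (y : ℕ) :
    ∃ z', (.cell ℓ' y, z') ∈ simSuccs code K (.cell ℓ y) a := by
  rw [simSuccs] at h ⊢
  split at h
  · rw [List.mem_singleton, Prod.mk.injEq] at h
    by_cases hx : a = x + 2 <;> simp [hx] at h
  · rename_i ha
    rw [if_neg ha]
    rcases hI : code[ℓ]? with _ | I
    · simp [hI] at h
    · simp only [hI, Option.map_some, Option.getD_some] at h ⊢
      cases I with
      | inc c =>
        simp only [instrSuccs, List.mem_singleton, Prod.mk.injEq, SimState.cell.injEq] at h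
        exact ⟨_, by rw [h.1.1, instrSuccs]; exact List.mem_cons_self⟩
      | jz c t =>
        rw [instrSuccs] at h ⊢
        split_ifs at h ⊢ with h0
        all_goals
          simp only [List.mem_cons, List.not_mem_nil, or_false, Prod.mk.injEq, SimState.cell.injEq,
            reduceCtorEq, false_and] at h
          exact ⟨_, by rw [h.1.1]; exact List.mem_cons_self⟩
      | halt b =>
        simp only [instrSuccs, List.mem_singleton, Prod.mk.injEq] at h
        by_cases hx : b = false ∧ x = 0 <;> simp [hx] at h

namespace Simulates

variable (S : G.Simulates code K e α)
include S

theorem exists_min_isSucc_of_mem [Finite Q] (hl : G.IsLimitedObservation) {t : ℕ} {a : A} {q : Q}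
    {x : ℕ} (hx : x < 2 * (K + 1)) {z : ℤ}
    (hz : (e q, z) ∈ simSuccs code K (.cell (run code t).1 x) (α a)) :
    ∃ f, G.IsSucc (confFun code K e t) a f ∧ q ∈ f.supp ∧
      ∀ r v, f r = some v → IsLeast (G.stepValues (confFun code K e t) a r) v := by
  have hobs : (confFun code K e t).supp ∈ G.Obs := by
    obtain ⟨p, hp⟩ := S.exists_cell t (x := 0) (by omega)
    obtain ⟨o, ho, hpo⟩ := G.exists_obs p
    convert ho using 1
    ext r
    rw [mem_supp_confFun, S.mem_obs o ho p hpo, hp, SimState.obs_eq_cell]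
  obtain ⟨o, ho, hqo, hsub⟩ := hl.exists_obs_subset hobs (S.mem_post.2 ⟨x, hx, z, hz⟩)
  obtain ⟨f, hf, rfl, hmin⟩ := exists_min_isSucc ho hsub
  exact ⟨f, hf, hqo, hmin⟩

theorem exists_coe_le_of_isLeast {t : ℕ} {a : A} {q : Q} {v : WithTop ℤ}
    (hv : IsLeast (G.stepValues (confFun code K e t) a q) v) {x : ℕ} (hx : x < 2 * (K + 1)) {z : ℤ}
    (hz : (e q, z) ∈ simSuccs code K (.cell (run code t).1 x) (α a)) :
    ∃ u : ℤ, v = u ∧ u ≤ laneVal (timed code K t) x + z := by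
  obtain ⟨y, -, z', -, rfl⟩ := S.mem_stepValues.1 hv.1
  exact ⟨_, rfl, by exact_mod_cast hv.2 (S.mem_stepValues.2 ⟨x, hx, z, hz, rfl⟩)⟩

/-- A move to `lose` with a finite value. -/
theorem adam_lose [Finite Q] (hl : G.IsLimitedObservation) {t : ℕ} {x : List (A × WFun Q)}
    (hx : G.Traced code K e t x) (hlast : G.lastFun x = confFun code K e t) {a : A} {y : ℕ}
    (hy : y < 2 * (K + 1)) {z : ℤ}
    (hz : (.lose, z) ∈ simSuccs code K (.cell (run code t).1 y) (α a)) :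
    ∃ x', G.assocGame.Δ x a x' ∧ G.assocGame.AdamForceIn 1 x' := by
  obtain ⟨q, hq⟩ := (S.valid_iff .lose).1 trivial
  rw [← hq] at hz
  obtain ⟨f, hf, hqf, hmin⟩ := S.exists_min_isSucc_of_mem hl hy hz
  obtain ⟨v, hv⟩ := WFun.mem_supp.1 hqf
  obtain ⟨u, rfl, -⟩ := S.exists_coe_le_of_isLeast (hmin q v hv) hy hz
  rw [← hlast] at hf
  have hpos := isPosition_cons hx.1 (S.not_mem_of_confFun hx hlast) hf
  refine ⟨_, assocGame_Δ_cons hx.1 (S.not_mem_of_confFun hx hlast) hf,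
    S.adamForceIn_lose hpos (S.fresh_of_sink hx (ℓ := (run code t).1) ?_ hqf (Or.inr hq)) hv hq⟩
  intro q hq
  rw [hlast] at hq
  exact mem_supp_confFun.1 hq

/-- Adam never needs `+∞`. A claim sends the claimed finite lane to `lose`, a wrong answer permits a
return with negative value, and after a right answer the least successor is the next configuration.
-/
theorem adam_step [Finite Q] (hl : G.IsLimitedObservation) {t : ℕ} {x : List (A × WFun Q)}
    (hx : G.Traced code K e t x) (hlast : G.lastFun x = confFun code K e t)
    (hh : ∀ b, code[(run code t).1]? ≠ some (.halt b)) (a : A) :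
    ∃ x', G.assocGame.Δ x a x' ∧ (G.assocGame.AdamForceIn 1 x' ∨
      G.Traced code K e (t + 1) x' ∧ G.lastFun x' = confFun code K e (t + 1)) := by
  have ht := S.not_mem_of_confFun hx hlast
  by_cases ha : 2 ≤ α a
  · have hlt := (S.act_iff _).2 ⟨a, rfl⟩
    obtain ⟨x', h1, h2⟩ := S.adam_lose hl hx hlast (a := a) (y := α a - 2) (z := 0) (by omega)
      (by simp [simSuccs, ha])
    exact ⟨x', h1, Or.inl h2⟩
  by_cases hr : RightAction code t (α a)
  · have hsuc := fun y => succs_of_rightAction (x := y) S.validCode hr hh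
    obtain ⟨z, hz⟩ := (hsuc 0).2
    obtain ⟨q, hq⟩ := S.exists_cell (t + 1) (x := 0) (by omega)
    rw [← hq] at hz
    obtain ⟨f, hf, hqf, hmin⟩ := S.exists_min_isSucc_of_mem hl (by omega) hz
    have hs := S.supp_iff_cell hf.1 hqf hq
    rw [← hlast] at hf
    have hpos := isPosition_cons hx.1 ht hf
    refine ⟨_, assocGame_Δ_cons hx.1 ht hf, Or.inr ⟨traced_cons hx hlast hpos, ?_⟩⟩
    funext r
    change f r = _
    rcases h : f r with _ | v
    · symm
      by_contra hn
      obtain ⟨v, hv⟩ := Option.ne_none_iff_exists'.1 hn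
      obtain ⟨y, hy, -⟩ := confFun_eq_some.1 hv
      exact (hs r).2 ⟨y, hy⟩ h
    · obtain ⟨y, hy⟩ := (hs r).1 (WFun.mem_supp.2 ⟨_, h⟩)
      symm
      rw [confFun_eq_some]
      refine ⟨y, hy, ?_⟩
      obtain ⟨y', -, z', hz', rfl⟩ := S.mem_stepValues.1 (hmin r v h).1
      rw [hy] at hz'
      rcases (hsuc y').1 _ hz' with ⟨h2, -⟩ | ⟨h2, h3⟩
      · cases h2
      · simp only [SimState.cell.injEq, true_and] at h2
        subst h2
        rw [h3]
  · obtain ⟨y, hy, z, hz, hneg⟩ := succs_of_not_rightAction S.validCode (by omega) hr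
    rw [← S.init] at hz
    obtain ⟨f, hf, hqf, hmin⟩ := S.exists_min_isSucc_of_mem hl hy hz
    obtain ⟨v, hv⟩ := WFun.mem_supp.1 hqf
    obtain ⟨u, rfl, hu⟩ := S.exists_coe_le_of_isLeast (hmin _ v hv) hy hz
    have hs : f.supp = {G.init} := by
      ext q
      rw [S.mem_supp hf.1 hqf, Set.mem_singleton_iff, S.init, SimState.obs_eq_init, ← S.init,
        S.injective.eq_iff]
    rw [← hlast] at hf
    have hpos := isPosition_cons hx.1 ht hf
    refine ⟨_, assocGame_Δ_cons hx.1 ht hf, Or.inl (Or.inl ⟨hpos, G.initFun,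
      initFun_mem_earlierFuns _ _, ⟨hs.trans supp_initFun.symm, ?_⟩, G.init, ?_, ?_⟩)⟩
    · intro q v v' hv' hv''
      obtain ⟨rfl, rfl⟩ := initFun_eq_some.1 hv''
      change f G.init = some v at hv'
      rw [hv] at hv'
      cases hv'
      have : u + 1 ≤ 0 := by omega
      exact_mod_cast this
    · rw [supp_initFun]
      rfl
    · rw [initFun_eq_some.2 ⟨rfl, rfl⟩]
      simp

/-- Whatever Eve plays, some lane with finite value leads to `lose`: lane `0` for an answer, the
claimed lane for a claim. -/
theorem adam_halt [Finite Q] (hl : G.IsLimitedObservation) {t : ℕ} {x : List (A × WFun Q)}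
    (hx : G.Traced code K e t x) (hlast : G.lastFun x = confFun code K e t)
    (hh : code[(run code t).1]? = some (.halt false)) : G.assocGame.AdamForceIn 2 x := by
  have h : ∀ a, ∃ x', G.assocGame.Δ x a x' ∧ G.assocGame.AdamForceIn 1 x' := by
    intro a
    by_cases ha : 2 ≤ α a
    · have hlt := (S.act_iff _).2 ⟨a, rfl⟩
      exact S.adam_lose hl hx hlast (a := a) (y := α a - 2) (z := 0) (by omega)
        (by simp [simSuccs, ha])
    · exact S.adam_lose hl hx hlast (a := a) (y := 0) (z := 0) (by omega)
        (by simp [simSuccs, ha, hh, instrSuccs])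
  choose m hm using h
  exact Or.inr ⟨S.not_mem_of_confFun hx hlast, m, hm⟩

theorem adam_start [Finite Q] (a : A) :
    ∃ x, G.assocGame.Δ [] a x ∧ G.Traced code K e 0 x ∧ G.lastFun x = confFun code K e 0 := by
  obtain ⟨q, hq⟩ := S.exists_cell 0 (x := 0) (by omega)
  have hsuc : ∀ {r}, (∃ y, e r = .cell 0 y) → (G.init, a, r) ∈ G.Δ ∧ G.w (G.init, a, r) = 0 := by
    rintro r ⟨y, hr⟩
    have h : (e r, 0) ∈ simSuccs code K (e G.init) (α a) := by
      rw [hr, S.init]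
      simpa [simSuccs] using S.lt_of_cell hr
    exact ⟨(S.mem_Δ _ _ _).2 ⟨0, h⟩, S.weight _ _ _ _ h⟩
  obtain ⟨o, ho, hqo⟩ := G.exists_obs q
  have hcell : ∀ r ∈ o, ∃ y, e r = .cell 0 y := by
    intro r hr
    rwa [S.mem_obs o ho q hqo, hq, SimState.obs_eq_cell] at hr
  obtain ⟨f, hf, rfl, hmin⟩ := exists_min_isSucc (G := G) (f := G.initFun) (a := a) ho fun r hr =>
    ⟨G.init, by rw [supp_initFun]; rfl, (hsuc (hcell r hr)).1⟩
  have hf' : G.IsSucc (G.lastFun []) a f := hf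
  have hpos := isPosition_cons (x := []) trivial nil_not_mem hf'
  refine ⟨_, assocGame_Δ_cons (x := []) trivial nil_not_mem hf', ⟨hpos, fun g hg => Or.inl (by
    simpa [earlierFuns, lastFun] using hg)⟩, ?_⟩
  funext r
  change f r = _
  rcases h : f r with _ | v
  · symm
    by_contra hn
    obtain ⟨v, hv⟩ := Option.ne_none_iff_exists'.1 hn
    obtain ⟨y, hy, -⟩ := confFun_eq_some.1 hv
    exact (S.supp_iff_cell hf.1 hqo hq r).2 ⟨y, hy⟩ h
  · have hr := hcell r (WFun.mem_supp.2 ⟨_, h⟩)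
    obtain ⟨p, u, h2, h3, rfl⟩ := (hmin r v h).1
    obtain ⟨rfl, rfl⟩ := initFun_eq_some.1 h3
    obtain ⟨y, hy⟩ := hr
    symm
    rw [confFun_eq_some]
    refine ⟨y, hy, ?_⟩
    rw [(hsuc ⟨y, hy⟩).2]
    simp [timed, run, laneVal]

/-- If the code halts with `false`, then Adam wins. -/
theorem exists_adamForceIn [Finite Q] (hl : G.IsLimitedObservation) (h : HaltsWith code false) :
    ∃ N, G.assocGame.AdamForceIn N [] := by
  obtain ⟨T, hT⟩ := h
  have key : ∀ n t, T ≤ t + n → ∀ x : List (A × WFun Q), G.Traced code K e t x →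
      G.lastFun x = confFun code K e t → G.assocGame.AdamForceIn (n + 2) x := by
    intro n
    induction n with
    | zero =>
      intro t ht x hx hlast
      exact S.adam_halt hl hx hlast (by rw [run_eq_of_halt hT (by omega)]; exact hT)
    | succ n ih =>
      intro t ht x hx hlast
      by_cases hh : ∃ b, code[(run code t).1]? = some (.halt b)
      · obtain ⟨b, hb⟩ := hh
        obtain rfl : b = false := HaltsWith.unique ⟨t, hb⟩ ⟨T, hT⟩
        exact ReachGame.AdamForceIn.mono (S.adam_halt hl hx hlast hb) (by omega)
      · push Not at hh
        choose m hm1 hm2 using S.adam_step hl hx hlast hh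
        refine Or.inr ⟨S.not_mem_of_confFun hx hlast, m, fun a => ⟨hm1 a, ?_⟩⟩
        rcases hm2 a with h | ⟨h1, h2⟩
        · exact ReachGame.AdamForceIn.mono h (by omega)
        · exact ih (t + 1) (by omega) _ h1 h2
  choose m hm1 hm2 hm3 using S.adam_start
  exact ⟨T + 3, Or.inr ⟨nil_not_mem, m, fun a => ⟨hm1 a, key T 0 (by omega) _ (hm2 a) (hm3 a)⟩⟩⟩

/-- Adam's reply from `adam_step` to Eve's forcing action must be a faithful one, as otherwise both
players could force a win. Forcing is well founded, so the simulation reaches a halting location,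
and there the answer `false` is excluded in the same way. -/
theorem haltsWith_of_eveForce [Finite Q] (hl : G.IsLimitedObservation)
    {x : List (A × WFun Q)} (h : G.assocGame.EveForce x) :
    (x = [] ∨ ∃ t, G.Traced code K e t x ∧ G.lastFun x = confFun code K e t) →
      HaltsWith code true := by
  induction h with
  | terminal h =>
    rintro (rfl | ⟨t, hx, hlast⟩)
    · exact absurd (Or.inl h) nil_not_mem
    · exact absurd (Or.inl h) (S.not_mem_of_confFun hx hlast)
  | move a ht hs ih =>
    rintro (rfl | ⟨t, hx, hlast⟩)
    · obtain ⟨x', h1, h2⟩ := S.adam_start a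
      exact ih x' h1 (Or.inr ⟨0, h2⟩)
    · have hno := ReachGame.not_eveForce_and_adamForce disjoint_TE_TA (.move a ht hs)
      by_cases hh : ∃ b, code[(run code t).1]? = some (.halt b)
      · obtain ⟨b, hb⟩ := hh
        cases b with
        | true => exact ⟨t, hb⟩
        | false => exact absurd (S.adam_halt hl hx hlast hb).adamForce hno
      · push Not at hh
        obtain ⟨x', h1, h2⟩ := S.adam_step hl hx hlast hh a
        rcases h2 with h2 | h2
        · exact absurd h2.adamForce
            (ReachGame.not_eveForce_and_adamForce disjoint_TE_TA (hs x' h1))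
        · exact ih x' h1 (Or.inr ⟨t + 1, h2⟩)

theorem haltsWith_of_adamForce {x : List (A × WFun Q)} (h : G.assocGame.AdamForce x) :
    (x = [] ∨ ∃ t, G.Traced code K e t x ∧ G.lastFun x = confFun code K e t) →
      HaltsWith code false := by
  induction h with
  | terminal h =>
    rintro (rfl | ⟨t, hx, hlast⟩)
    · exact absurd (Or.inr h) nil_not_mem
    · exact absurd (Or.inr h) (S.not_mem_of_confFun hx hlast)
  | move m ht hs hf ih =>
    have hex : ∀ x' , G.assocGame.AdamForce x' → ¬ ∃ N, G.assocGame.EveForceIn N x' :=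
      fun x' h' ⟨N, hN⟩ => ReachGame.not_eveForce_and_adamForce disjoint_TE_TA hN.eveForce h'
    rintro (rfl | ⟨t, hx, hlast⟩)
    · obtain ⟨a, -⟩ := (S.act_iff 0).1 (by omega)
      rcases S.eve_start (hs a) with h2 | h2
      · exact absurd ⟨2, h2⟩ (hex _ (hf a))
      · exact ih a (Or.inr ⟨0, h2⟩)
    · by_cases hh : ∃ b, code[(run code t).1]? = some (.halt b)
      · obtain ⟨b, hb⟩ := hh
        cases b with
        | false => exact ⟨t, hb⟩
        | true => exact absurd ⟨2, S.eve_halt hx hlast hb⟩ (hex _ (.move m ht hs hf))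
      · push Not at hh
        obtain ⟨a', ha'⟩ := exists_rightAction code t
        obtain ⟨a, rfl⟩ := (S.act_iff a').1 (by have := ha'.1; omega)
        rcases S.eve_step hx hlast hh ha' (hs a) with h2 | h2
        · exact absurd ⟨2, h2⟩ (hex _ (hf a))
        · exact ih a (Or.inr ⟨t + 1, h2⟩)

theorem eveWins_iff [Finite Q] (hl : G.IsLimitedObservation) :
    G.assocGame.EveWins ↔ HaltsWith code true := by
  constructor
  · exact fun h => S.haltsWith_of_eveForce hl h.eveForce (Or.inl rfl)
  · intro h
    obtain ⟨a, -⟩ := (S.act_iff 0).1 (by omega)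
    have : Nonempty A := ⟨a⟩
    obtain ⟨N, hN⟩ := S.exists_eveForceIn h
    exact ReachGame.EveForceIn.eveWins hN

theorem adamWins_iff [Finite Q] (hl : G.IsLimitedObservation) :
    G.assocGame.AdamWins ↔ HaltsWith code false := by
  constructor
  · exact fun h => S.haltsWith_of_adamForce h.adamForce (Or.inl rfl)
  · intro h
    obtain ⟨N, hN⟩ := S.exists_adamForceIn hl h
    exact ReachGame.AdamForceIn.adamWins hN fun h' hh' ht => exists_assocGame_Δ hl h' hh' ht

/-- The simulating game has limited observation. -/
theorem isLimitedObservation : G.IsLimitedObservation := by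
  constructor
  · obtain ⟨o, ho, hi⟩ := G.exists_obs G.init
    convert ho using 1
    ext q
    rw [S.mem_obs o ho _ hi, S.init, SimState.obs_eq_init, ← S.init, S.injective.eq_iff,
      Set.mem_singleton_iff]
  · intro o ho a
    refine ⟨{o' | o' ∈ G.Obs ∧ o' ⊆ G.post a o}, fun o' h => h.1, Set.Subset.antisymm ?_ ?_⟩
    swap
    · exact Set.sUnion_subset fun o' h => h.2
    rintro q' ⟨q, hq, hqq⟩
    obtain ⟨o', ho', hqo'⟩ := G.exists_obs q'
    refine ⟨o', ⟨ho', fun r hr => ?_⟩, hqo'⟩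
    rw [S.mem_obs o' ho' q' hqo'] at hr
    by_cases hcell : ∃ ℓ y, e q' = .cell ℓ y
    · obtain ⟨ℓ', y, hy⟩ := hcell
      rw [hy, SimState.obs_eq_cell] at hr
      obtain ⟨y', hy'⟩ := hr
      obtain ⟨z, hz⟩ := (S.mem_Δ _ _ _).1 hqq
      rw [hy] at hz
      rcases hs : e q with _ | _ | _ | ⟨ℓ, x⟩
      · refine ⟨q, hq, (S.mem_Δ _ _ _).2 ⟨0, ?_⟩⟩
        rw [hs, simSuccs, List.mem_map] at hz ⊢
        obtain ⟨u, hu, h⟩ := hz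
        simp only [Prod.mk.injEq, SimState.cell.injEq] at h
        exact ⟨y', List.mem_range.2 (S.lt_of_cell hy'), by rw [hy', h.1.1]⟩
      · simp [hs, simSuccs] at hz
      · simp [hs, simSuccs] at hz
      · rw [hs] at hz
        obtain ⟨p, hp⟩ := (S.valid_iff (.cell ℓ y')).1
          ⟨((S.valid_iff _).2 ⟨q, hs⟩ : SimState.Valid _ _ (.cell ℓ x)).1, S.lt_of_cell hy'⟩
        refine ⟨p, (S.mem_obs o ho q hq p).2 (by rw [hp, hs]; rfl), (S.mem_Δ _ _ _).2 ?_⟩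
        rw [hp, hy']
        exact exists_mem_simSuccs_cell hz y'
    · have : r = q' := by
        apply S.injective
        rcases hs : e q' with _ | _ | _ | ⟨ℓ, x⟩
        · rwa [hs, SimState.obs_eq_init] at hr
        · rwa [hs, SimState.obs_eq_win] at hr
        · rwa [hs, SimState.obs_eq_lose] at hr
        · exact absurd ⟨ℓ, x, hs⟩ hcell
      exact this ▸ ⟨q, hq, hqq⟩

end Simulates

end MPG

/-! ## Stack programs and polynomial time -/

namespace StackMachine

/-- Structured programs for five stacks of bits; `loop k p` is: while stack `k` is not empty, pop a
bit `b` and do `p b`. -/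
inductive SProg
  | push (k : Fin 5) (l : List Bool)
  | seq (p q : SProg)
  | loop (k : Fin 5) (p : Bool → SProg)

/-- Flat instructions: push some bits and go to `t`; pop a bit and go to `t b` if it is `b`, and to
`e` if the stack is empty. -/
inductive SInstr
  | push (k : Fin 5) (l : List Bool) (t : ℕ)
  | pop (k : Fin 5) (t : Bool → ℕ) (e : ℕ)

/-- The contents of the stacks. -/
abbrev Stacks := Fin 5 → List Bool

/-- The effect of an instruction. -/
def SInstr.exec : SInstr → Stacks → ℕ × Stacks
  | push k l t, S => (t, Function.update S k (l ++ S k))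
  | pop k t e, S =>
    match S k with
    | [] => (e, S)
    | b :: r => (t b, Function.update S k r)

/-- `n` steps lead from the first configuration to the second one. -/
inductive ReachIn (code : List SInstr) : ℕ → ℕ × Stacks → ℕ × Stacks → Prop
  | refl {c} : ReachIn code 0 c c
  | step {n ℓ S I c} : code[ℓ]? = some I → ReachIn code n (I.exec S) c →
      ReachIn code (n + 1) (ℓ, S) c

theorem ReachIn.trans {code : List SInstr} {n m : ℕ} {c c' c'' : ℕ × Stacks}
    (h : ReachIn code n c c') (h' : ReachIn code m c' c'') : ReachIn code (n + m) c c'' := by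
  induction h with
  | refl => simpa using h'
  | step hI _ ih =>
    rw [add_right_comm]
    exact .step hI (ih h')

namespace SProg

/-- The program transforms the first stacks into the second ones in the given time. -/
inductive Run : SProg → Stacks → ℕ → Stacks → Prop
  | push {k l S} : Run (push k l) S 1 (Function.update S k (l ++ S k))
  | seq {p q S n S' n' S''} : Run p S n S' → Run q S' n' S'' → Run (seq p q) S (n + n') S''
  | loop_nil {k p S} : S k = [] → Run (loop k p) S 1 S
  | loop_cons {k p S b r n S' n' S''} : S k = b :: r → Run (p b) (Function.update S k r) n S' →
      Run (loop k p) S' n' S'' → Run (loop k p) S (n + n' + 2) S''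

/-- The number of instructions of the compiled program. -/
def size : SProg → ℕ
  | push _ _ => 1
  | seq p q => p.size + q.size
  | loop _ p => (p false).size + (p true).size + 3

/-- The compiled program. -/
def compile : SProg → ℕ → List SInstr
  | push k l, i => [.push k l (i + 1)]
  | seq p q, i => p.compile i ++ q.compile (i + p.size)
  | loop k p, i =>
    .pop k (fun b => bif b then i + (p false).size + 2 else i + 1)
        (i + (p false).size + (p true).size + 3) ::
      ((p false).compile (i + 1) ++ (.push 0 [] i ::
        ((p true).compile (i + (p false).size + 2) ++ [.push 0 [] i])))

theorem length_compile (p : SProg) (i : ℕ) : (p.compile i).length = p.size := by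
  induction p generalizing i with
  | push k l => rfl
  | seq p q hp hq => simp [compile, size, hp, hq]
  | loop k p hp => simp [compile, size, hp]; omega

/-- The list `l` occurs in `code` at position `i`. -/
def OccursAt (code l : List SInstr) (i : ℕ) : Prop :=
  ∀ j I, l[j]? = some I → code[i + j]? = some I

theorem OccursAt.append {code l l' : List SInstr} {i : ℕ} (h : OccursAt code (l ++ l') i) :
    OccursAt code l i ∧ OccursAt code l' (i + l.length) := by
  refine ⟨fun j I hj => h j I ?_, fun j I hj => ?_⟩
  · rw [List.getElem?_append_left, hj]
    exact (List.getElem?_eq_some_iff.1 hj).1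
  · rw [add_assoc]
    refine h _ I ?_
    rw [List.getElem?_append_right (by omega), ← hj]
    congr 1
    omega

theorem OccursAt.cons {code l : List SInstr} {I : SInstr} {i : ℕ} (h : OccursAt code (I :: l) i) :
    code[i]? = some I ∧ OccursAt code l (i + 1) := by
  refine ⟨h 0 I rfl, fun j J hj => ?_⟩
  rw [add_right_comm, add_assoc]
  exact h (j + 1) J hj

/-- The two extra steps of a loop round are the pop and the jump back, which is a push of the empty
word. -/
theorem Run.reachIn {p : SProg} {S S' : Stacks} {n : ℕ} (h : p.Run S n S') {code : List SInstr}
    {i : ℕ} (hc : OccursAt code (p.compile i) i) : ReachIn code n (i, S) (i + p.size, S') := by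
  induction h generalizing i with
  | push => exact .step hc.cons.1 .refl
  | seq _ _ hp hq =>
    have h := hc.append
    rw [length_compile] at h
    rw [size, ← add_assoc]
    exact (hp h.1).trans (hq h.2)
  | @loop_nil k p S h0 =>
    refine .step hc.cons.1 ?_
    rw [SInstr.exec, h0, size, ← add_assoc, ← add_assoc]
    exact .refl
  | @loop_cons k p S b r n S' n' S'' h0 _ _ hp hl =>
    have h := hc.cons
    have hf := h.2.append
    have hg := hf.2.cons
    have ht := hg.2.append
    rw [length_compile] at hg ht
    have hlast := ht.2.cons.1
    rw [length_compile] at hlast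
    have hu : ∀ S : Stacks, Function.update S 0 ([] ++ S 0) = S := fun S => by simp
    rw [show n + n' + 2 = (n + (1 + n')) + 1 by ring]
    refine .step h.1 ?_
    rw [SInstr.exec, h0]
    dsimp only
    cases b with
    | false =>
      refine (hp hf.1).trans ?_
      rw [add_comm 1]
      refine .step hg.1 ?_
      rw [SInstr.exec, hu]
      exact hl hc
    | true =>
      rw [show i + 1 + (p false).size + 1 = i + (p false).size + 2 by ring] at ht hlast
      refine (hp ht.1).trans ?_
      rw [add_comm 1]
      refine .step hlast ?_
      rw [SInstr.exec, hu]
      exact hl hc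

end SProg

/-- Pushes bits. -/
def pushStmt {Λ : Type} (k : Fin 5) : List Bool →
    Turing.TM2.Stmt (fun _ : Fin 5 => Bool) Λ (Option Bool) →
    Turing.TM2.Stmt (fun _ : Fin 5 => Bool) Λ (Option Bool)
  | [], q => q
  | b :: l, q => pushStmt k l (.push k (fun _ => b) q)

theorem stepAux_pushStmt {Λ : Type} (k : Fin 5) (l : List Bool)
    (q : Turing.TM2.Stmt (fun _ : Fin 5 => Bool) Λ (Option Bool)) (v : Option Bool) (S : Stacks) :
    Turing.TM2.stepAux (pushStmt k l q) v S =
      Turing.TM2.stepAux q v (Function.update S k (l ++ S k)) := by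
  induction l generalizing q with
  | nil => simp [pushStmt]
  | cons b l ih =>
    rw [pushStmt, ih, Turing.TM2.stepAux]
    simp

/-- The statement for an instruction; `none` is the end of the code. -/
def toStmt (N : ℕ) : Option SInstr →
    Turing.TM2.Stmt (fun _ : Fin 5 => Bool) (Fin (N + 1)) (Option Bool)
  | none => .halt
  | some (.push k l t) => pushStmt k l (.goto fun _ => Fin.ofNat (N + 1) t)
  | some (.pop k t e) => .pop k (fun _ b => b) (.branch (fun v => v == some true)
      (.load (fun _ => none) (.goto fun _ => Fin.ofNat (N + 1) (t true)))
      (.branch (fun v => v == some false)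
        (.load (fun _ => none) (.goto fun _ => Fin.ofNat (N + 1) (t false)))
        (.load (fun _ => none) (.goto fun _ => Fin.ofNat (N + 1) e))))

/-- The machine that executes a code: stack `0` is the input stack, stack `4` the output stack. -/
def toFinTM2 (code : List SInstr) : Turing.FinTM2 where
  K := Fin 5
  k₀ := 0
  k₁ := 4
  Γ _ := Bool
  Λ := Fin (code.length + 1)
  main := 0
  σ := Option Bool
  initialState := none
  Γk₀Fin := inferInstanceAs (Fintype Bool)
  m ℓ := toStmt code.length code[(ℓ : ℕ)]?

/-- The configuration of the machine. -/
def toCfg (code : List SInstr) (c : ℕ × Stacks) : (toFinTM2 code).Cfg :=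
  (⟨some (Fin.ofNat (code.length + 1) c.1), none, c.2⟩ :
    Turing.TM2.Cfg (fun _ : Fin 5 => Bool) (Fin (code.length + 1)) (Option Bool))

/-- The internal memory holds a popped bit only during one machine step and is reset to `none`, so
configurations need not record it. -/
theorem step_toCfg {code : List SInstr} {ℓ : ℕ} {S : Stacks} {I : SInstr}
    (h : code[ℓ]? = some I) : (toFinTM2 code).step (toCfg code (ℓ, S)) =
      some (toCfg code (I.exec S)) := by
  have hℓ : (ℓ : ℕ) % (code.length + 1) = ℓ :=
    Nat.mod_eq_of_lt (by have := (List.getElem?_eq_some_iff.1 h).1; omega)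
  have h1 : (toFinTM2 code).step (toCfg code (ℓ, S)) = some (Turing.TM2.stepAux
      (toStmt code.length (code[ℓ % (code.length + 1)]?)) none S) := rfl
  rw [h1, hℓ, h]
  congr 1
  cases I with
  | push k l t => rw [toStmt, stepAux_pushStmt]; rfl
  | pop k t e =>
    rw [SInstr.exec]
    rcases hk : S k with _ | ⟨b, r⟩
    · have hu : Function.update S k [] = S := by rw [← hk, Function.update_eq_self]
      simp [toStmt, hk, hu, toCfg]
    · cases b <;> simp [toStmt, hk, toCfg]

theorem ReachIn.iterate {code : List SInstr} {n : ℕ} {c c' : ℕ × Stacks}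
    (h : ReachIn code n c c') : (flip Bind.bind (toFinTM2 code).step)^[n] (some (toCfg code c)) =
      some (toCfg code c') := by
  induction h with
  | refl => rfl
  | step hI _ ih =>
    rw [Function.iterate_succ_apply, ← ih]
    congr 1
    exact step_toCfg hI

/-- The stacks as a list. -/
def st (a b c d e : List Bool) : Stacks := ![a, b, c, d, e]

/-- A program that transforms the input into the output in polynomial time shows computability in
polynomial time. -/
theorem polyTimeComputable_of_run {α β : Type} {codeα : α → List Bool} {codeβ : β → List Bool}
    {f : α → β} (p : SProg) (C : Polynomial ℕ)
    (h : ∀ x, ∃ n ≤ C.eval (codeα x).length,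
      p.Run (st (codeα x) [] [] [] []) n (st [] [] [] [] (codeβ (f x)))) :
    PolyTimeComputable codeα codeβ f := by
  classical
  choose n hn hrun using h
  set code := p.compile 0 with hcode
  -- The additional step in the time bound executes `halt` at the label behind the code.
  refine ⟨{ tm := toFinTM2 code, inputAlphabet := Equiv.refl Bool, outputAlphabet := Equiv.refl Bool,
            time := C + 1, outputsFun := fun x => ⟨⟨n x + 1, ?_⟩, ?_⟩ }⟩
  · have h1 := ((hrun x).reachIn (code := code) (i := 0) (fun j I hj => by rwa [zero_add])).iterate
    rw [Function.iterate_succ_apply']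
    have h2 : Turing.initList (toFinTM2 code) (List.map (Equiv.refl Bool).invFun (codeα x)) =
        toCfg code (0, st (codeα x) [] [] [] []) := by
      have : ∀ k : Fin 5, (Turing.initList (toFinTM2 code)
          (List.map (Equiv.refl Bool).invFun (codeα x))).stk k =
          st (codeα x) [] [] [] [] k := by
        intro k
        fin_cases k
        · exact List.map_id _
        all_goals rfl
      have h3 : (Turing.initList (toFinTM2 code)
          (List.map (Equiv.refl Bool).invFun (codeα x))).stk = st (codeα x) [] [] [] [] :=
        funext this
      rw [toCfg, ← h3]
      rfl
    rw [h2]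
    refine (congrArg _ h1).trans ?_
    have h4 : (0 + p.size) % (code.length + 1) = code.length := by
      rw [hcode, SProg.length_compile, zero_add, Nat.mod_eq_of_lt (by omega)]
    have h5 : (flip Bind.bind (toFinTM2 code).step)
        (some (toCfg code (0 + p.size, st [] [] [] [] (codeβ (f x))))) =
        some (Turing.TM2.stepAux (toStmt code.length (code[(0 + p.size) % (code.length + 1)]?)) none
          (st [] [] [] [] (codeβ (f x)))) := rfl
    rw [h5, h4, List.getElem?_eq_none le_rfl]
    have h6 : ∀ k : Fin 5, (Turing.haltList (toFinTM2 code)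
        (List.map (Equiv.refl Bool).invFun (codeβ (f x)))).stk k =
        st [] [] [] [] (codeβ (f x)) k := by
      intro k
      fin_cases k
      all_goals first | rfl | exact List.map_id _
    rw [← show _ = st [] [] [] [] (codeβ (f x)) from funext h6]
    rfl
  · have := hn x
    simp
    omega

/-! ### Writing numbers -/

theorem update_st_zero (a b c d e x : List Bool) :
    Function.update (st a b c d e) 0 x = st x b c d e := by
  funext k; fin_cases k <;> rfl

theorem update_st_one (a b c d e x : List Bool) :
    Function.update (st a b c d e) 1 x = st a x c d e := by
  funext k; fin_cases k <;> rfl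

theorem update_st_two (a b c d e x : List Bool) :
    Function.update (st a b c d e) 2 x = st a b x d e := by
  funext k; fin_cases k <;> rfl

theorem update_st_three (a b c d e x : List Bool) :
    Function.update (st a b c d e) 3 x = st a b c x e := by
  funext k; fin_cases k <;> rfl

theorem update_st_four (a b c d e x : List Bool) :
    Function.update (st a b c d e) 4 x = st a b c d x := by
  funext k; fin_cases k <;> rfl

theorem SProg.Run.of_eq {p : SProg} {S S' S'' : Stacks} {n n' : ℕ} (h : p.Run S n S')
    (hn : n = n') (hS : S' = S'') : p.Run S n' S'' := hn ▸ hS ▸ h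

open SProg

/-- Numbers `α + β * i`, given by the pairs `(α, β)`. -/
abbrev Template := List (ℕ × ℕ)

/-- The numbers for a given `i`. -/
def Template.nats (t : Template) (i : ℕ) : List ℕ := t.map fun p => p.1 + p.2 * i

/-- A template for each bit and one for the end of the word. -/
structure Pass where
  body : Bool → Template
  last : Template

/-- The numbers for a word: for the bit in position `i` the template for this bit is taken at
`i`. -/
def Pass.nats (P : Pass) : ℕ → List Bool → List ℕ
  | i, [] => P.last.nats i
  | i, b :: w => (P.body b).nats i ++ P.nats (i + 1) w

/-- Writes the number `α + β * i`, where `i` is the height of stack `1`. -/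
def emitNum (p : ℕ × ℕ) : SProg :=
  .seq (.loop 1 fun b => .seq (.push 2 [b]) (.push 3 (List.replicate p.2 true)))
    (.seq (.loop 2 fun b => .push 1 [b]) (.push 3 (false :: List.replicate p.1 true)))

/-- Writes the numbers of a template. -/
def emit (t : Template) : SProg := t.foldr (fun p q => .seq (emitNum p) q) (.push 0 [])

/-- Writes the numbers of a pass for the word in stack `0`. -/
def emitPass (P : Pass) : SProg :=
  .seq (.loop 0 fun b => .seq (emit (P.body b)) (.push 1 [b]))
    (.seq (emit P.last) (.loop 1 fun b => .push 0 [b]))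

/-- Writes the numbers of some passes, and puts the result on the output stack. -/
def emitAll (Ps : List Pass) : SProg :=
  .seq (Ps.foldr (fun P q => .seq (emitPass P) q) (.push 0 []))
    (.seq (.loop 0 fun _ => .push 0 []) (.loop 3 fun b => .push 4 [b]))

/-- The height of stack `1` is a unary counter: each popped bit writes `β` units and is kept on
stack `2`. -/
theorem run_loop_one (β : ℕ) (a b c d e : List Bool) :
    (loop 1 fun b => .seq (.push 2 [b]) (.push 3 (List.replicate β true))).Run (st a b c d e)
      (4 * b.length + 1) (st a [] (b.reverse ++ c) (List.replicate (β * b.length) true ++ d) e) := by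
  induction b generalizing c d with
  | nil => simpa using Run.loop_nil rfl
  | cons x b ih =>
    refine (Run.loop_cons (b := x) (r := b) (n' := 4 * b.length + 1) rfl (.seq .push .push) ?_).of_eq ?_ rfl
    · rw [update_st_one, update_st_two, update_st_three]
      refine (ih (x :: c) (List.replicate β true ++ d)).of_eq rfl ?_
      congr 1
      · simp
      · rw [List.length_cons, mul_add_one, ← List.append_assoc, List.replicate_append_replicate]
    · simp
      ring

theorem run_move_two_one (a b c d e : List Bool) :
    (loop 2 fun b => .push 1 [b]).Run (st a b c d e) (3 * c.length + 1)
      (st a (c.reverse ++ b) [] d e) := by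
  induction c generalizing b with
  | nil => simpa using Run.loop_nil rfl
  | cons x c ih =>
    refine (Run.loop_cons (b := x) (r := c) (n' := 3 * c.length + 1) rfl .push ?_).of_eq ?_ rfl
    · rw [update_st_two, update_st_one]
      exact (ih (x :: b)).of_eq rfl (by simp)
    · simp
      ring

theorem run_move_one_zero (a b c d e : List Bool) :
    (loop 1 fun b => .push 0 [b]).Run (st a b c d e) (3 * b.length + 1)
      (st (b.reverse ++ a) [] c d e) := by
  induction b generalizing a with
  | nil => simpa using Run.loop_nil rfl
  | cons x b ih =>
    refine (Run.loop_cons (b := x) (r := b) (n' := 3 * b.length + 1) rfl .push ?_).of_eq ?_ rfl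
    · rw [update_st_one, update_st_zero]
      exact (ih (x :: a)).of_eq rfl (by simp)
    · simp
      ring

theorem run_move_three_four (a b c d e : List Bool) :
    (loop 3 fun b => .push 4 [b]).Run (st a b c d e) (3 * d.length + 1)
      (st a b c [] (d.reverse ++ e)) := by
  induction d generalizing e with
  | nil => simpa using Run.loop_nil rfl
  | cons x d ih =>
    refine (Run.loop_cons (b := x) (r := d) (n' := 3 * d.length + 1) rfl .push ?_).of_eq ?_ rfl
    · rw [update_st_three, update_st_four]
      exact (ih (x :: e)).of_eq rfl (by simp)
    · simp
      ring

theorem run_clear_zero (a b c d e : List Bool) :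
    (loop 0 fun _ => .push 0 []).Run (st a b c d e) (3 * a.length + 1) (st [] b c d e) := by
  induction a with
  | nil => simpa using Run.loop_nil rfl
  | cons x a ih =>
    refine (Run.loop_cons (b := x) (r := a) (n' := 3 * a.length + 1) rfl .push ?_).of_eq ?_ rfl
    · rw [update_st_zero, update_st_zero]
      exact ih
    · simp
      ring

/-- Stack `3` collects the output backwards, so the end marker comes on top of the units. Stack `1`
is restored and stack `2` is empty again. -/
theorem run_emitNum (p : ℕ × ℕ) (a b d : List Bool) :
    (emitNum p).Run (st a b [] d []) (7 * b.length + 3)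
      (st a b [] ((natsToWord [p.1 + p.2 * b.length]).reverse ++ d) []) := by
  refine (Run.seq (run_loop_one p.2 a b [] d []) (.seq (run_move_two_one _ _ _ _ _)
    .push)).of_eq ?_ ?_
  · simp
    ring
  · rw [update_st_three]
    congr 1
    · simp
    · change _ ++ (List.replicate (p.2 * b.length) true ++ d) = _
      simp [natsToWord, ← List.append_assoc, List.replicate_append_replicate]

theorem natsToWord_append (l l' : List ℕ) :
    natsToWord (l ++ l') = natsToWord l ++ natsToWord l' := List.flatMap_append

theorem natsToWord_cons (n : ℕ) (l : List ℕ) :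
    natsToWord (n :: l) = natsToWord [n] ++ natsToWord l := natsToWord_append [n] l

theorem run_emit (t : Template) (a b d : List Bool) :
    (emit t).Run (st a b [] d []) (t.length * (7 * b.length + 3) + 1)
      (st a b [] ((natsToWord (t.nats b.length)).reverse ++ d) []) := by
  induction t generalizing d with
  | nil =>
    refine Run.push.of_eq (by simp) ?_
    rw [update_st_zero]
    rfl
  | cons p t ih =>
    refine (Run.seq (run_emitNum p a b d) (ih _)).of_eq ?_ ?_
    · rw [List.length_cons]
      ring
    · have : Template.nats (p :: t) b.length = (p.1 + p.2 * b.length) :: Template.nats t b.length :=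
        rfl
      rw [this, natsToWord_cons _ (Template.nats t b.length), List.reverse_append, List.append_assoc]

/-- The maximal length of a template. -/
def Pass.size (P : Pass) : ℕ := (P.body false).length + (P.body true).length + P.last.length

theorem Pass.length_body_le (P : Pass) (b : Bool) : (P.body b).length ≤ P.size := by
  cases b <;> simp only [Pass.size] <;> omega

/-- The processed bits are moved to stack `1`, whose height is thus the position in the word. The
last template is included in the induction because it is evaluated at the final height. -/
theorem run_passLoop (P : Pass) {M N : ℕ} (hM : P.size ≤ M) (w b d : List Bool)
    (hN : b.length + w.length ≤ N) : ∃ n ≤ w.length * (M * (7 * N + 3) + 4) + M * (7 * N + 3) + 2,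
    (SProg.seq (.loop 0 fun b => .seq (emit (P.body b)) (.push 1 [b])) (emit P.last)).Run
      (st w b [] d []) n (st [] (w.reverse ++ b) []
        ((natsToWord (P.nats b.length w)).reverse ++ d) []) := by
  induction w generalizing b d with
  | nil =>
    refine ⟨_, ?_, Run.seq (.loop_nil rfl) (run_emit P.last _ _ _)⟩
    have h1 : P.last.length ≤ M := le_trans (by simp only [Pass.size]; omega) hM
    have h2 : 7 * b.length + 3 ≤ 7 * N + 3 := by simp at hN; omega
    have := Nat.mul_le_mul h1 h2
    simp
    omega
  | cons x w ih =>
    have hl : (x :: b).length = b.length + 1 := rfl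
    obtain ⟨n, hn, h⟩ := ih (x :: b) ((natsToWord ((P.body x).nats b.length)).reverse ++ d)
      (by simp at hN ⊢; omega)
    -- The run for the rest is split into loop and last template, so that the round for `x` can be
    -- put in front of the loop.
    cases h with
    | @seq _ _ _ n1 S' n2 _ h1 h2 =>
      have h3 := run_emit (P.body x) w b d
      rw [← update_st_zero (x :: w)] at h3
      rw [← update_st_one w b] at h1
      refine ⟨_, ?_, Run.seq (.loop_cons (b := x) (r := w) rfl (.seq h3 .push) h1)
        (h2.of_eq rfl ?_)⟩
      · have h4 := (P.length_body_le x).trans hM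
        have h5 : 7 * b.length + 3 ≤ 7 * N + 3 := by simp at hN; omega
        have := Nat.mul_le_mul h4 h5
        rw [List.length_cons, add_mul]
        omega
      · rw [hl, Pass.nats, natsToWord_append]
        simp

/-- Moving stack `1` back to stack `0` restores the word, so that the next pass can read it. -/
theorem run_emitPass (P : Pass) {M : ℕ} (hM : P.size ≤ M) (w d : List Bool) :
    ∃ n ≤ (w.length + 1) * (M * (7 * w.length + 3) + 7), (emitPass P).Run (st w [] [] d []) n
      (st w [] [] ((natsToWord (P.nats 0 w)).reverse ++ d) []) := by
  obtain ⟨n, hn, h⟩ := run_passLoop P hM w [] d (N := w.length) (by simp)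
  cases h with
  | seq h1 h2 =>
    refine ⟨_, ?_, Run.seq h1 (.seq h2 ((run_move_one_zero _ _ _ _ _).of_eq rfl ?_))⟩
    · simp only [List.append_nil, List.length_reverse, add_mul, one_mul, mul_add] at hn ⊢
      omega
    · simp

/-- The numbers of some passes. -/
def passesNats (Ps : List Pass) (w : List Bool) : List ℕ := Ps.flatMap fun P => P.nats 0 w

theorem run_emitPasses (Ps : List Pass) {M : ℕ} (hM : ∀ P ∈ Ps, P.size ≤ M) (w d : List Bool) :
    ∃ n ≤ Ps.length * ((w.length + 1) * (M * (7 * w.length + 3) + 7)) + 1,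
      (Ps.foldr (fun P q => SProg.seq (emitPass P) q) (.push 0 [])).Run (st w [] [] d []) n
        (st w [] [] ((natsToWord (passesNats Ps w)).reverse ++ d) []) := by
  induction Ps generalizing d with
  | nil =>
    refine ⟨1, by simp, Run.push.of_eq rfl ?_⟩
    rw [update_st_zero]
    rfl
  | cons P Ps ih =>
    obtain ⟨n, hn, h⟩ := run_emitPass P (hM P List.mem_cons_self) w d
    obtain ⟨n', hn', h'⟩ := ih (fun P hP => hM P (List.mem_cons_of_mem _ hP))
      ((natsToWord (P.nats 0 w)).reverse ++ d)
    refine ⟨_, ?_, (Run.seq h h').of_eq rfl ?_⟩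
    · rw [List.length_cons, add_mul]
      omega
    · have : passesNats (P :: Ps) w = P.nats 0 w ++ passesNats Ps w := List.flatMap_cons
      rw [this, natsToWord_append, List.reverse_append, List.append_assoc]

/-- The largest coefficients. -/
def Template.height (t : Template) : ℕ := (t.map fun p => p.1 + p.2 + 1).sum

theorem length_natsToWord_nats (t : Template) (i : ℕ) :
    (natsToWord (t.nats i)).length ≤ t.height * (i + 1) := by
  induction t with
  | nil => simp [natsToWord, Template.nats]
  | cons p t ih =>
    rw [Template.nats, List.map_cons, natsToWord_cons, List.length_append, Template.height,
      List.map_cons, List.sum_cons, add_mul]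
    refine Nat.add_le_add ?_ ih
    simp [natsToWord]
    nlinarith [Nat.zero_le (p.1 * i)]

/-- A bound for the coefficients of a pass. -/
def Pass.height (P : Pass) : ℕ :=
  (P.body false).height + (P.body true).height + P.last.height

theorem length_natsToWord_passNats (P : Pass) (w : List Bool) (i N : ℕ) (hN : i + w.length ≤ N) :
    (natsToWord (P.nats i w)).length ≤ P.height * (N + 1) * (w.length + 1) := by
  induction w generalizing i with
  | nil =>
    refine (length_natsToWord_nats _ _).trans ?_
    simp only [List.length_nil, zero_add, mul_one]
    exact Nat.mul_le_mul (by simp only [Pass.height]; omega) (by simp at hN; omega)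
  | cons b w ih =>
    rw [Pass.nats, natsToWord_append, List.length_append, List.length_cons, mul_add_one, add_comm]
    simp only [List.length_cons] at hN
    refine Nat.add_le_add (ih _ (by omega)) ((length_natsToWord_nats _ _).trans ?_)
    exact Nat.mul_le_mul (by cases b <;> simp only [Pass.height] <;> omega) (by omega)

/-- The length of the result enters the running time through the final transfer to the output stack.
-/
theorem length_natsToWord_passesNats (Ps : List Pass) (w : List Bool) :
    (natsToWord (passesNats Ps w)).length ≤
      (Ps.map Pass.height).sum * (w.length + 1) * (w.length + 1) := by
  induction Ps with
  | nil => simp [passesNats, natsToWord]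
  | cons P Ps ih =>
    rw [passesNats, List.flatMap_cons, natsToWord_append, List.length_append, List.map_cons,
      List.sum_cons, add_mul, add_mul]
    exact Nat.add_le_add (length_natsToWord_passNats P w 0 _ (by simp)) ih

/-- Functions that are given by templates are computable in polynomial time. -/
theorem polyTimeComputable_passesNats {α β : Type} {codeα : α → List Bool}
    {codeβ : β → List Bool} {f : α → β} (Ps : List Pass)
    (h : ∀ x, codeβ (f x) = natsToWord (passesNats Ps (codeα x))) :
    PolyTimeComputable codeα codeβ f := by
  set M := (Ps.map Pass.size).sum with hM
  set H := (Ps.map Pass.height).sum with hH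
  refine polyTimeComputable_of_run (emitAll Ps)
    (Polynomial.C Ps.length * ((Polynomial.X + 1) * (Polynomial.C M * (7 * Polynomial.X + 3) + 7)) +
      3 * Polynomial.X + 3 * (Polynomial.C H * (Polynomial.X + 1) * (Polynomial.X + 1)) + 3)
    fun x => ?_
  obtain ⟨n, hn, hr⟩ := run_emitPasses Ps (M := M)
    (fun P hP => List.single_le_sum (by simp) _ (List.mem_map_of_mem hP)) (codeα x) []
  refine ⟨_, ?_, Run.seq hr (.seq (run_clear_zero _ _ _ _ _)
    ((run_move_three_four _ _ _ _ _).of_eq rfl ?_))⟩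
  · have := length_natsToWord_passesNats Ps (codeα x)
    simp only [Polynomial.eval_add, Polynomial.eval_mul, Polynomial.eval_C, Polynomial.eval_X,
      Polynomial.eval_one, Polynomial.eval_ofNat, List.append_nil, List.length_reverse]
    rw [← hH] at this
    omega
  · simp [h]

end StackMachine

/-! ## The code of the simulating game -/

namespace SimState

/-- The states as numbers; there are `L` lanes. -/
def num (L : ℕ) : SimState → ℕ
  | init => 0
  | win => 1
  | lose => 2
  | cell ℓ x => 3 + L * ℓ + x

/-- The state with a given number. -/
def ofNum (L : ℕ) : ℕ → SimState
  | 0 => init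
  | 1 => win
  | 2 => lose
  | n + 3 => cell (n / L) (n % L)

theorem ofNum_num {K m : ℕ} {s : SimState} (h : s.Valid m K) :
    ofNum (2 * (K + 1)) (s.num (2 * (K + 1))) = s := by
  cases s with
  | cell ℓ x =>
    rw [num, show 3 + 2 * (K + 1) * ℓ + x = (2 * (K + 1) * ℓ + x) + 3 by ring, ofNum]
    rw [Nat.mul_add_mod, Nat.mod_eq_of_lt h.2, Nat.mul_add_div (by omega), Nat.div_eq_of_lt h.2,
      add_zero]
  | _ => rfl

theorem num_lt {K m : ℕ} {s : SimState} (h : s.Valid m K) :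
    s.num (2 * (K + 1)) < 2 * (K + 1) * m + 3 := by
  cases s with
  | cell ℓ x =>
    have h1 := Nat.mul_le_mul_left (2 * (K + 1)) (Nat.succ_le_of_lt h.1)
    have h2 := h.2
    rw [num]
    generalize 2 * (K + 1) = L at *
    rw [Nat.mul_succ] at h1
    omega
  | _ => simp [num]

theorem valid_ofNum {K m n : ℕ} (h : n < 2 * (K + 1) * m + 3) :
    (ofNum (2 * (K + 1)) n).Valid m K := by
  rcases n with _ | _ | _ | n
  · trivial
  · trivial
  · trivial
  · exact ⟨Nat.div_lt_of_lt_mul (by omega), Nat.mod_lt _ (by omega)⟩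

theorem num_ofNum {K n : ℕ} : (ofNum (2 * (K + 1)) n).num (2 * (K + 1)) = n := by
  rcases n with _ | _ | _ | n
  · rfl
  · rfl
  · rfl
  · rw [ofNum, num, add_assoc, Nat.div_add_mod, add_comm]

end SimState

/-! ### The transition list of the simulating game is well formed. -/

theorem simSuccs_ne_nil {code : List Instr} {K : ℕ} {s : SimState}
    (hs : s.Valid code.length K) (a : ℕ) : simSuccs code K s a ≠ [] := by
  cases s with
  | cell ℓ x =>
    rw [simSuccs]
    split
    · simp
    · rw [List.getElem?_eq_getElem hs.1, Option.map_some, Option.getD_some]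
      cases code[ℓ]'hs.1 with
      | jz c t => rw [instrSuccs]; split <;> simp
      | _ => simp [instrSuccs]
  | _ => simp [simSuccs]

theorem valid_of_mem_simSuccs {code : List Instr} {K : ℕ} (hc : ValidCode code K) {s : SimState}
    (hs : s.Valid code.length K) {a : ℕ} {p : SimState × ℤ} (h : p ∈ simSuccs code K s a) :
    p.1.Valid code.length K := by
  cases s with
  | init =>
    simp only [simSuccs, List.mem_map, List.mem_range] at h
    obtain ⟨x, hx, rfl⟩ := h
    exact ⟨List.length_pos_iff.2 hc.1, hx⟩
  | win => simp only [simSuccs, List.mem_singleton] at h; subst h; trivial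
  | lose => simp only [simSuccs, List.mem_singleton] at h; subst h; trivial
  | cell ℓ x =>
    rw [simSuccs] at h
    split at h
    · rw [List.mem_singleton] at h
      subst h
      dsimp only
      split <;> trivial
    · have hI := List.getElem?_eq_getElem hs.1
      obtain ⟨hv, hl⟩ := hc.2 _ _ hI
      rw [hI, Option.map_some, Option.getD_some] at h
      generalize code[ℓ]'hs.1 = I at hv hl h
      cases I with
      | inc c =>
        simp only [instrSuccs, List.mem_singleton] at h
        subst h
        exact ⟨hl.resolve_right (by simp), hs.2⟩
      | jz c t =>
        have hl := hl.resolve_right (by simp)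
        simp only [instrSuccs] at h
        split_ifs at h <;> simp only [List.mem_cons, List.not_mem_nil, or_false] at h
        · rcases h with rfl | rfl
          exacts [⟨hv.2, hs.2⟩, trivial]
        · subst h
          exact ⟨hv.2, hs.2⟩
        · rcases h with rfl | rfl
          exacts [⟨hl, hs.2⟩, trivial]
        · subst h
          exact ⟨hl, hs.2⟩
      | halt b =>
        simp only [instrSuccs, List.mem_singleton] at h
        subst h
        dsimp only
        split <;> trivial

theorem simSuccs_unique {code : List Instr} {K : ℕ} {s s' : SimState} {a : ℕ} {z z' : ℤ}
    (h : (s', z) ∈ simSuccs code K s a) (h' : (s', z') ∈ simSuccs code K s a) : z = z' := by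
  cases s with
  | init =>
    simp only [simSuccs, List.mem_map, Prod.mk.injEq] at h h'
    obtain ⟨x, -, -, rfl⟩ := h
    obtain ⟨x', -, -, rfl⟩ := h'
    rfl
  | win => simp [simSuccs] at h h'; rw [h.2, h'.2]
  | lose => simp [simSuccs] at h h'; rw [h.2, h'.2]
  | cell ℓ x =>
    rw [simSuccs] at h h'
    split at h
    · rename_i ha
      rw [if_pos ha] at h'
      rw [List.mem_singleton, Prod.mk.injEq] at h h'
      rw [h.2, h'.2]
    · rename_i ha
      rw [if_neg ha] at h'
      rcases hI : code[ℓ]? with _ | I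
      · simp [hI] at h
      · simp only [hI, Option.map_some, Option.getD_some] at h h'
        cases I with
        | inc c =>
          simp only [instrSuccs, List.mem_singleton, Prod.mk.injEq] at h h'
          rw [h.2, h'.2]
        | jz c t =>
          simp only [instrSuccs] at h h'
          split_ifs at h h' <;>
            simp only [List.mem_cons, List.not_mem_nil, or_false, Prod.mk.injEq] at h h'
          all_goals
            cases s' <;> simp_all
        | halt b =>
          simp only [instrSuccs, List.mem_singleton, Prod.mk.injEq] at h h'
          rw [h.2, h'.2]

/-- The transitions of the simulating game. -/
def simTrans (code : List Instr) (K : ℕ) : List (Fin (2 * (K + 1) * code.length + 3) ×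
    Fin (2 * (K + 1) + 2) × Fin (2 * (K + 1) * code.length + 3) × ℤ) :=
  (List.finRange _).flatMap fun q : Fin (2 * (K + 1) * code.length + 3) =>
    (List.finRange _).flatMap fun a : Fin (2 * (K + 1) + 2) =>
    (simSuccs code K (SimState.ofNum (2 * (K + 1)) q) a).map fun p =>
      (q, a, Fin.ofNat _ (p.1.num (2 * (K + 1))), p.2)

theorem mem_simTrans {code : List Instr} {K : ℕ} (hc : ValidCode code K)
    {q : Fin (2 * (K + 1) * code.length + 3)} {a : Fin (2 * (K + 1) + 2)}
    {q' : Fin (2 * (K + 1) * code.length + 3)} {z : ℤ} :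
    (q, a, q', z) ∈ simTrans code K ↔
      (SimState.ofNum (2 * (K + 1)) q', z) ∈
        simSuccs code K (SimState.ofNum (2 * (K + 1)) q) a := by
  simp only [simTrans, List.mem_flatMap, List.mem_finRange, true_and, List.mem_map,
    Prod.mk.injEq]
  constructor
  · rintro ⟨q, a, ⟨s, z⟩, h1, rfl, rfl, rfl, rfl⟩
    have hs : s.Valid code.length K := valid_of_mem_simSuccs hc (SimState.valid_ofNum q.2) h1
    simp only [Fin.ofNat, Nat.mod_eq_of_lt (SimState.num_lt hs)]
    rwa [SimState.ofNum_num hs]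
  · intro h
    refine ⟨q, a, _, h, rfl, rfl, ?_, rfl⟩
    apply Fin.ext
    simp only [Fin.ofNat, SimState.num_ofNum]
    exact Nat.mod_eq_of_lt q'.2

/-- The code of the game that simulates a counter machine. -/
def simGameCode (code : List Instr) (K : ℕ) (hc : ValidCode code K) : GameCode where
  numStates := 2 * (K + 1) * code.length + 3
  numActions := 2 * (K + 1) + 2
  numActions_pos := by omega
  init := 0
  label q := (SimState.ofNum (2 * (K + 1)) q).obs
  trans := simTrans code K
  weight_unique _ _ _ _ _ h h' := simSuccs_unique ((mem_simTrans hc).1 h) ((mem_simTrans hc).1 h')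
  trans_total q a := by
    obtain ⟨p, hp⟩ := List.exists_mem_of_ne_nil _
      (simSuccs_ne_nil (SimState.valid_ofNum q.2) a)
    have hs := valid_of_mem_simSuccs hc (SimState.valid_ofNum q.2) hp
    refine ⟨⟨_, SimState.num_lt hs⟩, p.2, (mem_simTrans hc).2 ?_⟩
    rwa [SimState.ofNum_num hs]

theorem simulates_simGameCode {code : List Instr} {K : ℕ} (hc : ValidCode code K) :
    (simGameCode code K hc).toMPG.Simulates code K
      (fun q => SimState.ofNum (2 * (K + 1)) q) (fun a => a) where
  validCode := hc
  injective q q' h := by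
    have := congrArg (SimState.num (2 * (K + 1))) h
    rw [SimState.num_ofNum, SimState.num_ofNum] at this
    exact Fin.ext this
  valid_iff s := by
    constructor
    · exact fun h => ⟨⟨_, SimState.num_lt h⟩, SimState.ofNum_num h⟩
    · rintro ⟨q, rfl⟩
      exact SimState.valid_ofNum q.2
  init := rfl
  act_iff n := ⟨fun h => ⟨⟨n, h⟩, rfl⟩, by rintro ⟨a, rfl⟩; exact a.2⟩
  mem_obs := by
    rintro _ ⟨q0, rfl⟩ q hq q'
    have hq : (SimState.ofNum (2 * (K + 1)) q).obs = (SimState.ofNum (2 * (K + 1)) q0).obs := hq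
    rw [hq]
    rfl
  mem_Δ q a q' := by
    rw [GameCode.mem_toMPG_Δ]
    exact exists_congr fun z => mem_simTrans hc
  weight q a q' z h := (simGameCode code K hc).toMPG_w ((mem_simTrans hc).2 h)

theorem isLimitedObservation_simGameCode {code : List Instr} {K : ℕ} (hc : ValidCode code K) :
    (simGameCode code K hc).toMPG.IsLimitedObservation :=
  (simulates_simGameCode hc).isLimitedObservation

/-- The simulating game. -/
def simGame (code : List Instr) (K : ℕ) (hc : ValidCode code K) : LimObsGame :=
  ⟨simGameCode code K hc, isLimitedObservation_simGameCode hc⟩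

theorem simGame_eveWins {code : List Instr} {K : ℕ} (hc : ValidCode code K) :
    (simGame code K hc).game.assocGame.EveWins ↔ HaltsWith code true :=
  (simulates_simGameCode hc).eveWins_iff (isLimitedObservation_simGameCode hc)

theorem simGame_adamWins {code : List Instr} {K : ℕ} (hc : ValidCode code K) :
    (simGame code K hc).game.assocGame.AdamWins ↔ HaltsWith code false :=
  (simulates_simGameCode hc).adamWins_iff (isLimitedObservation_simGameCode hc)

open StackMachine

/-! ### The code words of the simulating games -/

/-- The concatenation of the lists `F ℓ I` for the instructions of the code; the first one is at
location `ℓ`. -/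
def concatFrom {γ : Type} (F : ℕ → Instr → List γ) : ℕ → List Instr → List γ
  | _, [] => []
  | ℓ, I :: code => F ℓ I ++ concatFrom F (ℓ + 1) code

theorem concatFrom_append {γ : Type} (F : ℕ → Instr → List γ) (ℓ : ℕ) (c c' : List Instr) :
    concatFrom F ℓ (c ++ c') = concatFrom F ℓ c ++ concatFrom F (ℓ + c.length) c' := by
  induction c generalizing ℓ with
  | nil => rfl
  | cons I c ih =>
    rw [List.cons_append, concatFrom, ih, concatFrom, List.append_assoc, List.length_cons,
      add_assoc, add_comm 1]

theorem flatMap_range_eq_concatFrom {γ : Type} (F : ℕ → Instr → List γ) (G : ℕ → List γ)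
    (code : List Instr) (h : ∀ ℓ I, code[ℓ]? = some I → G ℓ = F ℓ I) :
    (List.range code.length).flatMap G = concatFrom F 0 code := by
  induction code using List.reverseRecOn with
  | nil => rfl
  | append_singleton code I ih =>
    rw [List.length_append, List.length_singleton, List.range_succ, List.flatMap_append, ih,
      concatFrom_append, List.flatMap_singleton, zero_add, h code.length I (by simp)]
    · rw [concatFrom, concatFrom, List.append_nil]
    · intro ℓ J hJ
      refine h ℓ J ?_
      rw [List.getElem?_append_left, hJ]
      exact (List.getElem?_eq_some_iff.1 hJ).1

theorem flatMap_concatFrom {γ δ : Type} (F : ℕ → Instr → List γ) (g : γ → List δ) (ℓ : ℕ)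
    (c : List Instr) :
    (concatFrom F ℓ c).flatMap g = concatFrom (fun ℓ I => (F ℓ I).flatMap g) ℓ c := by
  induction c generalizing ℓ with
  | nil => rfl
  | cons I c ih => rw [concatFrom, concatFrom, List.flatMap_append, ih]

theorem flatMap_range_split {γ : Type} (f : ℕ → List γ) (L m : ℕ) :
    (List.range (L * m + 3)).flatMap f = f 0 ++ f 1 ++ f 2 ++
      (List.range m).flatMap fun ℓ => (List.range L).flatMap fun x => f (3 + L * ℓ + x) := by
  induction m with
  | zero => simp [List.range_succ]
  | succ m ih =>
    rw [List.range_succ (n := m), List.flatMap_append, List.flatMap_singleton, ← List.append_assoc,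
      ← ih, show L * (m + 1) + 3 = (3 + L * m) + L by ring, List.range_add, List.flatMap_append,
      add_comm 3, List.flatMap_map]

theorem flatMap_finRange_val {γ : Type} (n : ℕ) (f : ℕ → List γ) :
    ((List.finRange n).flatMap fun i : Fin n => f i) = (List.range n).flatMap f := by
  rw [← List.map_coe_finRange_eq_range, List.flatMap_map]

/-- The transitions from a state, as rows of states and numbers. -/
def simRows (code : List Instr) (K : ℕ) (s : SimState) : List (SimState × ℕ × SimState × ℤ) :=
  (List.range (2 * (K + 1) + 2)).flatMap fun a => (simSuccs code K s a).map fun p =>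
    (s, a, p.1, p.2)

/-- The numbers of a row. -/
def rowNats (L : ℕ) (r : SimState × ℕ × SimState × ℤ) : List ℕ :=
  [r.1.num L, r.2.1, r.2.2.1.num L, r.2.2.2.toNat, (-r.2.2.2).toNat]

/-- The rows for a location with the instruction `I`. -/
def instrRows (K ℓ : ℕ) (I : Instr) : List (SimState × ℕ × SimState × ℤ) :=
  (List.range (2 * (K + 1))).flatMap fun x => (List.range (2 * (K + 1) + 2)).flatMap fun a =>
    (if 2 ≤ a then [(if a = x + 2 then .lose else .win, 0)] else instrSuccs K I ℓ x a).map fun p =>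
      (.cell ℓ x, a, p.1, p.2)

/-- The rows for the initial state and the sinks. -/
def specialRows (K : ℕ) : List (SimState × ℕ × SimState × ℤ) :=
  simRows [] K .init ++ simRows [] K .win ++ simRows [] K .lose

/-- All rows. -/
def allRows (K : ℕ) (code : List Instr) : List (SimState × ℕ × SimState × ℤ) :=
  specialRows K ++ concatFrom (instrRows K) 0 code

/-- The rows of the initial state and the sinks do not depend on the code; the others are grouped by
location. -/
theorem flatMap_simRows {γ : Type} (code : List Instr) (K : ℕ)
    (g : SimState × ℕ × SimState × ℤ → List γ) :
    ((List.range (2 * (K + 1) * code.length + 3)).flatMap fun q =>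
      (simRows code K (SimState.ofNum (2 * (K + 1)) q)).flatMap g) =
    (allRows K code).flatMap g := by
  rw [flatMap_range_split, allRows, specialRows, List.flatMap_append, List.flatMap_append,
    List.flatMap_append, flatMap_concatFrom]
  refine congrArg₂ _ rfl (flatMap_range_eq_concatFrom _ _ _ fun ℓ I hI => ?_)
  rw [instrRows, List.flatMap_assoc]
  refine List.flatMap_congr fun x hx => ?_
  have h := SimState.ofNum_num (K := K) (m := ℓ + 1) (s := .cell ℓ x)
    ⟨by omega, List.mem_range.1 hx⟩
  rw [SimState.num] at h
  rw [h, simRows]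
  simp only [simSuccs, hI, Option.map_some, Option.getD_some]

theorem flatMap_simTrans {γ : Type} {code : List Instr} {K : ℕ} (hc : ValidCode code K)
    (G : ℕ → ℕ → ℕ → ℤ → List γ) :
    ((simTrans code K).flatMap fun t => G t.1 t.2.1 t.2.2.1 t.2.2.2) =
      (allRows K code).flatMap fun r =>
        G (r.1.num (2 * (K + 1))) r.2.1 (r.2.2.1.num (2 * (K + 1))) r.2.2.2 := by
  rw [← flatMap_simRows, ← flatMap_finRange_val, simTrans, List.flatMap_assoc]
  refine List.flatMap_congr fun q _ => ?_
  rw [simRows, List.flatMap_assoc, List.flatMap_assoc, ← flatMap_finRange_val]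
  refine List.flatMap_congr fun a _ => ?_
  rw [List.flatMap_map, List.flatMap_map]
  refine List.flatMap_congr fun p hp => ?_
  have hs := valid_of_mem_simSuccs hc (SimState.valid_ofNum q.2) hp
  dsimp only
  rw [SimState.num_ofNum]
  congr 1
  exact Nat.mod_eq_of_lt (SimState.num_lt hs)

theorem length_simTrans {code : List Instr} {K : ℕ} (hc : ValidCode code K) :
    (simTrans code K).length = (allRows K code).length := by
  simpa using congrArg List.length (flatMap_simTrans hc fun _ _ _ _ => [()])

theorem toNats_simGameCode {code : List Instr} {K : ℕ} (hc : ValidCode code K) :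
    (simGameCode code K hc).toNats =
      [2 * (K + 1) * code.length + 3, 2 * (K + 1) + 2, 0, 0, 1, 2] ++
        concatFrom (fun ℓ _ => List.replicate (2 * (K + 1)) (ℓ + 3)) 0 code ++
        [(allRows K code).length] ++ (allRows K code).flatMap (rowNats (2 * (K + 1))) := by
  have h1 : List.ofFn (simGameCode code K hc).label = [0, 1, 2] ++
      concatFrom (fun ℓ _ => List.replicate (2 * (K + 1)) (ℓ + 3)) 0 code := by
    have h2 : (List.finRange _).flatMap (fun q : Fin (2 * (K + 1) * code.length + 3) =>
        [(SimState.ofNum (2 * (K + 1)) q).obs]) = [0, 1, 2] ++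
      concatFrom (fun ℓ _ => List.replicate (2 * (K + 1)) (ℓ + 3)) 0 code := by
      rw [flatMap_finRange_val _ (fun q => [(SimState.ofNum (2 * (K + 1)) q).obs]),
        flatMap_range_split]
      refine congrArg₂ _ rfl (flatMap_range_eq_concatFrom _ _ _ fun ℓ I hI => ?_)
      rw [List.eq_replicate_iff]
      constructor
      · simp
      · intro b hb
        simp only [List.mem_flatMap, List.mem_range, List.mem_singleton] at hb
        obtain ⟨x, hx, rfl⟩ := hb
        have h := SimState.ofNum_num (K := K) (m := ℓ + 1) (s := .cell ℓ x) ⟨by omega, hx⟩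
        rw [SimState.num] at h
        rw [h]
        rfl
    rw [← h2, List.ofFn_eq_map, List.map_eq_flatMap]
    rfl
  rw [GameCode.toNats, h1]
  have h3 := flatMap_simTrans hc fun n a n' z => [n, a, n', z.toNat, (-z).toNat]
  have h4 : (simGameCode code K hc).trans.flatMap (fun t =>
      [(t.1 : ℕ), (t.2.1 : ℕ), (t.2.2.1 : ℕ), t.2.2.2.toNat, (-t.2.2.2).toNat]) =
      (allRows K code).flatMap (rowNats (2 * (K + 1))) := h3
  rw [h4]
  have h5 : (simGameCode code K hc).trans.length = (allRows K code).length := length_simTrans hc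
  rw [h5]
  simp [simGameCode]

theorem Instr.Valid.shift {K m k n : ℕ} {I : Instr} (h : I.Valid K m) (hn : m + k ≤ n) :
    (I.shift k).Valid K n := by
  cases I with
  | inc c => exact h
  | jz c t => exact ⟨h.1, (Nat.add_lt_add_right (show t < m from h.2) k).trans_le hn⟩
  | halt b => trivial

theorem validCode_of_append_halt {code c : List Instr} {K : ℕ} {b : Bool}
    (hc : code = c ++ [.halt b]) (h : ∀ I ∈ code, I.Valid K code.length) : ValidCode code K := by
  refine ⟨by simp [hc], fun ℓ I hI => ⟨h I (List.mem_of_getElem? hI), ?_⟩⟩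
  by_cases hl : ℓ + 1 < code.length
  · exact Or.inl hl
  · right
    have h1 := (List.getElem?_eq_some_iff.1 hI).1
    have h2 : ℓ = c.length := by
      rw [hc] at h1 hl
      simp at h1 hl
      omega
    rw [hc, h2] at hI
    exact ⟨b, by simpa using hI.symm⟩

theorem validCode_wordCode {main : List Instr} {K : ℕ} (hK : 4 ≤ K)
    (hm : ∃ c, main = c ++ [.halt true]) (hv : ∀ I ∈ main, I.Valid K main.length)
    (w : List Bool) : ValidCode (wordCode main 0 w) K := by
  have h1 : ∀ w i, ∃ c, wordCode main i w = c ++ [.halt true] := by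
    obtain ⟨c, rfl⟩ := hm
    intro w
    induction w with
    | nil => exact fun i => ⟨c.map (Instr.shift (9 * i)), by simp [wordCode, Instr.shift]⟩
    | cons b w ih =>
      intro i
      obtain ⟨c', hc'⟩ := ih (i + 1)
      exact ⟨((digitProg b).compile 0).map (Instr.shift (9 * i)) ++ c', by
        rw [wordCode, hc', List.append_assoc]⟩
  have hpos : 0 < main.length := by
    obtain ⟨c, rfl⟩ := hm
    simp
  have h2 : ∀ w i, ∀ I ∈ wordCode main i w, I.Valid K (9 * i + (9 * w.length + main.length)) := by
    intro w
    induction w with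
    | nil =>
      intro i I hI
      rw [wordCode, List.mem_map] at hI
      obtain ⟨J, hJ, rfl⟩ := hI
      exact (hv J hJ).shift (by omega)
    | cons b w ih =>
      intro i I hI
      rw [wordCode, List.mem_append, List.mem_map] at hI
      rw [List.length_cons]
      rcases hI with ⟨J, hJ, rfl⟩ | hI
      · have := Prog.valid_of_mem_compile ((uses_digitProg b).mono hK) (by omega) hJ
        rw [size_digitProg] at this
        exact this.shift (by omega)
      · have := ih (i + 1) I hI
        rwa [show 9 * i + (9 * (w.length + 1) + main.length) =
          9 * (i + 1) + (9 * w.length + main.length) by ring]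
  obtain ⟨c, hc⟩ := h1 w 0
  refine validCode_of_append_halt hc ?_
  rw [length_wordCode]
  simpa using h2 w 0

/-! ### Templates for code words -/

namespace SimState

/-- The state with the location increased by `k`. -/
def shift (k : ℕ) : SimState → SimState
  | cell ℓ x => cell (ℓ + k) x
  | s => s

/-- The number of the state as a template; nine locations belong to each bit. -/
def tpl (L : ℕ) (s : SimState) : ℕ × ℕ :=
  (s.num L, match s with
    | cell _ _ => 9 * L
    | _ => 0)

theorem num_shift (L i : ℕ) (s : SimState) :
    (s.shift (9 * i)).num L = (s.tpl L).1 + (s.tpl L).2 * i := by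
  cases s with
  | cell ℓ x => simp only [shift, num, tpl]; ring
  | _ => simp [shift, num, tpl]

end SimState

/-- The row with the locations increased by `k`. -/
def shiftRow (k : ℕ) (r : SimState × ℕ × SimState × ℤ) : SimState × ℕ × SimState × ℤ :=
  (r.1.shift k, r.2.1, r.2.2.1.shift k, r.2.2.2)

/-- The numbers of a row as a template. -/
def rowTpl (L : ℕ) (r : SimState × ℕ × SimState × ℤ) : Template :=
  [r.1.tpl L, (r.2.1, 0), r.2.2.1.tpl L, (r.2.2.2.toNat, 0), ((-r.2.2.2).toNat, 0)]

theorem nats_rowTpl (L i : ℕ) (r : SimState × ℕ × SimState × ℤ) :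
    Template.nats (rowTpl L r) i = rowNats L (shiftRow (9 * i) r) := by
  simp [Template.nats, rowTpl, rowNats, shiftRow, SimState.num_shift]

theorem instrSuccs_shift (K k ℓ x a : ℕ) (I : Instr) :
    instrSuccs K (I.shift k) (ℓ + k) x a =
      (instrSuccs K I ℓ x a).map fun p => (p.1.shift k, p.2) := by
  cases I with
  | inc c => simp [instrSuccs, Instr.shift, SimState.shift, add_right_comm]
  | jz c t =>
    simp only [instrSuccs, Instr.shift]
    split_ifs <;> simp [SimState.shift, add_right_comm]
  | halt b =>
    simp only [instrSuccs, Instr.shift]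
    split_ifs <;> simp [SimState.shift]

/-- Locations are the only thing in a row that changes under relocation of the code, and they change
by a translation. -/
theorem instrRows_shift (K k ℓ : ℕ) (I : Instr) :
    instrRows K (ℓ + k) (I.shift k) = (instrRows K ℓ I).map (shiftRow k) := by
  simp only [instrRows, List.map_flatMap]
  refine List.flatMap_congr fun x _ => List.flatMap_congr fun a _ => ?_
  split_ifs
  · simp [shiftRow, SimState.shift]
  · simp [shiftRow, SimState.shift]
  · simp [instrSuccs_shift, shiftRow, SimState.shift]

theorem concatFrom_shift {γ δ : Type} {F : ℕ → Instr → List γ} {F' : ℕ → Instr → List δ}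
    {g : γ → δ} {k : ℕ} (h : ∀ ℓ I, (F ℓ I).map g = F' (ℓ + k) (I.shift k)) (ℓ : ℕ)
    (code : List Instr) :
    (concatFrom F ℓ code).map g = concatFrom F' (ℓ + k) (code.map (Instr.shift k)) := by
  induction code generalizing ℓ with
  | nil => rfl
  | cons I code ih =>
    rw [concatFrom, List.map_append, ih, List.map_cons, concatFrom, h, add_right_comm]

/-- The pass for the numbers that are given by the templates `F` for the instructions. -/
def codePass (F : ℕ → Instr → Template) (main : List Instr) (t : Template) : Pass where
  body b := concatFrom F 0 ((digitProg b).compile 0)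
  last := concatFrom F 0 main ++ t

/-- The block of bit `i` starts at location `9 * i`, so what it contributes is affine in `i` once
this holds for single instructions. -/
theorem nats_codePass {F : ℕ → Instr → Template} {F' : ℕ → Instr → List ℕ}
    (h : ∀ i ℓ I, (F ℓ I).nats i = F' (ℓ + 9 * i) (I.shift (9 * i))) (main : List Instr)
    (t : Template) (w : List Bool) (i : ℕ) : (codePass F main t).nats i w =
      concatFrom F' (9 * i) (wordCode main i w) ++ t.nats (i + w.length) := by
  have key : ∀ (i : ℕ) (c : List Instr), Template.nats (concatFrom F 0 c) i =
      concatFrom F' (9 * i) (c.map (Instr.shift (9 * i))) := by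
    intro i c
    have := concatFrom_shift (h i) 0 c
    rwa [zero_add] at this
  induction w generalizing i with
  | nil =>
    rw [Pass.nats, wordCode, ← key]
    simp [codePass, Template.nats]
  | cons b w ih =>
    rw [Pass.nats, ih, wordCode, concatFrom_append, ← key, List.length_map, Prog.length_compile,
      size_digitProg, List.length_cons, add_assoc i, add_comm 1, List.append_assoc, mul_add_one]
    rfl

theorem length_instrRows_inc (K ℓ c ℓ' c' : ℕ) :
    (instrRows K ℓ (.inc c)).length = (instrRows K ℓ' (.inc c')).length := by
  simp only [instrRows, List.length_flatMap, List.length_map, instrSuccs, apply_ite List.length,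
    List.length_singleton]

/-- The number of rows for a bit. -/
def digitRows (K : ℕ) : ℕ := (concatFrom (instrRows K) 0 ((digitProg true).compile 0)).length

/-- The two digit programs differ only in the register of the last increment, which does not affect
the number of rows. Hence the number of transitions is affine in the length of the word. -/
theorem length_digitRows (K : ℕ) (b : Bool) :
    (concatFrom (instrRows K) 0 ((digitProg b).compile 0)).length = digitRows K := by
  have h : ∀ b, (digitProg b).compile 0 = ((digitProg true).compile 0).take 8 ++
      [.inc (bif b then 1 else 3)] := fun b => by cases b <;> rfl
  rw [digitRows, h b, h true, concatFrom_append, concatFrom_append, List.length_append,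
    List.length_append]
  congr 1
  simp only [concatFrom, List.append_nil]
  exact length_instrRows_inc _ _ _ _ _

theorem length_concatFrom_instrRows (K : ℕ) (main : List Instr) (w : List Bool) (i : ℕ) :
    (concatFrom (instrRows K) (9 * i) (wordCode main i w)).length =
      (concatFrom (instrRows K) 0 main).length + digitRows K * w.length := by
  have key : ∀ (i : ℕ) (c : List Instr), (concatFrom (instrRows K) (9 * i)
      (c.map (Instr.shift (9 * i)))).length = (concatFrom (instrRows K) 0 c).length := by
    intro i c
    have := concatFrom_shift (F := instrRows K) (F' := instrRows K) (g := shiftRow (9 * i))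
      (k := 9 * i) (fun ℓ I => (instrRows_shift K _ ℓ I).symm) 0 c
    rw [zero_add] at this
    rw [← this, List.length_map]
  induction w generalizing i with
  | nil => rw [wordCode, key]; simp
  | cons b w ih =>
    rw [wordCode, concatFrom_append, List.length_append, key, length_digitRows, List.length_map,
      Prog.length_compile, size_digitProg, ← mul_add_one, ih, List.length_cons]
    ring

/-- The passes that write the code of the simulating game. -/
def gamePasses (main : List Instr) (K : ℕ) : List Pass :=
  [⟨fun _ => [], [(2 * (K + 1) * main.length + 3, 2 * (K + 1) * 9), (2 * (K + 1) + 2, 0), (0, 0),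
      (0, 0), (1, 0), (2, 0)]⟩,
    codePass (fun ℓ _ => List.replicate (2 * (K + 1)) (ℓ + 3, 9)) main
      (((specialRows K).length + (concatFrom (instrRows K) 0 main).length, digitRows K) ::
        ((specialRows K).flatMap (rowNats (2 * (K + 1)))).map fun n => (n, 0)),
    codePass (fun ℓ I => (instrRows K ℓ I).flatMap (rowTpl (2 * (K + 1)))) main []]

theorem nats_const_body (t : Template) (w : List Bool) (i : ℕ) :
    Pass.nats ⟨fun _ => [], t⟩ i w = t.nats (i + w.length) := by
  induction w generalizing i with
  | nil => rfl
  | cons b w ih =>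
    rw [Pass.nats, ih, List.length_cons, add_assoc, add_comm 1]
    rfl

/-- Three passes are needed: the header with the labels of the special states; the labels of the
cells, followed by the number of transitions and the special rows; and the rows of the code. -/
theorem encode_simGame {main : List Instr} {K : ℕ} {w : List Bool}
    (hc : ValidCode (wordCode main 0 w) K) :
    (simGame (wordCode main 0 w) K hc).encode = natsToWord (passesNats (gamePasses main K) w) := by
  change natsToWord (simGameCode (wordCode main 0 w) K hc).toNats = _
  congr 1
  have hlen := length_concatFrom_instrRows K main w 0
  rw [mul_zero] at hlen
  rw [toNats_simGameCode, allRows, List.flatMap_append, flatMap_concatFrom, List.length_append,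
    hlen, length_wordCode, ← add_assoc (specialRows K).length]
  simp only [passesNats, gamePasses, List.flatMap_cons, List.flatMap_nil, List.append_nil,
    nats_const_body]
  rw [nats_codePass (F' := fun ℓ _ => List.replicate (2 * (K + 1)) (ℓ + 3)),
    nats_codePass (F' := fun ℓ I => (instrRows K ℓ I).flatMap (rowNats (2 * (K + 1))))]
  · simp only [Template.nats, List.map_cons, List.map_nil, List.map_map, Function.comp_def,
      zero_mul, add_zero, List.map_id', zero_add, List.append_nil, List.append_assoc,
      List.cons_append, List.nil_append, mul_zero]
    congr 1
    · ring
  · intro i ℓ I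
    rw [instrRows_shift, List.flatMap_map, Template.nats, List.map_flatMap]
    exact List.flatMap_congr fun r _ => nats_rowTpl _ _ _
  · intro i ℓ I
    simp only [Template.nats, List.map_replicate]
    congr 1
    ring

/-- The code of the simulating game is computable in polynomial time. -/
theorem polyTimeComputable_simGame {α : Type} (code : α → List Bool) {main : List Instr} {K : ℕ}
    (hc : ∀ w, ValidCode (wordCode main 0 w) K) :
    PolyTimeComputable code LimObsGame.encode
      fun x => simGame (wordCode main 0 (code x)) K (hc (code x)) :=
  polyTimeComputable_passesNats (gamePasses main K) fun x => encode_simGame (hc (code x))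

/-! ### The code of the simulating game as a primitive recursive function of the word. -/

theorem primrec_templateNats (t : Template) : Primrec fun i => t.nats i := by
  have : Primrec₂ fun (i : ℕ) (p : ℕ × ℕ) => p.1 + p.2 * i := by
    show Primrec fun q : ℕ × ℕ × ℕ => q.2.1 + q.2.2 * q.1
    fun_prop
  exact Primrec.list_map (Primrec.const t) this

/-- A left fold whose state is the current position together with the output so far. -/
theorem primrec_passNats (P : Pass) : Primrec fun w : List Bool => P.nats 0 w := by
  have h : ∀ (w : List Bool) (i : ℕ) (l : List ℕ), l ++ P.nats i w =
      (fun s : ℕ × List ℕ => s.2 ++ P.last.nats s.1)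
        (w.foldl (fun s b => (s.1 + 1, s.2 ++ (P.body b).nats s.1)) (i, l)) := by
    intro w
    induction w with
    | nil => exact fun i l => rfl
    | cons b w ih =>
      intro i l
      rw [Pass.nats, ← List.append_assoc, ih]
      rfl
  have hbody : Primrec fun p : Bool × ℕ => (P.body p.1).nats p.2 :=
    (Primrec.cond Primrec.fst ((primrec_templateNats (P.body true)).comp Primrec.snd)
      ((primrec_templateNats (P.body false)).comp Primrec.snd)).of_eq fun p => by
        cases p.1 <;> rfl
  have hstep : Primrec₂ fun (_ : List Bool) (q : (ℕ × List ℕ) × Bool) =>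
      (q.1.1 + 1, q.1.2 ++ (P.body q.2).nats q.1.1) := by
    have h1 : Primrec fun q : List Bool × (ℕ × List ℕ) × Bool => (P.body q.2.2).nats q.2.1.1 :=
      hbody.comp (f := fun q => (P.body q.1).nats q.2)
        (g := fun q : List Bool × (ℕ × List ℕ) × Bool => (q.2.2, q.2.1.1)) (by fun_prop)
    show Primrec fun q : List Bool × (ℕ × List ℕ) × Bool =>
      (q.2.1.1 + 1, q.2.1.2 ++ (P.body q.2.2).nats q.2.1.1)
    fun_prop
  have hfold := Primrec.list_foldl Primrec.id (Primrec.const ((0 : ℕ), ([] : List ℕ))) hstep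
  have hlast : Primrec fun s : ℕ × List ℕ => s.2 ++ P.last.nats s.1 :=
    Primrec.list_append.comp Primrec.snd ((primrec_templateNats P.last).comp Primrec.fst)
  exact (hlast.comp hfold).of_eq fun w => by
    have := h w 0 []
    rw [List.nil_append] at this
    rw [this]
    rfl

theorem primrec_natsToWord : Primrec natsToWord := by
  have h : Primrec₂ fun (_ : List ℕ) (n : ℕ) => List.replicate n true ++ [false] := by
    have : Primrec fun n : ℕ => List.replicate n true :=
      (Primrec.list_map Primrec.list_range (Primrec₂.const true)).of_eq fun n => by simp
    exact (Primrec.list_append.comp this (Primrec.const [false])).comp Primrec.snd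
  exact Primrec.list_flatMap Primrec.id h

theorem primrec_encode_simGame {main : List Instr} {K : ℕ}
    (hc : ∀ w, ValidCode (wordCode main 0 w) K) :
    Primrec fun w => (simGame (wordCode main 0 w) K (hc w)).encode := by
  have h : ∀ Ps : List Pass, Primrec fun w : List Bool => passesNats Ps w := by
    intro Ps
    induction Ps with
    | nil => exact Primrec.const []
    | cons P Ps ih => exact Primrec.list_append.comp (primrec_passNats P) ih
  exact (primrec_natsToWord.comp (h (gamePasses main K))).of_eq fun w =>
    (encode_simGame (hc w)).symm

/-! ## A universal Turing machine -/

namespace DTM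

/-- Configurations given by numbers: the state, the tape to the left (nearest cell first), and the
tape from the head on. -/
abbrev RawCfg := ℕ × List ℕ × List ℕ

/-- The position in the code of the table entry for the configuration. -/
def rawBase (nums : List ℕ) (c : RawCfg) : ℕ :=
  4 * (c.1 * (nums.getD 1 0 + 1) + c.2.2.headI) + 5

/-- One step, for a machine given by its code; the configuration is unchanged if the machine has
halted. -/
def rawStep (nums : List ℕ) (c : RawCfg) : RawCfg :=
  if nums.getD (rawBase nums c) 0 = 0 then c else
    (nums.getD (rawBase nums c + 1) 0,
      if nums.getD (rawBase nums c + 3) 0 = 0 then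
        (c.2.1, nums.getD (rawBase nums c + 2) 0 :: c.2.2.tail)
      else if nums.getD (rawBase nums c + 3) 0 = 1 then
        (c.2.1.tail, c.2.1.headI :: nums.getD (rawBase nums c + 2) 0 :: c.2.2.tail)
      else (nums.getD (rawBase nums c + 2) 0 :: c.2.1, c.2.2.tail))

/-- The initial configuration. -/
def rawInit (nums : List ℕ) : RawCfg :=
  (nums.getD 2 0, [], nums.drop (4 * (nums.getD 0 0 * (nums.getD 1 0 + 1)) + 6))

/-- The configuration after `n` steps. -/
def rawRun (nums : List ℕ) (n : ℕ) : RawCfg := (rawStep nums)^[n] (rawInit nums)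

/-- The answer after `n` steps. -/
def rawAnswer (nums : List ℕ) (n : ℕ) : Option Bool :=
  if nums.getD (rawBase nums (rawRun nums n)) 0 = 0 then
    if (rawRun nums n).1 = nums.getD 3 0 then some true
    else if (rawRun nums n).1 = nums.getD 4 0 then some false else none
  else none

/-- The answer of the machine that is given by its code. -/
def universal (w : List Bool) : Part Bool := Nat.rfindOpt (rawAnswer (wordToNats w))

theorem primrec_rawBase : Primrec fun p : List ℕ × RawCfg => rawBase p.1 p.2 := by
  unfold rawBase
  fun_prop

theorem primrec_rawStep : Primrec₂ rawStep := by
  have hb := primrec_rawBase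
  have hd : ∀ k, Primrec fun p : List ℕ × RawCfg => p.1.getD (rawBase p.1 p.2 + k) 0 := by
    intro k
    fun_prop
  have h1 := hd 1
  have h2 := hd 2
  have h3 := hd 3
  refine Primrec.ite (PrimrecPred.fun_eq (hd 0) (Primrec.const 0)) Primrec.snd
    (h1.pair (Primrec.ite (PrimrecPred.fun_eq h3 (Primrec.const 0)) ?_
      (Primrec.ite (PrimrecPred.fun_eq h3 (Primrec.const 1)) ?_ ?_)))
  · fun_prop
  · fun_prop
  · fun_prop

theorem primrec_rawRun : Primrec fun p : List ℕ × ℕ => rawRun p.1 p.2 := by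
  have h1 : Primrec fun nums : List ℕ =>
      nums.drop (4 * (nums.getD 0 0 * (nums.getD 1 0 + 1)) + 6) :=
    Primrec.list_drop.comp (by fun_prop) Primrec.id
  have h2 : Primrec rawInit := by
    unfold rawInit
    fun_prop
  exact Primrec.nat_iterate Primrec.snd (h2.comp Primrec.fst)
    (primrec_rawStep.comp (Primrec.fst.comp Primrec.fst) Primrec.snd)

theorem primrec_rawAnswer : Primrec₂ rawAnswer := by
  have h1 := primrec_rawRun
  have hb : Primrec fun p : List ℕ × ℕ => rawBase p.1 (rawRun p.1 p.2) :=
    primrec_rawBase.comp (Primrec.fst.pair h1)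
  refine Primrec.ite (PrimrecPred.fun_eq (by fun_prop) (Primrec.const 0))
    (Primrec.ite (PrimrecPred.fun_eq (by fun_prop) (by fun_prop)) (Primrec.const _)
      (Primrec.ite (PrimrecPred.fun_eq (by fun_prop) (by fun_prop)) (Primrec.const _)
        (Primrec.const _))) (Primrec.const _)

theorem partrec_universal : Partrec universal :=
  Partrec.rfindOpt (primrec_rawAnswer.comp (primrec_wordToNats.comp Primrec.fst)
    Primrec.snd).to_comp

theorem rawRun_eq_of_le {nums : List ℕ} {n m : ℕ} (hn : n ≤ m)
    (h : nums.getD (rawBase nums (rawRun nums n)) 0 = 0) : rawRun nums m = rawRun nums n := by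
  induction hn with
  | refl => rfl
  | step _ ih => rw [rawRun, Function.iterate_succ_apply', ← rawRun, ih, rawStep, if_pos h]

/-- A halting configuration is a fixed point of `rawStep`, so an answer persists and the first one
found is the only one. -/
theorem mem_universal {w : List Bool} {b : Bool} :
    b ∈ universal w ↔ ∃ n, rawAnswer (wordToNats w) n = some b := by
  refine Nat.rfindOpt_mono fun {a m n} hmn h => ?_
  rw [Option.mem_def] at h ⊢
  have h0 : (wordToNats w).getD (rawBase (wordToNats w) (rawRun (wordToNats w) m)) 0 = 0 := by
    by_contra hn
    rw [rawAnswer, if_neg hn] at h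
    cases h
  rw [rawAnswer, rawRun_eq_of_le hmn h0, ← h]
  rfl

variable {M : DTM} {u : List (Fin (M.numSymbols + 1))}

/-- The configuration given by numbers represents a configuration of the machine. -/
def Represents (M : DTM) (c : RawCfg) (d : M.Cfg) : Prop :=
  ∃ l r : List (Fin (M.numSymbols + 1)), c = ((d.1 : ℕ), l.map Fin.val, r.map Fin.val) ∧
    d.2 = Turing.Tape.mk' (Turing.ListBlank.mk l) (Turing.ListBlank.mk r)

theorem headI_map_val {k : ℕ} (l : List (Fin (k + 1))) : (l.map Fin.val).headI = l.headI := by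
  cases l <;> rfl

/-- Five header numbers come before the transition table, whose entries take four numbers each. -/
theorem getD_toNats (M : DTM) (u : List (Fin (M.numSymbols + 1))) (q : Fin M.numStates)
    (b : Fin (M.numSymbols + 1)) {j : ℕ} (hj : j < 4) :
    (M.toNats u).getD (4 * ((q : ℕ) * (M.numSymbols + 1) + b) + 5 + j) 0 =
      (entryNats (M.δ q b)).getD j 0 := by
  have hl1 : ∀ q, ((List.finRange (M.numSymbols + 1)).flatMap fun b => entryNats (M.δ q b)).length =
      4 * (M.numSymbols + 1) := fun q => by simp [entryNats_length, mul_comm]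
  have h1 := GameCode.getD_flatMap (fun q => (List.finRange (M.numSymbols + 1)).flatMap fun b =>
    entryNats (M.δ q b)) _ hl1 0 (List.finRange M.numStates) q (by simp) (4 * b + j)
    (by have := b.2; omega)
  have h2 := GameCode.getD_flatMap (fun b => entryNats (M.δ q b)) 4 (fun _ => entryNats_length _) 0
    (List.finRange (M.numSymbols + 1)) b (by rw [List.length_finRange]; exact b.2) j hj
  simp only [List.getElem_finRange, Fin.cast_mk, Fin.eta] at h1 h2
  rw [← h2, ← h1, toNats, List.append_assoc, List.append_assoc]
  have hlt : 4 * (M.numSymbols + 1) * (q : ℕ) + (4 * (b : ℕ) + j) <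
      ((List.finRange M.numStates).flatMap fun q =>
        (List.finRange (M.numSymbols + 1)).flatMap fun b => entryNats (M.δ q b)).length := by
    have h3 : ((List.finRange M.numStates).flatMap fun q =>
        (List.finRange (M.numSymbols + 1)).flatMap fun b => entryNats (M.δ q b)).length =
        4 * (M.numSymbols + 1) * M.numStates := by
      simp [List.length_flatMap (l := List.finRange M.numStates), hl1, mul_comm]
    have := Nat.mul_le_mul_left (4 * (M.numSymbols + 1)) (Nat.succ_le_of_lt q.2)
    rw [h3]
    rw [Nat.mul_succ] at this
    have := b.2
    omega
  rw [show 4 * ((q : ℕ) * (M.numSymbols + 1) + b) + 5 + j =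
    (4 * (M.numSymbols + 1) * (q : ℕ) + (4 * (b : ℕ) + j)) + 5 by ring]
  rw [List.getD_append_right _ _ _ _ (by simp)]
  rw [show ∀ a : ℕ, a + 5 - [M.numStates, M.numSymbols, (M.start : ℕ), (M.accept : ℕ),
    (M.reject : ℕ)].length = a from fun a => by simp, List.getD_append _ _ _ _ hlt]

theorem getD_rawBase {c : RawCfg} {d : M.Cfg} (h : Represents M c d) {j : ℕ} (hj : j < 4) :
    (M.toNats u).getD (rawBase (M.toNats u) c + j) 0 =
      (entryNats (M.δ d.1 d.2.head)).getD j 0 := by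
  obtain ⟨l, r, rfl, hd⟩ := h
  have h1 : (M.toNats u).getD 1 0 = M.numSymbols := rfl
  rw [rawBase, h1]
  dsimp only
  rw [headI_map_val, getD_toNats M u _ _ hj, hd, Turing.Tape.mk'_head, Turing.ListBlank.head_mk]

theorem represents_rawInit : Represents M (rawInit (M.toNats u)) (M.start, Turing.Tape.mk₁ u) := by
  refine ⟨[], u, ?_, rfl⟩
  have h2 : M.toNats u = ([M.numStates, M.numSymbols, (M.start : ℕ), (M.accept : ℕ),
      (M.reject : ℕ)] ++ ((List.finRange M.numStates).flatMap fun q =>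
      (List.finRange (M.numSymbols + 1)).flatMap fun b => entryNats (M.δ q b)) ++
      [u.length]) ++ u.map Fin.val := rfl
  -- The input starts after the five header numbers, the table and the length of the input, which
  -- explains the summand `6`.
  have h3 : 4 * (M.numStates * (M.numSymbols + 1)) + 6 = ([M.numStates, M.numSymbols,
      (M.start : ℕ), (M.accept : ℕ),
      (M.reject : ℕ)] ++ ((List.finRange M.numStates).flatMap fun q =>
      (List.finRange (M.numSymbols + 1)).flatMap fun b => entryNats (M.δ q b)) ++
      [u.length]).length := by
    simp [entryNats_length]
    ring
  have h4 : rawInit (M.toNats u) = ((M.start : ℕ), [],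
      (M.toNats u).drop (4 * (M.numStates * (M.numSymbols + 1)) + 6)) := rfl
  rw [h4, h3, h2, List.drop_left]
  rfl

/-- Beyond the end of a list `headI` gives `0`, the blank, and `tail` gives the empty list. This
agrees with tape halves taken up to trailing blanks. -/
theorem represents_rawStep {c : RawCfg} {d d' : M.Cfg} (h : Represents M c d)
    (hs : M.step d = some d') : Represents M (rawStep (M.toNats u) c) d' := by
  have hg := fun j (hj : j < 4) => getD_rawBase (u := u) h hj
  rcases he : M.δ d.1 d.2.head with _ | ⟨q, b, m⟩
  · simp [step, he] at hs
  rw [he] at hg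
  have h0 := hg 0 (by norm_num)
  have h1 := hg 1 (by norm_num)
  have h2 := hg 2 (by norm_num)
  have h3 := hg 3 (by norm_num)
  simp only [entryNats, List.getD_cons_zero, List.getD_cons_succ, add_zero] at h0 h1 h2 h3
  rw [rawStep, h0, h1, h2, h3, if_neg one_ne_zero]
  simp only [step, he, Option.map_some, Option.some.injEq] at hs
  obtain ⟨l, r, rfl, hd⟩ := h
  subst hs
  rcases m with _ | _ | _
  · refine ⟨l, b :: r.tail, ?_, ?_⟩
    · simp [moveCode]
    · simp [hd, Turing.Tape.write_mk']
  · refine ⟨l.tail, l.headI :: b :: r.tail, ?_, ?_⟩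
    · simp [moveCode, headI_map_val]
    · simp [hd, Turing.Tape.write_mk', Turing.Tape.move_left_mk']
  · refine ⟨b :: l, r.tail, ?_, ?_⟩
    · simp [moveCode]
    · simp [hd, Turing.Tape.write_mk', Turing.Tape.move_right_mk']

theorem getD_rawBase_eq_zero {c : RawCfg} {d : M.Cfg} (h : Represents M c d) :
    (M.toNats u).getD (rawBase (M.toNats u) c) 0 = 0 ↔ M.step d = none := by
  have := getD_rawBase (u := u) h (j := 0) (by norm_num)
  rw [add_zero] at this
  rw [this, step]
  rcases M.δ d.1 d.2.head with _ | ⟨q, b, m⟩ <;> simp [entryNats]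

theorem haltsIn_iff (q : Fin M.numStates) : M.HaltsIn u q ↔
    ∃ n, (M.toNats u).getD (rawBase (M.toNats u) (rawRun (M.toNats u) n)) 0 = 0 ∧
      (rawRun (M.toNats u) n).1 = q := by
  constructor
  · rintro ⟨T, hr, hn⟩
    have key : ∀ d, StateTransition.Reaches M.step (M.start, Turing.Tape.mk₁ u) d →
        ∃ n, Represents M (rawRun (M.toNats u) n) d := by
      intro d hd
      induction hd with
      | refl => exact ⟨0, represents_rawInit⟩
      | tail _ hs ih =>
        obtain ⟨n, hn⟩ := ih
        refine ⟨n + 1, ?_⟩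
        rw [rawRun, Function.iterate_succ_apply', ← rawRun]
        exact represents_rawStep hn hs
    obtain ⟨n, h⟩ := key _ hr
    refine ⟨n, (getD_rawBase_eq_zero h).2 hn, ?_⟩
    obtain ⟨l, r, h, -⟩ := h
    rw [h]
  · rintro ⟨n, h0, hq⟩
    have key : ∀ n, ∃ d, StateTransition.Reaches M.step (M.start, Turing.Tape.mk₁ u) d ∧
        Represents M (rawRun (M.toNats u) n) d := by
      intro n
      induction n with
      | zero => exact ⟨_, Relation.ReflTransGen.refl, represents_rawInit⟩
      | succ n ih =>
        obtain ⟨d, hd, hr⟩ := ih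
        rw [rawRun, Function.iterate_succ_apply', ← rawRun]
        rcases hs : M.step d with _ | d'
        · exact ⟨d, hd, by rwa [rawStep, if_pos ((getD_rawBase_eq_zero hr).2 hs)]⟩
        · exact ⟨d', hd.tail hs, represents_rawStep hr hs⟩
    obtain ⟨d, hd, hr⟩ := key n
    have hn := (getD_rawBase_eq_zero hr).1 h0
    obtain ⟨l, r, h, -⟩ := hr
    rw [h] at hq
    obtain rfl := Fin.ext hq
    exact ⟨d.2, hd, hn⟩

theorem true_mem_universal (M : DTM) (u : List (Fin (M.numSymbols + 1))) :
    true ∈ universal (DTMInput.encode ⟨M, u⟩) ↔ M.Accepts u := by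
  rw [mem_universal, DTMInput.encode, wordToNats_natsToWord, Accepts, haltsIn_iff]
  refine exists_congr fun n => ?_
  have h3 : (M.toNats u).getD 3 0 = M.accept := rfl
  rw [rawAnswer, h3]
  generalize (M.toNats u).getD (rawBase (M.toNats u) (rawRun (M.toNats u) n)) 0 = f
  split_ifs <;> simp_all

theorem false_mem_universal (M : DTM) (u : List (Fin (M.numSymbols + 1))) :
    false ∈ universal (DTMInput.encode ⟨M, u⟩) ↔ M.Rejects u := by
  rw [mem_universal, DTMInput.encode, wordToNats_natsToWord, Rejects, haltsIn_iff]
  refine exists_congr fun n => ?_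
  have h3 : (M.toNats u).getD 3 0 = M.accept := rfl
  have h4 : (M.toNats u).getD 4 0 = M.reject := rfl
  -- Acceptance is tested first, so a rejecting halt is recognised only because the two states
  -- differ.
  have hne : (M.reject : ℕ) ≠ M.accept := fun h => M.accept_ne_reject (Fin.ext h).symm
  rw [rawAnswer, h3, h4]
  generalize (M.toNats u).getD (rawBase (M.toNats u) (rawRun (M.toNats u) n)) 0 = f
  split_ifs with h1 h2 h5
  · simp [h2, hne.symm]
  · simp [h5, h1]
  · simp [h5]
  · simp [h1]

end DTM

/-! ## The main theorem -/

/-- Every partial recursive predicate is reducible in polynomial time to the winner of the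
reachability games. -/
theorem exists_reduction {φ : List Bool →. Bool} (hφ : Partrec φ) :
    ∃ F : List Bool → LimObsGame,
      (∀ w, ((F w).game.assocGame.EveWins ↔ true ∈ φ w) ∧
        ((F w).game.assocGame.AdamWins ↔ false ∈ φ w)) ∧
      (∀ (α : Type) (code : α → List Bool),
        PolyTimeComputable code LimObsGame.encode fun x => F (code x)) ∧
      Primrec fun w => (F w).encode := by
  obtain ⟨main, K, hK, hm, hv, h⟩ := exists_wordCode hφ
  have hc := validCode_wordCode hK hm hv
  refine ⟨fun w => simGame _ K (hc w), fun w => ⟨?_, ?_⟩,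
    fun α code => polyTimeComputable_simGame code hc, primrec_encode_simGame hc⟩
  · rw [simGame_eveWins, h]
  · rw [simGame_adamWins, h]

/-- Words are used as unary code numbers of partial recursive functions. The game terminates
forcibly iff the function halts at `0`, so a decision procedure would solve the halting problem. -/
theorem not_decidableOn_forciblyTerminating :
    ¬ DecidableOn LimObsGame.encode (fun _ => True) fun G => G.game.ForciblyTerminating := by
  rintro ⟨d, hd, hdec⟩
  let φ : List Bool →. Bool := fun w =>
    ((Nat.Partrec.Code.ofNatCode w.length).eval 0).map fun _ => true
  have hlen : Computable fun w : List Bool => Nat.Partrec.Code.ofNatCode w.length :=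
    (Primrec.ofNat Nat.Partrec.Code).to_comp.comp Computable.list_length
  have hφ : Partrec φ :=
    (Nat.Partrec.Code.eval_part.comp hlen (Computable.const 0)).map
      (Computable.const true).to₂
  obtain ⟨F, hF, -, hprim⟩ := exists_reduction hφ
  have hterm : ∀ w, (F w).game.ForciblyTerminating ↔
      ((Nat.Partrec.Code.ofNatCode w.length).eval 0).Dom := by
    intro w
    rw [MPG.ForciblyTerminating, (hF w).1, (hF w).2]
    constructor
    · rintro (h | h)
      · exact Part.dom_iff_mem.2 ((Part.mem_map_iff _).1 h |>.imp fun _ h => h.1)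
      · exact Part.dom_iff_mem.2 ((Part.mem_map_iff _).1 h |>.imp fun _ h => h.1)
    · intro h
      obtain ⟨x, hx⟩ := Part.dom_iff_mem.1 h
      exact Or.inr ((Part.mem_map_iff _).2 ⟨x, hx, rfl⟩)
  refine ComputablePred.halting_problem 0 ?_
  rw [ComputablePred.computable_iff]
  have hword : Computable fun c : Nat.Partrec.Code =>
      (F (List.replicate (Encodable.encode c) true)).encode := by
    have h1 : Primrec fun n : ℕ => List.replicate n true :=
      (Primrec.list_map Primrec.list_range (Primrec₂.const true)).of_eq fun n => by simp
    exact (hprim.comp (h1.comp Primrec.encode)).to_comp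
  choose f hf hiff using fun c : Nat.Partrec.Code =>
    hdec (F (List.replicate (Encodable.encode c) true)) trivial
  refine ⟨f, Partrec.of_eq_tot (hd.comp hword) hf, ?_⟩
  funext c
  have h1 := (hiff c).trans (hterm _)
  rw [List.length_replicate] at h1
  have h2 : Nat.Partrec.Code.ofNatCode (Encodable.encode c) = c := Denumerable.ofNat_encode c
  rw [h2] at h1
  exact propext h1.symm

/-- For a decidable language the simulated predicate is total. One player thus always wins the
reachability game, and the certificates carry this over to the mean-payoff game. -/
theorem isRComplete_eveWins :
    IsRComplete LimObsGame.encode (fun G => G.game.ForciblyTerminating)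
      fun G => G.game.EveWins := by
  refine ⟨decidableOn_eveWins, fun L hL => ?_⟩
  obtain ⟨f, hf, rfl⟩ := ComputablePred.computable_iff.1 hL
  obtain ⟨F, hF, hpoly, -⟩ := exists_reduction (φ := fun w => Part.some (f w)) hf
  refine ⟨F, hpoly _ id, fun u => ?_⟩
  obtain ⟨he, ha⟩ := hF u
  simp only [Part.mem_some_iff] at he ha
  have : Nonempty (Fin (F u).1.numActions) := ⟨⟨0, (F u).1.numActions_pos⟩⟩
  rcases hu : f u with _ | _
  · have h := ha.2 hu.symm
    exact ⟨Or.inl h, iff_of_false (by simp [hu]) (MPG.not_eveWins_of_assocGame h)⟩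
  · have h := he.2 hu.symm
    exact ⟨Or.inr h, iff_of_true hu (MPG.eveWins_of_assocGame (F u).2 h)⟩

theorem mainTheorem6 :
    (∃ f : DTMInput → LimObsGame,
      PolyTimeComputable DTMInput.encode LimObsGame.encode f ∧
      ∀ (M : DTM) (u : List (Fin (M.numSymbols + 1))),
        ((f ⟨M, u⟩).game.assocGame.EveWins ↔ M.Accepts u) ∧
        ((f ⟨M, u⟩).game.assocGame.AdamWins ↔ M.Rejects u)) ∧
    (¬ DecidableOn LimObsGame.encode (fun _ => True) (fun G => G.game.ForciblyTerminating)) ∧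
    IsRComplete LimObsGame.encode (fun G => G.game.ForciblyTerminating)
      (fun G => G.game.EveWins) := by
  refine ⟨?_, not_decidableOn_forciblyTerminating, isRComplete_eveWins⟩
  obtain ⟨F, hF, hpoly, -⟩ := exists_reduction DTM.partrec_universal
  refine ⟨fun x => F x.encode, hpoly _ _, fun M u => ?_⟩
  rw [← DTM.true_mem_universal, ← DTM.false_mem_universal]
  exact hF _
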